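/- Let $(M,\omega)$ be a connected symplectic manifold of dimension $2n$ (Hausdorff, second countable, possibly with boundary). $M$ is called closed if it is compact without boundary, and open otherwise. Conventions: $df=\omega(X_f,\cdot)$; for a smooth Hamiltonian $F:[0,1]\times M\to\mathbb R$, $F_t=F(t,\cdot)$, $\phi_F^t$ denotes the flow of $X_{F_t}$ on $[0,1]$, and $F$ generates $\phi$ if $\phi_F^1=\phi$. Call $F$ normalized if, for $M$ closed, $\int_M F_t\,\frac{\omega^n}{n!}=0$ for all $t\in[0,1]$, and, for $M$ open, $F$ vanishes outside $[0,1]\times K$ for some compact subset $K$ of the interior of $M$. Let $\widetilde\Omega_0(M)$ be the set of classes $[\gamma,w]$, where $\gamma:[0,1]\to M$, $\gamma(0)=\gamma(1)$, is a contractible loop and $w:D^2\to M$ is a disc with $w(e^{2\pi i t})=\gamma(t)$ (such that $(r,t)\mapsto w(re^{2\pi it})$ is smooth on $[0,1]^2$), and where $(\gamma,w)$ and $(\gamma,w')$ are identified if the sphere $w'\#\overline w$ satisfies $\omega([w'\#\overline w])=0$ and $c_1([w'\#\overline w])=0$. Let $$\mathcal A_F([\gamma,w])=-\int w^*\omega-\int_0^1F(t,\gamma(t))\,dt,$$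 let $\mathrm{Crit}(\mathcal A_F)$ be the set of those $[z,w]$ for which $z$ is an orbit of $X_F$ with $z(0)=z(1)$, and let $\mathrm{Spec}(F)=\mathcal A_F(\mathrm{Crit}(\mathcal A_F))\subset\mathbb R$. For $H$ with flow $h_t=\phi_H^t$ put $(H\#G)(t,x)=H(t,x)+G(t,h_t^{-1}(x))$. Let $F$ and $G$ be normalized Hamiltonians generating the same diffeomorphism $\phi$ with $F\sim G$, that is, there is a smooth family $F^s$, $s\in[0,1]$, of normalized Hamiltonians, $F^0=G$, $F^1=F$, such that $f^s_t=\phi^t_{F^s}$ is a smooth family of diffeomorphisms and $f^s_1=\phi$ for all $s$. Put $f_t=f^1_t$, $g_t=f^0_t$, and let $h$ be the loop $h_t=f_t\circ g_t^{-1}$ of diffeomorphisms, with the contraction $\widetilde h(re^{2\pi it})=f^r_t\circ g_t^{-1}$. Then: 1. The canonical lifting $\widetilde h\cdot[\gamma,w]=[h\cdot\gamma,\widetilde h\cdot w]$, where $(h\cdot\gamma)(t)=h_t(\gamma(t))$ and $(\widetilde h\cdot w)(y)=\widetilde h(y)(w(y))$, is a well-defined map $\widetilde\Omega_0(M)\to\widetilde\Omega_0(M)$.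 2. There is a normalized Hamiltonian generating the loop $h$ (that is, with flow $h_t$). For each such $H$, the lifting preserves the action, $$\mathcal A_{H\#G}(\widetilde h\cdot[\gamma,w])=\mathcal A_G([\gamma,w])\quad\text{for all }[\gamma,w]\in\widetilde\Omega_0(M),$$ and maps $\mathrm{Crit}(\mathcal A_G)$ bijectively onto $\mathrm{Crit}(\mathcal A_{H\#G})$. 3. $\mathrm{Spec}(F)=\mathrm{Spec}(G)$ as subsets of $\mathbb R$, with no shift by a constant. -/

import Mathlib

open Set MeasureTheory
open scoped Manifold ContDiff

noncomputable section

namespace HamSpec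

/-- The model vector space `ℝ²ⁿ`. -/
abbrev E (n : ℕ) : Type := EuclideanSpace ℝ (Fin (2 * n))

/-- The closed unit interval `[0,1]`. -/
abbrev J : Set ℝ := Icc 0 1

/-- The closed unit square. It carries the parameters `(s,t)` of a homotopy of isotopies, and the
polar coordinates `(r,t)` of the point `r e^{2πit}` of the closed unit disc. -/
abbrev Sq : Set (ℝ × ℝ) := J ×ˢ J

section

variable {n : ℕ} {H : Type*} [TopologicalSpace H] (I : ModelWithCorners ℝ (E n) H)
  {M : Type*} [TopologicalSpace M] [ChartedSpace H M]

/-- The coordinate expression, in the chart at `x₀`, of a field of bilinear forms on `M`. -/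
def localForm (σ : ∀ x : M, TangentSpace I x →L[ℝ] TangentSpace I x →L[ℝ] ℝ) (x₀ : M) (y : E n) :
    E n →L[ℝ] E n →L[ℝ] ℝ :=
  let D : E n →L[ℝ] E n :=
    mfderivWithin 𝓘(ℝ, E n) I (extChartAt I x₀).symm (range I) y
  let B : E n →L[ℝ] E n →L[ℝ] ℝ := σ ((extChartAt I x₀).symm y)
  B.bilinearComp D D

variable (M) in
/-- A symplectic form: a smooth, alternating, nondegenerate, closed 2-form. Smoothness and
`dω = 0` are expressed in the charts at the points of `M`. -/
structure SymplecticForm [IsManifold I ∞ M] where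
  form (x : M) : TangentSpace I x →L[ℝ] TangentSpace I x →L[ℝ] ℝ
  smooth (x₀ : M) : ContDiffOn ℝ ∞ (localForm I form x₀) (extChartAt I x₀).target
  alternating (x : M) (v : TangentSpace I x) : form x v v = 0
  nondegenerate (x : M) (v : TangentSpace I x) : (∀ w, form x v w = 0) → v = 0
  closed (x₀ : M) (y : E n) (_ : y ∈ (extChartAt I x₀).target) (u v w : E n) :
    fderivWithin ℝ (localForm I form x₀) (range I) y u v w
      + fderivWithin ℝ (localForm I form x₀) (range I) y v w u
      + fderivWithin ℝ (localForm I form x₀) (range I) y w u v = 0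

variable (M) in
/-- A pair `(γ,w)` of a contractible loop `γ` in `M` and a disc `w` bounding it. The disc is given
in polar coordinates, `disc (r,t) = w (r e^{2πit})`, and is smooth in these coordinates; `γ` is its
restriction to the boundary circle. (The loop may have a corner at `t = 0`: the orbits of
Hamiltonians that are not periodic in time are such loops.) -/
structure CappedLoop where
  disc : ℝ × ℝ → M
  smooth : ContMDiffOn 𝓘(ℝ, ℝ × ℝ) I ∞ disc Sq
  center (t : ℝ) (_ : t ∈ J) : disc (0, t) = disc (0, 0)
  closed (r : ℝ) (_ : r ∈ J) : disc (r, 1) = disc (r, 0)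

end

section

variable {n : ℕ} {H : Type*} [TopologicalSpace H] {I : ModelWithCorners ℝ (E n) H}
  {M : Type*} [TopologicalSpace M] [ChartedSpace H M]

/-- The loop `γ` of a pair `(γ,w)`. -/
def CappedLoop.loop (u : CappedLoop I M) (t : ℝ) : M := u.disc (1, t)

variable [IsManifold I ∞ M] (σ : SymplecticForm I M)

/-- The bilinear form `ω_x` on `T_xM`. As a type, each tangent space of `M` is the model space, and
tangent vectors are written as elements of the model space from here on. -/
def SymplecticForm.bil (x : M) : E n →L[ℝ] E n →L[ℝ] ℝ := σ.form x

/-! ### Liouville measure -/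

/-- The Liouville measure on the domain of the chart at `x₀`: the density of `ωⁿ/n!` in coordinates
is the absolute value of the Pfaffian of the matrix `ω_ij`. -/
def chartMeasure [MeasurableSpace M] (x₀ : M) : Measure M :=
  Measure.map (extChartAt I x₀).symm
    ((volume.restrict (extChartAt I x₀).target).withDensity fun y =>
      ENNReal.ofReal (Real.sqrt (Matrix.det (Matrix.of fun i j : Fin (2 * n) =>
        localForm I σ.form x₀ y (EuclideanSpace.single i 1) (EuclideanSpace.single j 1)))))

/-- The Liouville measure `dμ = ωⁿ/n!`: the least measure that dominates the measures in the
charts. As these agree on overlaps, it restricts to each of them. -/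
def liouville [MeasurableSpace M] : Measure M := ⨆ x₀ : M, chartMeasure σ x₀

/-! ### Hamiltonians and their flows -/

/-- The Hamiltonian `F : [0,1] × M → ℝ` (as a function of `(t,x)`) is smooth. -/
def SmoothHam (I : ModelWithCorners ℝ (E n) H) (F : ℝ → M → ℝ) : Prop :=
  ContMDiffOn (𝓘(ℝ, ℝ).prod I) 𝓘(ℝ, ℝ) ∞ (fun q : ℝ × M => F q.1 q.2) (J ×ˢ univ)

/-- The velocity at time `t`, in `T_{z(t)}M`, of a curve `z` parametrized by `[0,1]`. -/
def velocity (I : ModelWithCorners ℝ (E n) H) (z : ℝ → M) (t : ℝ) : E n :=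
  (mfderivWithin 𝓘(ℝ, ℝ) I z J t : ℝ →L[ℝ] E n) 1

/-- The differential at `x`, on `T_xM`, of a function `h` on `M`. -/
def differential (I : ModelWithCorners ℝ (E n) H) (h : M → ℝ) (x : M) : E n →L[ℝ] ℝ :=
  mfderiv I 𝓘(ℝ, ℝ) h x

/-- The differential at `p` of a map `w : [0,1]² → M`, with values in `T_{w(p)}M`. -/
def differentialSq (I : ModelWithCorners ℝ (E n) H) (w : ℝ × ℝ → M) (p : ℝ × ℝ) :
    ℝ × ℝ →L[ℝ] E n :=
  mfderivWithin 𝓘(ℝ, ℝ × ℝ) I w Sq p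

/-- `z : [0,1] → M` solves `ż = X_F(t,z)`, where `X_F` is defined by `dF_t = ω(X_F, ·)`. -/
def IsHamOrbit (F : ℝ → M → ℝ) (z : ℝ → M) : Prop :=
  ContMDiffOn 𝓘(ℝ, ℝ) I ∞ z J ∧
    ∀ t ∈ J, ∀ v : E n, σ.bil (z t) (velocity I z t) v = differential I (F t) (z t) v

/-- The smooth Hamiltonian `F` generates the smooth isotopy `(f_t)`, `t ∈ [0,1]`, that is,
`f_t = φ_F^t`. -/
structure Generates (F : ℝ → M → ℝ) (f : ℝ → M ≃ₘ⟮I, I⟯ M) : Prop where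
  smooth_ham : SmoothHam I F
  smooth : ContMDiffOn (𝓘(ℝ, ℝ).prod I) I ∞ (fun q : ℝ × M => f q.1 q.2) (J ×ˢ univ)
  smooth_symm :
    ContMDiffOn (𝓘(ℝ, ℝ).prod I) I ∞ (fun q : ℝ × M => (f q.1).symm q.2) (J ×ˢ univ)
  zero (x : M) : f 0 x = x
  orbit (x : M) : IsHamOrbit σ F (fun t => f t x)

variable (I M) in
/-- `M` is closed: compact without boundary. Otherwise `M` is called open. -/
def IsClosedMfd : Prop := CompactSpace M ∧ I.boundary M = ∅

/-- Normalized Hamiltonians: of mean value zero at each time if `M` is closed, and supported in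
`[0,1] × K` for a compact subset `K` of the interior of `M` if `M` is open. -/
def IsNormalized [MeasurableSpace M] (F : ℝ → M → ℝ) : Prop :=
  (IsClosedMfd I M ∧ ∀ t ∈ J, ∫ x, F t x ∂(liouville σ) = 0) ∨
    (¬ IsClosedMfd I M ∧ ∃ K : Set M, IsCompact K ∧ K ⊆ I.interior M ∧
      ∀ t ∈ J, ∀ x, x ∉ K → F t x = 0)

/-- The set of normalized Hamiltonians generating `φ`: this is `ℋ_m(φ)` if `M` is closed, and
`ℋ_c(φ)` if `M` is open. -/
def normalizedHam [MeasurableSpace M] (φ : M ≃ₘ⟮I, I⟯ M) : Set (ℝ → M → ℝ) :=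
  {F | IsNormalized σ F ∧ ∃ f : ℝ → M ≃ₘ⟮I, I⟯ M, Generates σ F f ∧ f 1 = φ}

/-- `H # G (t,x) = H(t,x) + G(t, (φ_H^t)⁻¹ x)`, where `h_t = φ_H^t`. -/
def hash (H : ℝ → M → ℝ) (h : ℝ → M ≃ₘ⟮I, I⟯ M) (G : ℝ → M → ℝ) : ℝ → M → ℝ :=
  fun t x => H t x + G t ((h t).symm x)

/-- A homotopy `(F^s)`, `s ∈ [0,1]`, from `F^0 = G` to `F^1 = F` through normalized Hamiltonians
generating `φ`, with the isotopy `f^s_t = φ_{F^s}^t` of their paths of Hamiltonian diffeomorphisms.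
Both are smooth in all variables. -/
structure HamHomotopy [MeasurableSpace M] (φ : M ≃ₘ⟮I, I⟯ M) (G F : ℝ → M → ℝ) where
  ham : ℝ → ℝ → M → ℝ
  flow : ℝ → ℝ → M ≃ₘ⟮I, I⟯ M
  smooth_ham : ContMDiffOn (𝓘(ℝ, ℝ × ℝ).prod I) 𝓘(ℝ, ℝ) ∞
    (fun q : (ℝ × ℝ) × M => ham q.1.1 q.1.2 q.2) (Sq ×ˢ univ)
  smooth_flow : ContMDiffOn (𝓘(ℝ, ℝ × ℝ).prod I) I ∞
    (fun q : (ℝ × ℝ) × M => flow q.1.1 q.1.2 q.2) (Sq ×ˢ univ)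
  smooth_flow_symm : ContMDiffOn (𝓘(ℝ, ℝ × ℝ).prod I) I ∞
    (fun q : (ℝ × ℝ) × M => (flow q.1.1 q.1.2).symm q.2) (Sq ×ˢ univ)
  normalized (s : ℝ) (_ : s ∈ J) : IsNormalized σ (ham s)
  generates (s : ℝ) (_ : s ∈ J) : Generates σ (ham s) (flow s)
  flow_one (s : ℝ) (_ : s ∈ J) : flow s 1 = φ
  ham_zero (t : ℝ) (_ : t ∈ J) : ham 0 t = G t
  ham_one (t : ℝ) (_ : t ∈ J) : ham 1 t = F t

/-! ### The covering space of capped loops -/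

/-- The symplectic area `∫ w^*ω` of the disc `w`. In the polar coordinates `(r,t)` the disc is
positively oriented by `(∂_r, ∂_t)`. -/
def area (u : CappedLoop I M) : ℝ :=
  ∫ r in (0 : ℝ)..1, ∫ t in (0 : ℝ)..1,
    σ.bil (u.disc (r, t)) (differentialSq I u.disc (r, t) (1, 0))
      (differentialSq I u.disc (r, t) (0, 1))

/-- A symplectic trivialization of `w^*TM` over the disc: a continuous frame
`(e₁, …, e_n, f₁, …, f_n)` that is a symplectic basis of the tangent space at each point `w(p)`. It
is written in polar coordinates, so it has to be constant at the centre and to agree at `t = 0` and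
`t = 1`, where the base points agree. -/
structure SympFrame (u : CappedLoop I M) where
  e (p : ℝ × ℝ) (i : Fin n) : E n
  f (p : ℝ × ℝ) (i : Fin n) : E n
  continuous_e (i : Fin n) :
    ContinuousOn (fun p => (⟨u.disc p, e p i⟩ : TangentBundle I M)) Sq
  continuous_f (i : Fin n) :
    ContinuousOn (fun p => (⟨u.disc p, f p i⟩ : TangentBundle I M)) Sq
  center_e (t : ℝ) (_ : t ∈ J) (i : Fin n) : e (0, t) i = e (0, 0) i
  center_f (t : ℝ) (_ : t ∈ J) (i : Fin n) : f (0, t) i = f (0, 0) i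
  closed_e (r : ℝ) (_ : r ∈ J) (i : Fin n) : e (r, 1) i = e (r, 0) i
  closed_f (r : ℝ) (_ : r ∈ J) (i : Fin n) : f (r, 1) i = f (r, 0) i
  form_ee (p : ℝ × ℝ) (_ : p ∈ Sq) (i j : Fin n) : σ.bil (u.disc p) (e p i) (e p j) = 0
  form_ff (p : ℝ × ℝ) (_ : p ∈ Sq) (i j : Fin n) : σ.bil (u.disc p) (f p i) (f p j) = 0
  form_ef (p : ℝ × ℝ) (_ : p ∈ Sq) (i j : Fin n) :
    σ.bil (u.disc p) (e p i) (f p j) = if i = j then 1 else 0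

/-- Let `w` and `w'` bound the same loop `γ`, with symplectic trivializations `b` and `b'`. At
`γ(t)` the frame `b` is expressed in the frame `b'` by a symplectic matrix `[[A, B], [C, D]]`,
where `A_ij = ω(e_j, f'_i)`, `B_ij = ω(f_j, f'_i)`, `C_ij = ω(e'_i, e_j)`, `D_ij = ω(e'_i, f_j)`.
This is the complex determinant of its complex linear part `((A + D) + i (C - B)) / 2`, which is
never zero. -/
def transitionDet {u u' : CappedLoop I M} (b : SympFrame σ u) (b' : SympFrame σ u') (t : ℝ) : ℂ :=
  Matrix.det (Matrix.of fun i j : Fin n =>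
    (((σ.bil (u.loop t) (b.e (1, t) j) (b'.f (1, t) i)
        + σ.bil (u.loop t) (b'.e (1, t) i) (b.f (1, t) j) : ℝ) : ℂ)
      + ((σ.bil (u.loop t) (b'.e (1, t) i) (b.e (1, t) j)
        - σ.bil (u.loop t) (b.f (1, t) j) (b'.f (1, t) i) : ℝ) : ℂ) * Complex.I) / 2)

/-- `c₁([w' # w̄]) = k` for two discs `w`, `w'` bounding the same loop: the first Chern number of the
bundle over the sphere glued from `w^*TM` and `w'^*TM` is the Maslov index of the clutching loop of
symplectic matrices, that is, the winding number around `0` of the complex determinant of their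
complex linear parts. -/
def HasChernNumber (u u' : CappedLoop I M) (k : ℤ) : Prop :=
  ∃ (b : SympFrame σ u) (b' : SympFrame σ u') (L : ℝ → ℂ), ContinuousOn L J ∧
    (∀ t ∈ J, Complex.exp (L t) = transitionDet σ b b' t) ∧
    L 1 - L 0 = 2 * Real.pi * Complex.I * k

/-- `Γ`-equivalence of `(γ,w)` and `(γ,w')`: `ω([w' # w̄]) = 0` and `c₁([w' # w̄]) = 0`. -/
def GammaEquiv (u u' : CappedLoop I M) : Prop :=
  (∀ t ∈ J, u.loop t = u'.loop t) ∧ area σ u' - area σ u = 0 ∧ HasChernNumber σ u u' 0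

/-- The covering space of the space of contractible loops: the set of `Γ`-equivalence
classes `[γ,w]`. -/
def GammaCover : Type _ := Quot (GammaEquiv σ)

/-- The class `[γ,w]`. -/
def GammaCover.mk (u : CappedLoop I M) : GammaCover σ := Quot.mk _ u

/-! ### Action functional and action spectrum -/

/-- The action functional `A_F([γ,w]) = - ∫ w^*ω - ∫_0^1 F(t,γ(t)) dt`. -/
def action (F : ℝ → M → ℝ) : GammaCover σ → ℝ :=
  Quot.lift (fun u => - area σ u - ∫ t in (0 : ℝ)..1, F t (u.loop t)) (by
    rintro u u' ⟨h, ha, -⟩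
    have h1 : ∫ t in (0 : ℝ)..1, F t (u.loop t) = ∫ t in (0 : ℝ)..1, F t (u'.loop t) := by
      refine intervalIntegral.integral_congr fun t ht => ?_
      rw [uIcc_of_le zero_le_one] at ht
      simp only [h t ht]
    have h2 : area σ u = area σ u' := by linarith
    simp only [h1, h2])

/-- The critical points of `A_F`: the classes `[z,w]` with `z` a periodic orbit of `X_F`. -/
def crit (F : ℝ → M → ℝ) : Set (GammaCover σ) :=
  {x | ∃ u : CappedLoop I M, GammaCover.mk σ u = x ∧ IsHamOrbit σ F u.loop}

/-- The action spectrum `Spec(F)`. -/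
def spec (F : ℝ → M → ℝ) : Set ℝ := action σ F '' crit σ F

/-! ### The canonical lifting -/

variable {σ}

/-- The loop `h_t = f_t ∘ g_t⁻¹`. -/
def HamHomotopy.loop [MeasurableSpace M] {φ : M ≃ₘ⟮I, I⟯ M} {G F : ℝ → M → ℝ}
    (P : HamHomotopy σ φ G F) (t : ℝ) : M ≃ₘ⟮I, I⟯ M :=
  (P.flow 0 t).symm.trans (P.flow 1 t)

/-- The homotopy gives the contraction `h̃(r e^{2πit}) = f^r_t ∘ g_t⁻¹` of the loop `h` over the
disc. It acts on pairs by `h̃ · (γ,w) = (h · γ, h̃ · w)`, where `(h · γ)(t) = h_t(γ(t))` and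
`(h̃ · w)(y) = h̃(y)(w(y))` for `y` in the disc. -/
def HamHomotopy.liftPair [MeasurableSpace M] {φ : M ≃ₘ⟮I, I⟯ M} {G F : ℝ → M → ℝ}
    (P : HamHomotopy σ φ G F) (u : CappedLoop I M) : CappedLoop I M where
  disc p := P.flow p.1 p.2 ((P.flow 0 p.2).symm (u.disc p))
  smooth := by
    have h0 : (0 : ℝ) ∈ J := ⟨le_rfl, zero_le_one⟩
    have hsnd : ContMDiffOn 𝓘(ℝ, ℝ × ℝ) 𝓘(ℝ, ℝ) ∞ (fun p : ℝ × ℝ => p.2) Sq :=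
      contDiff_snd.contMDiff.contMDiffOn
    have h1 : ContMDiffOn 𝓘(ℝ, ℝ × ℝ) I ∞
        (fun p : ℝ × ℝ => (P.flow 0 p.2).symm (u.disc p)) Sq :=
      (P.generates 0 h0).smooth_symm.comp (hsnd.prodMk u.smooth)
        (fun p hp => ⟨hp.2, mem_univ _⟩)
    exact P.smooth_flow.comp (contMDiffOn_id.prodMk h1) (fun p hp => ⟨hp, mem_univ _⟩)
  center t ht := by
    simp [u.center t ht]
  closed r hr := by
    have h0 : (0 : ℝ) ∈ J := ⟨le_rfl, zero_le_one⟩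
    have e0 : ∀ x, (P.flow 0 0).symm x = x := fun x => by
      conv_lhs => rw [← (P.generates 0 h0).zero x]
      simp
    simp [P.flow_one r hr, P.flow_one 0 h0, u.closed r hr, e0, (P.generates r hr).zero]

end

end HamSpec

end

/-! Everything is pulled back to parameter space. For a map v into M put Φ(s,t,q) = f^s_t(v(q))
(`sweep`). As ∂_tΦ is the Hamiltonian vector field, contracting Φ^*ω with ∂_t gives d(F∘Φ) minus the
derivative of F in its explicit parameters (`bil_sweep_time`). Closedness of Φ^*ω then says two
things: each f^s_t is symplectic, and ∂_t ω(∂_sΦ, ∂_ξΦ) = ∂_ξ(Ḟ∘Φ), where Ḟ = ∂_sF is `hamDot`.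

Since f^s_0 = id and f^s_1 = φ do not depend on s, ∂_sΦ vanishes at t = 0 and t = 1. Along a curve
u(τ), the closed 1-form Ḟ dt + ω(∂_sΦ, ∂_τΦ) dτ on the (t,τ)-square is therefore invisible on these
two sides. Hence c(s) = ∫ Ḟ(s,t,f^s_t(x)) dt does not depend on x, and the same number is the
integral of the form along the diagonal τ = t. The diagonal version, applied to the circle of radius
r = s in the disc g_t⁻¹∘w, gives `area_sub_area`: the area of the disc changes under the lifting by
∫ c(s) ds minus the change of the Hamiltonian term, so the action changes by -∫ c(s) ds.

Normalization makes ∫ c(s) ds vanish (`flux_eq_zero`). On a closed M, average over x: symplectic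
maps preserve the Liouville measure, so the average of Ḟ along the flow is that of Ḟ, which
integrates to the difference of two vanishing means. On a compact M with boundary, evaluate c(s) at
a boundary point, which never enters a support. On a noncompact M no uniformity in s of the compact
supports is given; a Baire argument yields a common compact support near each s in a dense open set,
where c(s) is computed on a trajectory avoiding that compact set, and continuity of c does the rest.

The lifting descends to classes because the area correction depends only on the boundary loop, and
because symplectic frames can be transported along the disc without changing the transition
matrices. Its inverse comes from the inverse diffeomorphisms. Finally a normalized Hamiltonian is
determined by its isotopy, so H # G = F on [0,1] for every normalized H generating the loop
(`hash_eq`), and all claims reduce to F and G. -/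

open Set MeasureTheory
open scoped Manifold ContDiff

noncomputable section

namespace HamSpec

/-! ### Chain rule for parametrized families of maps -/

section TotalDerivative

variable {n : ℕ} {H : Type*} [TopologicalSpace H] {I : ModelWithCorners ℝ (E n) H}
  {M : Type*} [TopologicalSpace M] [ChartedSpace H M]
  {A : Type*} [NormedAddCommGroup A] [NormedSpace ℝ A]
  {V : Type*} [NormedAddCommGroup V] [NormedSpace ℝ V]
  {E' : Type*} [NormedAddCommGroup E'] [NormedSpace ℝ E']
  {H' : Type*} [TopologicalSpace H'] {I' : ModelWithCorners ℝ E' H'}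
  {N : Type*} [TopologicalSpace N] [ChartedSpace H' N]

/-- The chain rule for `p ↦ f (τ p) (Φ p)`, where `f` is a family of maps of `M` parametrized by a
subset of a normed space. -/
theorem mfderivWithin_family [IsManifold I ∞ M] [IsManifold I' ∞ N]
    {f : A → M → N} {S₀ : Set A} (hS₀ : UniqueDiffOn ℝ S₀)
    (hf : ContMDiffOn (𝓘(ℝ, A).prod I) I' ∞ (fun q : A × M => f q.1 q.2) (S₀ ×ˢ univ))
    {τ : V → A} {Φ : V → M} {S : Set V} (hS : UniqueDiffOn ℝ S)
    (hτ : DifferentiableOn ℝ τ S) (hτm : MapsTo τ S S₀)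
    (hΦ : MDifferentiableOn 𝓘(ℝ, V) I Φ S) {p : V} (hp : p ∈ S) (X : V) :
    (mfderivWithin 𝓘(ℝ, V) I' (fun p => f (τ p) (Φ p)) S p : V →L[ℝ] E') X =
      (mfderivWithin 𝓘(ℝ, A) I' (fun a => f a (Φ p)) S₀ (τ p) : A →L[ℝ] E')
        (fderivWithin ℝ τ S p X) +
      (mfderiv I I' (f (τ p)) (Φ p) : E n →L[ℝ] E')
        ((mfderivWithin 𝓘(ℝ, V) I Φ S p : V →L[ℝ] E n) X) := by
  have hu : UniqueMDiffOn (𝓘(ℝ, A).prod I) (S₀ ×ˢ (univ : Set M)) :=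
    (uniqueMDiffOn_iff_uniqueDiffOn.2 hS₀).prod uniqueMDiffOn_univ
  set tot : A × M → N := fun q => f q.1 q.2 with htot
  have hmem : ((τ p, Φ p) : A × M) ∈ S₀ ×ˢ (univ : Set M) := ⟨hτm hp, mem_univ _⟩
  have hd : MDifferentiableWithinAt (𝓘(ℝ, A).prod I) I' tot (S₀ ×ˢ univ) (τ p, Φ p) :=
    (hf _ hmem).mdifferentiableWithinAt (by simp)
  have hSp : UniqueMDiffWithinAt 𝓘(ℝ, V) S p := (uniqueMDiffOn_iff_uniqueDiffOn.2 hS) p hp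
  have hτp : MDifferentiableWithinAt 𝓘(ℝ, V) 𝓘(ℝ, A) τ S p :=
    (hτ p hp).mdifferentiableWithinAt
  have hS₀p := (uniqueMDiffOn_iff_uniqueDiffOn.2 hS₀) _ (hτm hp)
  have h1 := (hd.hasMFDerivWithinAt.comp (I := 𝓘(ℝ, V)) p (f := fun p => (τ p, Φ p))
    (hτp.hasMFDerivWithinAt.prodMk (hΦ p hp).hasMFDerivWithinAt)
    (fun q hq => ⟨hτm hq, mem_univ _⟩)).mfderivWithin hSp
  have h2 := (hd.hasMFDerivWithinAt.comp (I := 𝓘(ℝ, A)) (τ p) (f := fun a => (a, Φ p))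
    ((hasMFDerivWithinAt_id _ _).prodMk (hasMFDerivWithinAt_const _ _ _))
    (fun q hq => ⟨hq, mem_univ _⟩)).mfderivWithin hS₀p
  have h3 := (hd.hasMFDerivWithinAt.comp (I := I) (Φ p) (f := fun x => (τ p, x)) (s := univ)
    ((hasMFDerivWithinAt_const _ _ _).prodMk (hasMFDerivWithinAt_id _ _))
    (fun q hq => ⟨hτm hp, mem_univ _⟩)).mfderivWithin (uniqueMDiffWithinAt_univ I)
  rw [mfderivWithin_univ] at h3
  have e1 := congrArg (fun L : V →L[ℝ] E' => L X) h1
  have e2 := congrArg (fun L : A →L[ℝ] E' => L (fderivWithin ℝ τ S p X)) h2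
  have e3 := congrArg (fun L : E n →L[ℝ] E' =>
    L ((mfderivWithin 𝓘(ℝ, V) I Φ S p : V →L[ℝ] E n) X)) h3
  refine e1.trans ((?_ : _ = _).trans (congrArg₂ (· + ·) e2.symm e3.symm))
  let T : A × E n →L[ℝ] E' := mfderivWithin (𝓘(ℝ, A).prod I) I' tot (S₀ ×ˢ univ) (τ p, Φ p)
  have key (a : A) (w : E n) : T (a, w) = T (a, 0) + T (0, w) := by rw [← T.map_add]; simp
  have := key (fderivWithin ℝ τ S p X) ((mfderivWithin 𝓘(ℝ, V) I Φ S p : V →L[ℝ] E n) X)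
  rw [← mfderivWithin_eq_fderivWithin] at this ⊢
  exact this

end TotalDerivative

/-! ### Pullback of the symplectic form to a normed space -/

section Pullback

variable {n : ℕ} {H : Type*} [TopologicalSpace H] (I : ModelWithCorners ℝ (E n) H)
  {M : Type*} [TopologicalSpace M] [ChartedSpace H M]
  {V : Type*} [NormedAddCommGroup V] [NormedSpace ℝ V]
  {W : Type*} [NormedAddCommGroup W] [NormedSpace ℝ W]

/-- The differential within `S` of a map from a normed space to `M`, with values in the model
space. -/
def dWithin (Φ : V → M) (S : Set V) (p : V) : V →L[ℝ] E n := mfderivWithin 𝓘(ℝ, V) I Φ S p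

/-- The differential of a self-map of `M`, as an endomorphism of the model space. -/
def dMap (f : M → M) (x : M) : E n →L[ℝ] E n := mfderiv I I f x

/-- The differential of the inverse of the chart at `x₀`. -/
def dChartSymm (x₀ : M) (y : E n) : E n →L[ℝ] E n :=
  mfderivWithin 𝓘(ℝ, E n) I (extChartAt I x₀).symm (range I) y

variable {I}

theorem dWithin_comp {Φ : V → M} {S : Set V} {θ : W → V} {T : Set W} {q : W}
    (hΦ : MDifferentiableWithinAt 𝓘(ℝ, V) I Φ S (θ q)) (hθ : DifferentiableWithinAt ℝ θ T q)
    (hm : MapsTo θ T S) (hT : UniqueDiffWithinAt ℝ T q) :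
    dWithin I (fun w => Φ (θ w)) T q = (dWithin I Φ S (θ q)).comp (fderivWithin ℝ θ T q) := by
  rw [← mfderivWithin_eq_fderivWithin]
  exact mfderivWithin_comp q hΦ hθ.mdifferentiableWithinAt hm
    (uniqueMDiffWithinAt_iff_uniqueDiffWithinAt.2 hT)

theorem dWithin_dMap {Φ : V → M} {S : Set V} {p : V} {f : M → M}
    (hf : MDifferentiableAt I I f (Φ p)) (hΦ : MDifferentiableWithinAt 𝓘(ℝ, V) I Φ S p)
    (hS : UniqueDiffWithinAt ℝ S p) :
    dWithin I (fun v => f (Φ v)) S p = (dMap I f (Φ p)).comp (dWithin I Φ S p) :=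
  mfderiv_comp_mfderivWithin p hf hΦ (uniqueMDiffWithinAt_iff_uniqueDiffWithinAt.2 hS)

theorem dMap_comp {f g : M → M} {x : M} (hg : MDifferentiableAt I I g (f x))
    (hf : MDifferentiableAt I I f x) :
    dMap I (fun y => g (f y)) x = (dMap I g (f x)).comp (dMap I f x) :=
  mfderiv_comp x hg hf

theorem dMap_id (x : M) : dMap I (fun y => y) x = ContinuousLinearMap.id ℝ (E n) := mfderiv_id

theorem differential_comp {h : M → ℝ} {f : M → M} {x : M}
    (hh : MDifferentiableAt I 𝓘(ℝ, ℝ) h (f x)) (hf : MDifferentiableAt I I f x) :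
    differential I (fun y => h (f y)) x = (differential I h (f x)).comp (dMap I f x) :=
  mfderiv_comp x hh hf

theorem fderivWithin_differential {Φ : V → M} {S : Set V} {p : V} {h : M → ℝ}
    (hh : MDifferentiableAt I 𝓘(ℝ, ℝ) h (Φ p)) (hΦ : MDifferentiableWithinAt 𝓘(ℝ, V) I Φ S p)
    (hS : UniqueDiffWithinAt ℝ S p) :
    fderivWithin ℝ (fun v => h (Φ v)) S p = (differential I h (Φ p)).comp (dWithin I Φ S p) := by
  rw [← mfderivWithin_eq_fderivWithin]
  exact mfderiv_comp_mfderivWithin p hh hΦ (uniqueMDiffWithinAt_iff_uniqueDiffWithinAt.2 hS)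

variable [IsManifold I ∞ M]

/-- The differential of the inverse chart after that of the chart is the identity. This transfers
calculations from M to the model space, where smoothness and closedness of ω are formulated. -/
theorem dWithin_eq_dChartSymm {Φ : V → M} {S : Set V} {p : V} (hp : p ∈ S)
    (hΦ : MDifferentiableOn 𝓘(ℝ, V) I Φ S) (hS : UniqueDiffOn ℝ S) {x₀ : M}
    (hx : Φ p ∈ (extChartAt I x₀).source) :
    dWithin I Φ S p = (dChartSymm I x₀ (extChartAt I x₀ (Φ p))).comp
      (fderivWithin ℝ (fun v => extChartAt I x₀ (Φ v)) S p) := by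
  rw [extChartAt_source] at hx
  have h1 := mfderivWithin_extChartAt_symm_comp_mfderiv_extChartAt' (I := I)
    (by rwa [extChartAt_source] : Φ p ∈ (extChartAt I x₀).source)
  have h2 := mfderiv_comp_mfderivWithin p (mdifferentiableAt_extChartAt (I := I) hx) (hΦ p hp)
    (uniqueMDiffWithinAt_iff_uniqueDiffWithinAt.2 (hS p hp))
  rw [← mfderivWithin_eq_fderivWithin]
  ext v
  have e1 := congrArg (fun L : E n →L[ℝ] E n => L (dWithin I Φ S p v)) h1
  have e2 := congrArg (fun L : V →L[ℝ] E n => dChartSymm I x₀ (extChartAt I x₀ (Φ p)) (L v)) h2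
  exact congrFun (congrArg _ (e1.symm.trans e2.symm)) _

variable (σ : SymplecticForm I M)

/-- The pullback of the symplectic form by a map from a subset of a normed space. -/
def pull (Φ : V → M) (S : Set V) (p : V) : V →L[ℝ] V →L[ℝ] ℝ :=
  (σ.bil (Φ p)).bilinearComp (dWithin I Φ S p) (dWithin I Φ S p)

theorem pull_apply (Φ : V → M) (S : Set V) (p u v : V) :
    pull σ Φ S p u v = σ.bil (Φ p) (dWithin I Φ S p u) (dWithin I Φ S p v) := rfl

theorem localForm_apply (x₀ : M) (y u v : E n) :
    localForm I σ.form x₀ y u v =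
      σ.bil ((extChartAt I x₀).symm y) (dChartSymm I x₀ y u) (dChartSymm I x₀ y v) := rfl

theorem bil_self (x : M) (v : E n) : σ.bil x v v = 0 := σ.alternating x v

theorem bil_swap (x : M) (u v : E n) : σ.bil x u v = - σ.bil x v u := by
  have h := bil_self σ x (u + v)
  simp only [map_add, add_apply, bil_self] at h
  linarith

theorem bil_eq_zero {x : M} {v : E n} (h : ∀ w, σ.bil x v w = 0) : v = 0 := σ.nondegenerate x v h

theorem pull_eq_localForm {Φ : V → M} {S : Set V} {p : V} (hp : p ∈ S)
    (hΦ : MDifferentiableOn 𝓘(ℝ, V) I Φ S) (hS : UniqueDiffOn ℝ S) {x₀ : M}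
    (hx : Φ p ∈ (extChartAt I x₀).source) :
    pull σ Φ S p = (localForm I σ.form x₀ (extChartAt I x₀ (Φ p))).bilinearComp
      (fderivWithin ℝ (fun v => extChartAt I x₀ (Φ v)) S p)
      (fderivWithin ℝ (fun v => extChartAt I x₀ (Φ v)) S p) := by
  ext u v
  rw [pull_apply, dWithin_eq_dChartSymm hp hΦ hS hx, ContinuousLinearMap.bilinearComp_apply,
    localForm_apply, (extChartAt I x₀).left_inv hx]
  rfl

theorem pull_comp {Φ : V → M} {S : Set V} {θ : W → V} {T : Set W} {q : W}
    (hΦ : MDifferentiableWithinAt 𝓘(ℝ, V) I Φ S (θ q)) (hθ : DifferentiableWithinAt ℝ θ T q)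
    (hm : MapsTo θ T S) (hT : UniqueDiffWithinAt ℝ T q) (u v : W) :
    pull σ (fun w => Φ (θ w)) T q u v =
      pull σ Φ S (θ q) (fderivWithin ℝ θ T q u) (fderivWithin ℝ θ T q v) := by
  rw [pull_apply, dWithin_comp hΦ hθ hm hT]
  rfl

end Pullback

/-! ### Smoothness and closedness of the pulled-back form -/

section PullbackCalculus

variable {n : ℕ} {H : Type*} [TopologicalSpace H] {I : ModelWithCorners ℝ (E n) H}
  {M : Type*} [TopologicalSpace M] [ChartedSpace H M] [IsManifold I ∞ M]
  {V : Type*} [NormedAddCommGroup V] [NormedSpace ℝ V] (σ : SymplecticForm I M)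

theorem contDiffWithinAt_extChartAt {Φ : V → M} {S : Set V} (hΦ : ContMDiffOn 𝓘(ℝ, V) I ∞ Φ S)
    {x₀ : M} {q : V} (hq : q ∈ S) (hx : Φ q ∈ (extChartAt I x₀).source) :
    ContDiffWithinAt ℝ ∞ (fun v => extChartAt I x₀ (Φ v)) S q :=
  ((contMDiffAt_extChartAt' (by rwa [extChartAt_source] at hx)).comp_contMDiffWithinAt q
    (hΦ q hq)).contDiffWithinAt

omit [IsManifold I ∞ M] [NormedSpace ℝ V] in
theorem preimage_source_mem {Φ : V → M} {S : Set V} (hΦ : ContinuousOn Φ S)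
    {p : V} (hp : p ∈ S) :
    {q | q ∈ S ∧ Φ q ∈ (extChartAt I (Φ p)).source} ∈ nhdsWithin p S :=
  Filter.inter_mem self_mem_nhdsWithin
    ((hΦ p hp).preimage_mem_nhdsWithin (extChartAt_source_mem_nhds (I := I) (Φ p)))

theorem pull_contDiffOn {Φ : V → M} {S : Set V} (hΦ : ContMDiffOn 𝓘(ℝ, V) I ∞ Φ S)
    (hS : UniqueDiffOn ℝ S) (u v : V) : ContDiffOn ℝ ∞ (fun q => pull σ Φ S q u v) S := by
  intro p hp
  have hψ := contDiffWithinAt_extChartAt hΦ hp (mem_extChartAt_source (I := I) (Φ p))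
  have hB : ContDiffWithinAt ℝ ∞ (localForm I σ.form (Φ p)) (extChartAt I (Φ p)).target
      (extChartAt I (Φ p) (Φ p)) := σ.smooth _ _ (mem_extChartAt_target _)
  have hBψ : ContDiffWithinAt ℝ ∞ (fun q => localForm I σ.form (Φ p) (extChartAt I (Φ p) (Φ q)))
      S p := by
    -- The local form is smooth only on the chart target. This is a neighbourhood within `range I`,
    -- boundary points included, and the chart expression of Φ takes all its values in `range I`.
    refine ContDiffWithinAt.comp_of_mem_nhdsWithin_image p hB hψ ?_
    refine nhdsWithin_mono _ ?_ (extChartAt_target_mem_nhdsWithin (I := I) (Φ p))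
    rintro _ ⟨q, -, rfl⟩
    exact mem_range_self _
  have hD : ContDiffWithinAt ℝ ∞ (fun q => fderivWithin ℝ
      (fun v => extChartAt I (Φ p) (Φ v)) S q) S p := hψ.fderivWithin_right hS (by simp) hp
  have := (hBψ.clm_apply (hD.clm_apply (contDiffWithinAt_const (c := u)))).clm_apply
    (hD.clm_apply (contDiffWithinAt_const (c := v)))
  refine this.congr_of_eventuallyEq ?_ ?_
  · filter_upwards [preimage_source_mem (I := I) hΦ.continuousOn hp] with q hq
    rw [pull_eq_localForm σ hq.1 (hΦ.mdifferentiableOn (by simp)) hS hq.2]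
    rfl
  · rw [pull_eq_localForm σ hp (hΦ.mdifferentiableOn (by simp)) hS (mem_extChartAt_source _)]
    rfl

/-- This is d(Φ^*ω) = 0 on constant vector fields, so there are no bracket terms. In a chart, the
terms containing second derivatives of the chart expression cancel in pairs, by their symmetry and
the skew symmetry of ω; what remains is the closedness of ω. The condition that S lies in the
closure of its interior is what makes second derivatives within S symmetric. -/
theorem pull_closed {Φ : V → M} {S : Set V} (hΦ : ContMDiffOn 𝓘(ℝ, V) I ∞ Φ S)
    (hS : UniqueDiffOn ℝ S) (hSI : S ⊆ closure (interior S)) {p : V} (hp : p ∈ S) (u v w : V) :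
    fderivWithin ℝ (fun q => pull σ Φ S q v w) S p u +
      fderivWithin ℝ (fun q => pull σ Φ S q w u) S p v +
      fderivWithin ℝ (fun q => pull σ Φ S q u v) S p w = 0 := by
  set ψ : V → E n := fun v => extChartAt I (Φ p) (Φ v) with hψdef
  set B := localForm I σ.form (Φ p) with hBdef
  have hψ : ContDiffWithinAt ℝ ∞ ψ S p :=
    contDiffWithinAt_extChartAt hΦ hp (mem_extChartAt_source (I := I) (Φ p))
  have hyt : ψ p ∈ (extChartAt I (Φ p)).target := mem_extChartAt_target _
  have hB : HasFDerivWithinAt B (fderivWithin ℝ B (range I) (ψ p)) (range I) (ψ p) := by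
    refine DifferentiableWithinAt.hasFDerivWithinAt ?_
    exact ((σ.smooth _ _ hyt).differentiableWithinAt (by simp)).mono_of_mem_nhdsWithin
      (extChartAt_target_mem_nhdsWithin (I := I) (Φ p))
  have hψ' : HasFDerivWithinAt ψ (fderivWithin ℝ ψ S p) S p :=
    (hψ.differentiableWithinAt (by simp)).hasFDerivWithinAt
  have hr : MapsTo ψ S (range I) := fun q _ => mem_range_self (chartAt H (Φ p) (Φ q))
  have hBψ : HasFDerivWithinAt (fun q => B (ψ q))
      ((fderivWithin ℝ B (range I) (ψ p)).comp (fderivWithin ℝ ψ S p)) S p :=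
    HasFDerivWithinAt.comp (g := B) (g' := fderivWithin ℝ B (range I) (ψ p)) p
      hB hψ' hr
  have hD : HasFDerivWithinAt (fun q => fderivWithin ℝ ψ S q)
      (fderivWithin ℝ (fderivWithin ℝ ψ S) S p) S p :=
    ((hψ.fderivWithin_right hS (m := 1) (by norm_cast) hp).differentiableWithinAt
      (by simp)).hasFDerivWithinAt
  have h2 : minSmoothness ℝ 2 ≤ (∞ : WithTop ℕ∞) := by
    rw [minSmoothness_of_isRCLikeNormedField]; exact WithTop.coe_le_coe.2 le_top
  have hsymm := hψ.isSymmSndFDerivWithinAt h2 hS (hSI hp) hp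
  have hder (a b c : V) : fderivWithin ℝ (fun q => pull σ Φ S q a b) S p c =
      fderivWithin ℝ B (range I) (ψ p) (fderivWithin ℝ ψ S p c) (fderivWithin ℝ ψ S p a)
        (fderivWithin ℝ ψ S p b) +
      B (ψ p) (fderivWithin ℝ (fderivWithin ℝ ψ S) S p c a) (fderivWithin ℝ ψ S p b) +
      B (ψ p) (fderivWithin ℝ ψ S p a) (fderivWithin ℝ (fderivWithin ℝ ψ S) S p c b) := by
    have h := (hBψ.clm_apply (hD.clm_apply (hasFDerivWithinAt_const a p S))).clm_apply
      (hD.clm_apply (hasFDerivWithinAt_const b p S))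
    have hc : (fun q => pull σ Φ S q a b) =ᶠ[nhdsWithin p S]
        fun q => B (ψ q) (fderivWithin ℝ ψ S q a) (fderivWithin ℝ ψ S q b) := by
      filter_upwards [preimage_source_mem (I := I) hΦ.continuousOn hp] with q hq
      rw [pull_eq_localForm σ hq.1 (hΦ.mdifferentiableOn (by simp)) hS hq.2]
      rfl
    rw [hc.fderivWithin_eq (hc.self_of_nhdsWithin hp), h.fderivWithin (hS p hp)]
    simp
    ring
  have hcl := σ.closed (Φ p) (ψ p) hyt (fderivWithin ℝ ψ S p u) (fderivWithin ℝ ψ S p v)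
    (fderivWithin ℝ ψ S p w)
  have hskew (a b : E n) : B (ψ p) a b = - B (ψ p) b a := by
    rw [hBdef, localForm_apply, bil_swap, localForm_apply]
  rw [hder, hder, hder, hsymm u v, hsymm u w, hsymm v w,
    hskew _ (fderivWithin ℝ (fderivWithin ℝ ψ S) S p w v),
    hskew _ (fderivWithin ℝ (fderivWithin ℝ ψ S) S p v u),
    hskew _ (fderivWithin ℝ (fderivWithin ℝ ψ S) S p w u)]
  linarith

end PullbackCalculus

/-! ### Calculus within the unit interval and the unit square -/

section Calculus

variable {V : Type*} [NormedAddCommGroup V] [NormedSpace ℝ V]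
  {W : Type*} [NormedAddCommGroup W] [NormedSpace ℝ W]

theorem fderivWithin_comm {b : V → ℝ} {S : Set V} (hb : ContDiffOn ℝ ∞ b S)
    (hS : UniqueDiffOn ℝ S) (hSI : S ⊆ closure (interior S)) {p : V} (hp : p ∈ S) (X Y : V) :
    fderivWithin ℝ (fun q => fderivWithin ℝ b S q X) S p Y =
      fderivWithin ℝ (fun q => fderivWithin ℝ b S q Y) S p X := by
  have h2 : minSmoothness ℝ 2 ≤ (∞ : WithTop ℕ∞) := by
    rw [minSmoothness_of_isRCLikeNormedField]; exact WithTop.coe_le_coe.2 le_top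
  have hD : DifferentiableWithinAt ℝ (fderivWithin ℝ b S) S p :=
    ((hb p hp).fderivWithin_right hS (m := 1) (by norm_cast) hp).differentiableWithinAt (by simp)
  have key (X : V) : fderivWithin ℝ (fun q => fderivWithin ℝ b S q X) S p =
      (fderivWithin ℝ (fderivWithin ℝ b S) S p).flip X := by
    have := (hD.hasFDerivWithinAt.clm_apply (hasFDerivWithinAt_const X p S)).fderivWithin (hS p hp)
    rw [this]
    ext
    simp
  rw [key, key]
  exact (hb p hp).isSymmSndFDerivWithinAt h2 hS (hSI hp) hp Y X

theorem fderivWithin_apply_contDiffOn {b : V → ℝ} {S : Set V} (hb : ContDiffOn ℝ ∞ b S)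
    (hS : UniqueDiffOn ℝ S) (X : V) : ContDiffOn ℝ ∞ (fun q => fderivWithin ℝ b S q X) S :=
  (hb.fderivWithin hS (by simp)).clm_apply contDiffOn_const

theorem hasDerivWithinAt_comp_fderivWithin {g : V → ℝ} {S : Set V} {θ : ℝ → V} {T : Set ℝ}
    {t : ℝ} {X : V} (hg : DifferentiableWithinAt ℝ g S (θ t)) (hθ : HasDerivWithinAt θ X T t)
    (hm : MapsTo θ T S) :
    HasDerivWithinAt (fun t => g (θ t)) (fderivWithin ℝ g S (θ t) X) T t :=
  hg.hasFDerivWithinAt.comp_hasDerivWithinAt t hθ hm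

theorem fderivWithin_one {θ : ℝ → V} {T : Set ℝ} {t : ℝ} {X : V} (hθ : HasDerivWithinAt θ X T t)
    (hT : UniqueDiffWithinAt ℝ T t) : fderivWithin ℝ θ T t 1 = X := by
  rw [hθ.hasFDerivWithinAt.fderivWithin hT]
  simp

theorem uniqueDiffOn_J : UniqueDiffOn ℝ J := uniqueDiffOn_Icc zero_lt_one

theorem uniqueDiffOn_Sq : UniqueDiffOn ℝ Sq := uniqueDiffOn_J.prod uniqueDiffOn_J

theorem J_subset_closure_interior : J ⊆ closure (interior J) := by
  rw [interior_Icc, closure_Ioo zero_ne_one]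

omit [NormedSpace ℝ V] [NormedSpace ℝ W] in
theorem prod_subset_closure_interior {S : Set V} {T : Set W} (hS : S ⊆ closure (interior S))
    (hT : T ⊆ closure (interior T)) : S ×ˢ T ⊆ closure (interior (S ×ˢ T)) := by
  rw [interior_prod_eq, closure_prod_eq]
  exact prod_mono hS hT

theorem Sq_subset_closure_interior : Sq ⊆ closure (interior Sq) :=
  prod_subset_closure_interior J_subset_closure_interior J_subset_closure_interior

theorem zero_mem_J : (0 : ℝ) ∈ J := ⟨le_rfl, zero_le_one⟩

theorem one_mem_J : (1 : ℝ) ∈ J := ⟨zero_le_one, le_rfl⟩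

theorem eq_of_hasDerivWithinAt_zero {g : ℝ → ℝ} (hg : ∀ t ∈ J, HasDerivWithinAt g 0 J t) {t : ℝ}
    (ht : t ∈ J) : g t = g 0 :=
  constant_of_derivWithin_zero (fun t ht => (hg t ht).differentiableWithinAt)
    (fun t ht => (hg t (Ico_subset_Icc_self ht)).derivWithin (uniqueDiffOn_J t
      (Ico_subset_Icc_self ht))) t ht

end Calculus

/-! ### The sweep of a family of Hamiltonian isotopies -/

section Family

variable {n : ℕ} {H : Type*} [TopologicalSpace H] {I : ModelWithCorners ℝ (E n) H}
  {M : Type*} [TopologicalSpace M] [ChartedSpace H M] [IsManifold I ∞ M]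
  {W : Type*} [NormedAddCommGroup W] [NormedSpace ℝ W] (σ : SymplecticForm I M)

/-- A smooth family of Hamiltonians on `M`, parametrized by `s ∈ [0,1]`, together with the
isotopies that they generate. -/
structure IsHamFamily (ham : ℝ → ℝ → M → ℝ) (flow : ℝ → ℝ → M ≃ₘ⟮I, I⟯ M) : Prop where
  smooth_ham : ContMDiffOn (𝓘(ℝ, ℝ × ℝ).prod I) 𝓘(ℝ, ℝ) ∞
    (fun q : (ℝ × ℝ) × M => ham q.1.1 q.1.2 q.2) (Sq ×ˢ univ)
  smooth_flow : ContMDiffOn (𝓘(ℝ, ℝ × ℝ).prod I) I ∞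
    (fun q : (ℝ × ℝ) × M => flow q.1.1 q.1.2 q.2) (Sq ×ˢ univ)
  generates (s : ℝ) (_ : s ∈ J) : Generates σ (ham s) (flow s)

theorem HamHomotopy.isHamFamily {σ : SymplecticForm I M} [MeasurableSpace M] {φ : M ≃ₘ⟮I, I⟯ M}
    {G F : ℝ → M → ℝ} (P : HamHomotopy σ φ G F) : IsHamFamily σ P.ham P.flow :=
  ⟨P.smooth_ham, P.smooth_flow, P.generates⟩

theorem Generates.isHamFamily {σ : SymplecticForm I M} {F : ℝ → M → ℝ} {f : ℝ → M ≃ₘ⟮I, I⟯ M}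
    (h : Generates σ F f) : IsHamFamily σ (fun _ => F) (fun _ => f) := by
  have hp : ContMDiff (𝓘(ℝ, ℝ × ℝ).prod I) (𝓘(ℝ, ℝ).prod I) ∞
      (fun q : (ℝ × ℝ) × M => (q.1.2, q.2)) :=
    (contDiff_snd.contMDiff.comp contMDiff_fst).prodMk contMDiff_snd
  exact ⟨h.smooth_ham.comp hp.contMDiffOn fun q hq => ⟨hq.1.2, mem_univ _⟩,
    h.smooth.comp hp.contMDiffOn fun q hq => ⟨hq.1.2, mem_univ _⟩, fun _ _ => h⟩

/-- The derivative with respect to `s` of a family of Hamiltonians. -/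
def hamDot (ham : ℝ → ℝ → M → ℝ) (s t : ℝ) (x : M) : ℝ :=
  fderivWithin ℝ (fun a : ℝ × ℝ => ham a.1 a.2 x) Sq (s, t) (1, 0)

/-- The map `((s,t),q) ↦ f^s_t (v q)`. -/
def sweep (flow : ℝ → ℝ → M ≃ₘ⟮I, I⟯ M) (v : W → M) (p : (ℝ × ℝ) × W) : M :=
  flow p.1.1 p.1.2 (v p.2)

variable {σ} {ham : ℝ → ℝ → M → ℝ} {flow : ℝ → ℝ → M ≃ₘ⟮I, I⟯ M}
  {v : W → M} {T : Set W}

theorem uniqueDiffOn_Sq_prod (hT : UniqueDiffOn ℝ T) : UniqueDiffOn ℝ (Sq ×ˢ T) :=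
  uniqueDiffOn_Sq.prod hT

namespace IsHamFamily

theorem sweep_contMDiffOn (h : IsHamFamily σ ham flow) (hv : ContMDiffOn 𝓘(ℝ, W) I ∞ v T) :
    ContMDiffOn 𝓘(ℝ, (ℝ × ℝ) × W) I ∞ (sweep flow v) (Sq ×ˢ T) := by
  have h1 : ContMDiffOn 𝓘(ℝ, (ℝ × ℝ) × W) (𝓘(ℝ, ℝ × ℝ).prod I) ∞
      (fun p : (ℝ × ℝ) × W => (p.1, v p.2)) (Sq ×ˢ T) :=
    contDiff_fst.contMDiff.contMDiffOn.prodMk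
      (hv.comp contDiff_snd.contMDiff.contMDiffOn fun q hq => hq.2)
  exact h.smooth_flow.comp h1 fun q hq => ⟨hq.1, mem_univ _⟩

theorem ham_sweep_contDiffOn (h : IsHamFamily σ ham flow) (hv : ContMDiffOn 𝓘(ℝ, W) I ∞ v T) :
    ContDiffOn ℝ ∞ (fun p : (ℝ × ℝ) × W => ham p.1.1 p.1.2 (sweep flow v p)) (Sq ×ˢ T) := by
  have h1 : ContMDiffOn 𝓘(ℝ, (ℝ × ℝ) × W) (𝓘(ℝ, ℝ × ℝ).prod I) ∞
      (fun p : (ℝ × ℝ) × W => (p.1, sweep flow v p)) (Sq ×ˢ T) :=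
    contDiff_fst.contMDiff.contMDiffOn.prodMk (h.sweep_contMDiffOn hv)
  exact (h.smooth_ham.comp h1 fun q hq => ⟨hq.1, mem_univ _⟩).contDiffOn

theorem dWithin_sweep_time (h : IsHamFamily σ ham flow) (hv : ContMDiffOn 𝓘(ℝ, W) I ∞ v T)
    {p : (ℝ × ℝ) × W} (hp : p ∈ Sq ×ˢ T) :
    dWithin I (sweep flow v) (Sq ×ˢ T) p ((0, 1), 0) =
      velocity I (fun t => flow p.1.1 t (v p.2)) p.1.2 := by
  have hθ : HasDerivWithinAt (fun t : ℝ => ((p.1.1, t), p.2)) ((0, 1), (0 : W)) J p.1.2 :=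
    ((hasDerivWithinAt_const _ _ _).prodMk (hasDerivWithinAt_id _ _)).prodMk
      (hasDerivWithinAt_const _ _ _)
  have h1 := dWithin_comp (Φ := sweep flow v) (θ := fun t : ℝ => ((p.1.1, t), p.2))
    (((h.sweep_contMDiffOn hv) p hp).mdifferentiableWithinAt (by simp)) hθ.differentiableWithinAt
    (fun t ht => ⟨⟨hp.1.1, ht⟩, hp.2⟩) (uniqueDiffOn_J _ hp.1.2)
  have h2 := congrArg (fun L : ℝ →L[ℝ] E n => L 1) h1
  simp only [ContinuousLinearMap.comp_apply,
    fderivWithin_one hθ (uniqueDiffOn_J _ hp.1.2)] at h2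
  exact h2.symm

/-- The vector ∂_tΦ is the Hamiltonian vector field, so pairing it with dΦ(X) gives dF_t(dΦ(X)). By
the chain rule this is the total derivative of F∘Φ along X without the part in which F varies
through its explicit parameters. -/
theorem bil_sweep_time (h : IsHamFamily σ ham flow) (hv : ContMDiffOn 𝓘(ℝ, W) I ∞ v T)
    (hT : UniqueDiffOn ℝ T) {p : (ℝ × ℝ) × W} (hp : p ∈ Sq ×ˢ T) (X : (ℝ × ℝ) × W) :
    pull σ (sweep flow v) (Sq ×ˢ T) p ((0, 1), 0) X =
      fderivWithin ℝ (fun p : (ℝ × ℝ) × W => ham p.1.1 p.1.2 (sweep flow v p)) (Sq ×ˢ T) p X -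
      fderivWithin ℝ (fun a : ℝ × ℝ => ham a.1 a.2 (sweep flow v p)) Sq p.1 X.1 := by
  have h1 := mfderivWithin_family (f := fun a : ℝ × ℝ => ham a.1 a.2) uniqueDiffOn_Sq h.smooth_ham
    (uniqueDiffOn_Sq_prod hT) (τ := Prod.fst) differentiableOn_fst (fun p hp => hp.1)
    ((h.sweep_contMDiffOn hv).mdifferentiableOn (by simp)) hp X
  rw [mfderivWithin_eq_fderivWithin, mfderivWithin_eq_fderivWithin,
    fderivWithin_fst ((uniqueDiffOn_Sq_prod hT) p hp)] at h1
  rw [pull_apply, h.dWithin_sweep_time hv hp]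
  have h2 := (h.generates _ hp.1.1).orbit (v p.2) |>.2 _ hp.1.2
    (dWithin I (sweep flow v) (Sq ×ˢ T) p X)
  refine h2.trans ?_
  rw [eq_sub_iff_add_eq']
  exact h1.symm

theorem bil_sweep_time_space (h : IsHamFamily σ ham flow) (hv : ContMDiffOn 𝓘(ℝ, W) I ∞ v T)
    (hT : UniqueDiffOn ℝ T) {p : (ℝ × ℝ) × W} (hp : p ∈ Sq ×ˢ T) (ξ : W) :
    pull σ (sweep flow v) (Sq ×ˢ T) p ((0, 1), 0) (0, ξ) =
      fderivWithin ℝ (fun p : (ℝ × ℝ) × W => ham p.1.1 p.1.2 (sweep flow v p)) (Sq ×ˢ T) p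
        (0, ξ) := by
  rw [h.bil_sweep_time hv hT hp]
  simp

theorem bil_sweep_time_param (h : IsHamFamily σ ham flow) (hv : ContMDiffOn 𝓘(ℝ, W) I ∞ v T)
    (hT : UniqueDiffOn ℝ T) {p : (ℝ × ℝ) × W} (hp : p ∈ Sq ×ˢ T) :
    pull σ (sweep flow v) (Sq ×ˢ T) p ((0, 1), 0) ((1, 0), 0) =
      fderivWithin ℝ (fun p : (ℝ × ℝ) × W => ham p.1.1 p.1.2 (sweep flow v p)) (Sq ×ˢ T) p
        ((1, 0), 0) - hamDot ham p.1.1 p.1.2 (sweep flow v p) :=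
  h.bil_sweep_time hv hT hp _

theorem pull_swap (σ : SymplecticForm I M) {V : Type*} [NormedAddCommGroup V] [NormedSpace ℝ V]
    (Φ : V → M) (S : Set V) (p u w : V) : pull σ Φ S p u w = - pull σ Φ S p w u := by
  rw [pull_apply, pull_apply, bil_swap]

/-- The derivative in `hamDot` is taken with the point of M frozen, so its smoothness along the
sweep is not immediate. It is read off from `bil_sweep_time_param`, whose other two terms are
smooth. -/
theorem hamDot_contDiffOn (h : IsHamFamily σ ham flow) (hv : ContMDiffOn 𝓘(ℝ, W) I ∞ v T)
    (hT : UniqueDiffOn ℝ T) :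
    ContDiffOn ℝ ∞ (fun p : (ℝ × ℝ) × W => hamDot ham p.1.1 p.1.2 (sweep flow v p))
      (Sq ×ˢ T) := by
  refine ((fderivWithin_apply_contDiffOn (h.ham_sweep_contDiffOn hv) (uniqueDiffOn_Sq_prod hT)
    ((1, 0), 0)).sub (pull_contDiffOn σ (h.sweep_contMDiffOn hv) (uniqueDiffOn_Sq_prod hT)
    ((0, 1), 0) ((1, 0), 0))).congr fun p hp => ?_
  rw [h.bil_sweep_time_param hv hT hp]
  ring

variable (hTI : T ⊆ closure (interior T))
include hTI

/-- Cartan's formula in coordinates: contraction with ∂_t is exact in the space directions, so in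
the closedness relation for ∂_t, ξ, η the other two terms are mixed second derivatives of F∘Φ and
cancel. -/
theorem fderivWithin_pull_space (h : IsHamFamily σ ham flow) (hv : ContMDiffOn 𝓘(ℝ, W) I ∞ v T)
    (hT : UniqueDiffOn ℝ T)
    {p : (ℝ × ℝ) × W} (hp : p ∈ Sq ×ˢ T) (ξ η : W) :
    fderivWithin ℝ (fun p => pull σ (sweep flow v) (Sq ×ˢ T) p (0, ξ) (0, η)) (Sq ×ˢ T) p
      ((0, 1), 0) = 0 := by
  have hSI := prod_subset_closure_interior Sq_subset_closure_interior hTI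
  have hS := uniqueDiffOn_Sq_prod hT
  have h0 := pull_closed σ (h.sweep_contMDiffOn hv) hS hSI hp ((0, 1), 0) (0, ξ) (0, η)
  have e1 : EqOn (fun q => pull σ (sweep flow v) (Sq ×ˢ T) q (0, η) ((0, 1), 0)) (-fun q =>
      fderivWithin ℝ (fun p : (ℝ × ℝ) × W => ham p.1.1 p.1.2 (sweep flow v p)) (Sq ×ˢ T) q
        (0, η)) (Sq ×ˢ T) := fun q hq => by
    simp only [Pi.neg_apply]
    rw [pull_swap, h.bil_sweep_time_space hv hT hq]
  have e2 : EqOn (fun q => pull σ (sweep flow v) (Sq ×ˢ T) q ((0, 1), 0) (0, ξ)) (fun q =>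
      fderivWithin ℝ (fun p : (ℝ × ℝ) × W => ham p.1.1 p.1.2 (sweep flow v p)) (Sq ×ˢ T) q
        (0, ξ)) (Sq ×ˢ T) := fun q hq => h.bil_sweep_time_space hv hT hq ξ
  rw [fderivWithin_congr e1 (e1 hp), fderivWithin_congr e2 (e2 hp), fderivWithin_neg (hS p hp),
    neg_apply, fderivWithin_comm (h.ham_sweep_contDiffOn hv) hS hSI hp (0, ξ) (0, η)] at h0
  linarith

/-- The same cancellation with ∂_s in place of one space direction. Now F depends explicitly on s,
and the correction term in ω(∂_tΦ, ∂_sΦ) survives as the derivative of `hamDot`. -/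
theorem fderivWithin_pull_param (h : IsHamFamily σ ham flow) (hv : ContMDiffOn 𝓘(ℝ, W) I ∞ v T)
    (hT : UniqueDiffOn ℝ T)
    {p : (ℝ × ℝ) × W} (hp : p ∈ Sq ×ˢ T) (ξ : W) :
    fderivWithin ℝ (fun p => pull σ (sweep flow v) (Sq ×ˢ T) p ((1, 0), 0) (0, ξ)) (Sq ×ˢ T) p
      ((0, 1), 0) =
    fderivWithin ℝ (fun p : (ℝ × ℝ) × W => hamDot ham p.1.1 p.1.2 (sweep flow v p)) (Sq ×ˢ T) p
      (0, ξ) := by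
  have hSI := prod_subset_closure_interior Sq_subset_closure_interior hTI
  have hS := uniqueDiffOn_Sq_prod hT
  have h0 := pull_closed σ (h.sweep_contMDiffOn hv) hS hSI hp ((0, 1), 0) ((1, 0), 0) (0, ξ)
  have e1 : EqOn (fun q => pull σ (sweep flow v) (Sq ×ˢ T) q (0, ξ) ((0, 1), 0)) (-fun q =>
      fderivWithin ℝ (fun p : (ℝ × ℝ) × W => ham p.1.1 p.1.2 (sweep flow v p)) (Sq ×ˢ T) q
        (0, ξ)) (Sq ×ˢ T) := fun q hq => by
    simp only [Pi.neg_apply]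
    rw [pull_swap, h.bil_sweep_time_space hv hT hq]
  have e2 : EqOn (fun q => pull σ (sweep flow v) (Sq ×ˢ T) q ((0, 1), 0) ((1, 0), 0))
      ((fun q => fderivWithin ℝ (fun p : (ℝ × ℝ) × W => ham p.1.1 p.1.2 (sweep flow v p))
        (Sq ×ˢ T) q ((1, 0), 0)) - fun q => hamDot ham q.1.1 q.1.2 (sweep flow v q))
      (Sq ×ˢ T) := fun q hq => h.bil_sweep_time_param hv hT hq
  rw [fderivWithin_congr e1 (e1 hp), fderivWithin_congr e2 (e2 hp), fderivWithin_neg (hS p hp),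
    neg_apply, fderivWithin_comm (h.ham_sweep_contDiffOn hv) hS hSI hp (0, ξ) ((1, 0), 0),
    fderivWithin_sub (hS p hp)
      (((fderivWithin_apply_contDiffOn (h.ham_sweep_contDiffOn hv) hS _) p
        hp).differentiableWithinAt (by simp))
      (((h.hamDot_contDiffOn hv hT) p hp).differentiableWithinAt (by simp)),
    sub_apply] at h0
  linarith

end IsHamFamily

end Family

/-! ### Integrals over the unit square and closed 1-forms -/

section IntegralCalculus

theorem mem_J_of_mem_uIcc {t : ℝ} (ht : t ∈ uIcc (0 : ℝ) 1) : t ∈ J := by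
  rwa [uIcc_of_le zero_le_one] at ht

theorem intervalIntegrable_J {g : ℝ → ℝ} (hg : ContinuousOn g J) :
    IntervalIntegrable g volume 0 1 :=
  ContinuousOn.intervalIntegrable (by rwa [uIcc_of_le zero_le_one])

theorem integral_J_congr {f g : ℝ → ℝ} (h : ∀ t ∈ J, f t = g t) :
    ∫ t in (0 : ℝ)..1, f t = ∫ t in (0 : ℝ)..1, g t :=
  intervalIntegral.integral_congr fun _ ht => h _ (mem_J_of_mem_uIcc ht)

theorem integral_deriv_J {g g' : ℝ → ℝ} (hg : ∀ t ∈ J, HasDerivWithinAt g (g' t) J t)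
    (hg' : ContinuousOn g' J) : ∫ t in (0 : ℝ)..1, g' t = g 1 - g 0 :=
  intervalIntegral.integral_eq_sub_of_hasDerivAt_of_le zero_le_one
    (fun t ht => (hg t ht).continuousWithinAt)
    (fun t ht => (hg t (Ioo_subset_Icc_self ht)).hasDerivAt (Icc_mem_nhds ht.1 ht.2))
    (intervalIntegrable_J hg')

theorem integral_swap_J {D : ℝ → ℝ → ℝ} (hD : ContinuousOn (fun p : ℝ × ℝ => D p.1 p.2) Sq) :
    ∫ r in (0 : ℝ)..1, ∫ t in (0 : ℝ)..1, D r t = ∫ t in (0 : ℝ)..1, ∫ r in (0 : ℝ)..1, D r t := by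
  refine intervalIntegral_intervalIntegral_swap ?_
  rw [uIoc_of_le zero_le_one]
  exact (hD.integrableOn_compact (isCompact_Icc.prod isCompact_Icc)).mono_set
    (prod_mono Ioc_subset_Icc_self Ioc_subset_Icc_self)

theorem continuousOn_integral_J {X : Type*} [TopologicalSpace X] {S : Set X} {D : X → ℝ → ℝ}
    (hD : ContinuousOn (fun p : X × ℝ => D p.1 p.2) (S ×ˢ J)) :
    ContinuousOn (fun x => ∫ t in (0 : ℝ)..1, D x t) S := by
  rw [continuousOn_iff_continuous_domRestrict]
  have h : Continuous (fun p : S × ℝ => D p.1 (projIcc 0 1 zero_le_one p.2)) :=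
    hD.comp_continuous (f := fun p : S × ℝ => ((p.1 : X), (projIcc (0 : ℝ) 1 zero_le_one p.2 : ℝ)))
      (by fun_prop) fun p => ⟨p.1.2, (projIcc (0 : ℝ) 1 zero_le_one p.2).2⟩
  have := intervalIntegral.continuous_parametric_intervalIntegral_of_continuous' (μ := volume)
    (f := fun (x : S) t => D x (projIcc 0 1 zero_le_one t)) h 0 1
  refine this.congr fun x => integral_J_congr fun t ht => ?_
  rw [projIcc_of_mem _ ht]

theorem continuousOn_left {D : ℝ → ℝ → ℝ} (hD : ContinuousOn (fun p : ℝ × ℝ => D p.1 p.2) Sq)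
    {r : ℝ} (hr : r ∈ J) : ContinuousOn (D r) J :=
  hD.comp (f := fun t => (r, t)) (by fun_prop) fun _ ht => ⟨hr, ht⟩

theorem continuousOn_right {D : ℝ → ℝ → ℝ} (hD : ContinuousOn (fun p : ℝ × ℝ => D p.1 p.2) Sq)
    {t : ℝ} (ht : t ∈ J) : ContinuousOn (fun r => D r t) J :=
  hD.comp (f := fun r => (r, t)) (by fun_prop) fun _ hr => ⟨hr, ht⟩

theorem integral_integral_sub_J {D D' : ℝ → ℝ → ℝ}
    (hD : ContinuousOn (fun p : ℝ × ℝ => D p.1 p.2) Sq)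
    (hD' : ContinuousOn (fun p : ℝ × ℝ => D' p.1 p.2) Sq) :
    ∫ r in (0 : ℝ)..1, ∫ t in (0 : ℝ)..1, (D r t - D' r t) =
      (∫ r in (0 : ℝ)..1, ∫ t in (0 : ℝ)..1, D r t) -
      ∫ r in (0 : ℝ)..1, ∫ t in (0 : ℝ)..1, D' r t := by
  rw [← intervalIntegral.integral_sub (intervalIntegrable_J (continuousOn_integral_J hD))
    (intervalIntegrable_J (continuousOn_integral_J hD'))]
  exact integral_J_congr fun r hr => intervalIntegral.integral_sub
    (intervalIntegrable_J (continuousOn_left hD hr))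
    (intervalIntegrable_J (continuousOn_left hD' hr))

/-- If `∂_ρ A = ∂_t B` on the unit square and `B` vanishes for `t = 0` and `t = 1`, then
`∫ A (ρ,t) dt` is the same for `ρ = 0` and `ρ = 1`. -/
theorem integral_eq_of_closed {A B D : ℝ → ℝ → ℝ}
    (hD : ContinuousOn (fun p : ℝ × ℝ => D p.1 p.2) Sq)
    (hA : ∀ ρ ∈ J, ∀ t ∈ J, HasDerivWithinAt (fun ρ => A ρ t) (D ρ t) J ρ)
    (hB : ∀ ρ ∈ J, ∀ t ∈ J, HasDerivWithinAt (B ρ) (D ρ t) J t)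
    (hB0 : ∀ ρ ∈ J, B ρ 0 = 0) (hB1 : ∀ ρ ∈ J, B ρ 1 = 0)
    (hA0 : ContinuousOn (A 0) J) (hA1 : ContinuousOn (A 1) J) :
    ∫ t in (0 : ℝ)..1, A 1 t = ∫ t in (0 : ℝ)..1, A 0 t := by
  rw [← sub_eq_zero, ← intervalIntegral.integral_sub (intervalIntegrable_J hA1)
    (intervalIntegrable_J hA0)]
  have h1 : ∫ t in (0 : ℝ)..1, (A 1 t - A 0 t) =
      ∫ t in (0 : ℝ)..1, ∫ ρ in (0 : ℝ)..1, D ρ t := integral_J_congr fun t ht =>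
    (integral_deriv_J (fun ρ hρ => hA ρ hρ t ht) (continuousOn_right hD ht)).symm
  have h2 : ∫ ρ in (0 : ℝ)..1, ∫ t in (0 : ℝ)..1, D ρ t = ∫ ρ in (0 : ℝ)..1, (0 : ℝ) :=
    integral_J_congr fun ρ hρ => by
      rw [integral_deriv_J (hB ρ hρ) (continuousOn_left hD hρ), hB0 ρ hρ, hB1 ρ hρ, sub_zero]
  rw [h1, ← integral_swap_J hD, h2]
  simp

variable {a m : ℝ × ℝ → ℝ}

theorem hasDerivWithinAt_fst {g : ℝ × ℝ → ℝ} (hg : ContDiffOn ℝ ∞ g Sq) {p : ℝ × ℝ} (hp : p ∈ Sq) :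
    HasDerivWithinAt (fun t => g (t, p.2)) (fderivWithin ℝ g Sq p (1, 0)) J p.1 :=
  hasDerivWithinAt_comp_fderivWithin (θ := fun t => (t, p.2))
    ((hg p hp).differentiableWithinAt (by simp))
    ((hasDerivWithinAt_id _ _).prodMk (hasDerivWithinAt_const _ _ _)) fun _ ht => ⟨ht, hp.2⟩

theorem hasDerivWithinAt_snd {g : ℝ × ℝ → ℝ} (hg : ContDiffOn ℝ ∞ g Sq) {p : ℝ × ℝ} (hp : p ∈ Sq) :
    HasDerivWithinAt (fun t => g (p.1, t)) (fderivWithin ℝ g Sq p (0, 1)) J p.2 :=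
  hasDerivWithinAt_comp_fderivWithin (θ := fun t => (p.1, t))
    ((hg p hp).differentiableWithinAt (by simp))
    ((hasDerivWithinAt_const _ _ _).prodMk (hasDerivWithinAt_id _ _)) fun _ ht => ⟨hp.1, ht⟩

theorem continuousOn_fderivWithin_Sq {g : ℝ × ℝ → ℝ} (hg : ContDiffOn ℝ ∞ g Sq) (X : ℝ × ℝ) :
    ContinuousOn (fun p => fderivWithin ℝ g Sq p X) Sq :=
  (fderivWithin_apply_contDiffOn hg uniqueDiffOn_Sq X).continuousOn

/-- Green's theorem for the closed 1-form a dt + m dτ: the two sides t = 0 and t = 1 contribute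
nothing because m vanishes there. -/
theorem integral_top_eq_bottom (ha : ContDiffOn ℝ ∞ a Sq) (hm : ContDiffOn ℝ ∞ m Sq)
    (ham : ∀ p ∈ Sq, fderivWithin ℝ m Sq p (1, 0) = fderivWithin ℝ a Sq p (0, 1))
    (hm0 : ∀ τ ∈ J, m (0, τ) = 0) (hm1 : ∀ τ ∈ J, m (1, τ) = 0) :
    ∫ t in (0 : ℝ)..1, a (t, 1) = ∫ t in (0 : ℝ)..1, a (t, 0) := by
  refine integral_eq_of_closed (A := fun ρ t => a (t, ρ)) (B := fun ρ t => m (t, ρ))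
    (D := fun ρ t => fderivWithin ℝ a Sq (t, ρ) (0, 1)) ?_ ?_ ?_ hm0 hm1 ?_ ?_
  · exact (continuousOn_fderivWithin_Sq ha (0, 1)).comp (f := fun p : ℝ × ℝ => (p.2, p.1))
      (by fun_prop) fun p hp => ⟨hp.2, hp.1⟩
  · exact fun ρ hρ t ht => hasDerivWithinAt_snd (p := (t, ρ)) ha ⟨ht, hρ⟩
  · intro ρ hρ t ht
    have := hasDerivWithinAt_fst (p := (t, ρ)) hm ⟨ht, hρ⟩
    rwa [ham _ ⟨ht, hρ⟩] at this
  · exact ha.continuousOn.comp (f := fun t => (t, 0)) (by fun_prop) fun t ht => ⟨ht, zero_mem_J⟩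
  · exact ha.continuousOn.comp (f := fun t => (t, 1)) (by fun_prop) fun t ht => ⟨ht, one_mem_J⟩

/-- The bottom edge is moved to the diagonal through the segments τ = ρt, all of which start at the
corner (0,0). Only their end points, on the side t = 1, move. -/
theorem integral_diagonal_eq_bottom (ha : ContDiffOn ℝ ∞ a Sq) (hm : ContDiffOn ℝ ∞ m Sq)
    (ham : ∀ p ∈ Sq, fderivWithin ℝ m Sq p (1, 0) = fderivWithin ℝ a Sq p (0, 1))
    (hm1 : ∀ τ ∈ J, m (1, τ) = 0) :
    ∫ t in (0 : ℝ)..1, (a (t, t) + m (t, t)) = ∫ t in (0 : ℝ)..1, a (t, 0) := by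
  have hmem {ρ t : ℝ} (hρ : ρ ∈ J) (ht : t ∈ J) : (t, ρ * t) ∈ Sq :=
    ⟨ht, mul_nonneg hρ.1 ht.1, mul_le_one₀ hρ.2 ht.1 ht.2⟩
  have hc {g : ℝ × ℝ → ℝ} (hg : ContinuousOn g Sq) :
      ContinuousOn (fun p : ℝ × ℝ => g (p.2, p.1 * p.2)) Sq :=
    hg.comp (f := fun p : ℝ × ℝ => (p.2, p.1 * p.2)) (by fun_prop) fun p hp => hmem hp.1 hp.2
  have hρ' {g : ℝ × ℝ → ℝ} (hg : ContDiffOn ℝ ∞ g Sq) {ρ t : ℝ} (hρ : ρ ∈ J) (ht : t ∈ J) :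
      HasDerivWithinAt (fun ρ => g (t, ρ * t)) (t * fderivWithin ℝ g Sq (t, ρ * t) (0, 1)) J ρ := by
    have hθ : HasDerivWithinAt (fun ρ => (t, ρ * t)) (t • ((0, 1) : ℝ × ℝ)) J ρ := by
      simpa using (hasDerivWithinAt_const ρ J t).prodMk ((hasDerivWithinAt_id ρ J).mul_const t)
    have := hasDerivWithinAt_comp_fderivWithin (θ := fun ρ => (t, ρ * t))
      ((hg _ (hmem hρ ht)).differentiableWithinAt (by simp)) hθ (fun _ h => hmem h ht)
    rwa [map_smul, smul_eq_mul] at this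
  have ht' {g : ℝ × ℝ → ℝ} (hg : ContDiffOn ℝ ∞ g Sq) {ρ t : ℝ} (hρ : ρ ∈ J) (ht : t ∈ J) :
      HasDerivWithinAt (fun t => g (t, ρ * t)) (fderivWithin ℝ g Sq (t, ρ * t) (1, 0) +
        ρ * fderivWithin ℝ g Sq (t, ρ * t) (0, 1)) J t := by
    have hθ : HasDerivWithinAt (fun t => (t, ρ * t)) ((1, 0) + ρ • ((0, 1) : ℝ × ℝ)) J t := by
      simpa using (hasDerivWithinAt_id t J).prodMk ((hasDerivWithinAt_id t J).const_mul ρ)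
    have := hasDerivWithinAt_comp_fderivWithin (θ := fun t => (t, ρ * t))
      ((hg _ (hmem hρ ht)).differentiableWithinAt (by simp)) hθ (fun _ h => hmem hρ h)
    rwa [map_add, map_smul, smul_eq_mul] at this
  -- `A` and `B` are the dt- and dρ-coefficients of the form pulled back by (ρ,t) ↦ (t, ρt). The
  -- factor t in `B` disposes of t = 0, so m has to vanish only at t = 1.
  have key := integral_eq_of_closed (A := fun ρ t => a (t, ρ * t) + ρ * m (t, ρ * t))
    (B := fun ρ t => t * m (t, ρ * t))
    (D := fun ρ t => m (t, ρ * t) + t * (fderivWithin ℝ a Sq (t, ρ * t) (0, 1) +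
      ρ * fderivWithin ℝ m Sq (t, ρ * t) (0, 1))) ?_ ?_ ?_ ?_ ?_ ?_ ?_
  · simpa using key
  · exact (hc hm.continuousOn).add (continuousOn_snd.mul
      ((hc (continuousOn_fderivWithin_Sq ha _)).add
      (continuousOn_fst.mul (hc (continuousOn_fderivWithin_Sq hm _)))))
  · intro ρ hρ t ht
    convert! (hρ' ha hρ ht).add ((hasDerivWithinAt_id ρ J).mul (hρ' hm hρ ht)) using 1
    simp
    ring
  · intro ρ hρ t ht
    convert! (hasDerivWithinAt_id t J).mul (ht' hm hρ ht) using 1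
    rw [ham _ (hmem hρ ht)]
    simp
  · intro ρ _
    simp
  · intro ρ hρ
    have := hm1 ρ hρ
    simpa using this
  · have := continuousOn_left (D := fun ρ t => a (t, ρ * t)) (hc ha.continuousOn) zero_mem_J
    simpa using this
  · have := continuousOn_left (D := fun ρ t => a (t, ρ * t) + ρ * m (t, ρ * t))
      ((hc ha.continuousOn).add (continuousOn_fst.mul (hc hm.continuousOn))) one_mem_J
    simpa using this

end IntegralCalculus

/-! ### Hamiltonian isotopies preserve the symplectic form -/

section Symplectic

variable {n : ℕ} {H : Type*} [TopologicalSpace H] {I : ModelWithCorners ℝ (E n) H}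
  {M : Type*} [TopologicalSpace M] [ChartedSpace H M] [IsManifold I ∞ M]
  {W : Type*} [NormedAddCommGroup W] [NormedSpace ℝ W] (σ : SymplecticForm I M)

/-- The differential of `f` preserves the symplectic form. -/
def IsSymplectic (f : M → M) : Prop :=
  ∀ x u w, σ.bil (f x) (dMap I f x u) (dMap I f x w) = σ.bil x u w

variable {σ} {ham : ℝ → ℝ → M → ℝ} {flow : ℝ → ℝ → M ≃ₘ⟮I, I⟯ M}
  {v : W → M} {T : Set W}

omit [IsManifold I ∞ M] in
theorem Diffeomorph.mdifferentiableAt' (f : M ≃ₘ⟮I, I⟯ M) (x : M) : MDifferentiableAt I I f x :=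
  f.mdifferentiable (by simp) x

omit [IsManifold I ∞ M] in
theorem dMap_symm_dMap (f : M ≃ₘ⟮I, I⟯ M) (x : M) (u : E n) :
    dMap I f.symm (f x) (dMap I f x u) = u := by
  have h := dMap_comp (Diffeomorph.mdifferentiableAt' f.symm (f x))
    (Diffeomorph.mdifferentiableAt' f x)
  simp only [Diffeomorph.symm_apply_apply, dMap_id] at h
  exact (congrArg (fun L : E n →L[ℝ] E n => L u) h).symm

omit [IsManifold I ∞ M] in
theorem dMap_dMap_symm (f : M ≃ₘ⟮I, I⟯ M) (x : M) (u : E n) :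
    dMap I f (f.symm x) (dMap I f.symm x u) = u :=
  dMap_symm_dMap f.symm x u

theorem IsSymplectic.symm {f : M ≃ₘ⟮I, I⟯ M} (hf : IsSymplectic σ f) :
    IsSymplectic σ f.symm := by
  intro x u w
  rw [← hf, dMap_dMap_symm, dMap_dMap_symm, f.apply_symm_apply]

theorem IsSymplectic.comp {f g : M ≃ₘ⟮I, I⟯ M} (hf : IsSymplectic σ f) (hg : IsSymplectic σ g) :
    IsSymplectic σ (f.trans g) := by
  intro x u w
  have h : dMap I (f.trans g) x = (dMap I g (f x)).comp (dMap I f x) :=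
    dMap_comp (Diffeomorph.mdifferentiableAt' g _) (Diffeomorph.mdifferentiableAt' f x)
  rw [h]
  exact (hg _ _ _).trans (hf _ _ _)

/-- Lets every tangent vector at the base point be realized by a direction in the chart, so that a
statement about pullbacks along the inverse chart yields `IsSymplectic`. -/
theorem dWithin_chart_surjective (x₀ : M) (u : E n) :
    ∃ ξ, dWithin I (extChartAt I x₀).symm (extChartAt I x₀).target (extChartAt I x₀ x₀) ξ = u := by
  have h1 := mfderivWithin_extChartAt_symm_comp_mfderiv_extChartAt' (I := I)
    (mem_extChartAt_source (I := I) x₀)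
  refine ⟨(mfderiv I 𝓘(ℝ, E n) (extChartAt I x₀) x₀ : E n →L[ℝ] E n) u, ?_⟩
  have h2 : mfderivWithin 𝓘(ℝ, E n) I (extChartAt I x₀).symm (extChartAt I x₀).target
      (extChartAt I x₀ x₀) = mfderivWithin 𝓘(ℝ, E n) I (extChartAt I x₀).symm (range I)
      (extChartAt I x₀ x₀) :=
    mfderivWithin_subset (extChartAt_target_subset_range x₀)
      (uniqueMDiffWithinAt_iff_uniqueDiffWithinAt.2
        ((uniqueDiffOn_extChartAt_target x₀) _ (mem_extChartAt_target x₀)))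
      (mdifferentiableWithinAt_extChartAt_symm (mem_extChartAt_target x₀))
  have h3 := congrArg (fun L : E n →L[ℝ] E n => L u) h1
  rw [← h2] at h3
  exact h3

namespace IsHamFamily

theorem pull_sweep_space (h : IsHamFamily σ ham flow) (hv : ContMDiffOn 𝓘(ℝ, W) I ∞ v T)
    (hT : UniqueDiffOn ℝ T) {s t : ℝ} (hs : s ∈ J) (ht : t ∈ J) {q : W} (hq : q ∈ T) (ξ η : W) :
    pull σ (sweep flow v) (Sq ×ˢ T) ((s, t), q) (0, ξ) (0, η) =
      pull σ (fun q => flow s t (v q)) T q ξ η := by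
  have hθ : HasFDerivWithinAt (fun q : W => ((s, t), q))
      (ContinuousLinearMap.inr ℝ (ℝ × ℝ) W) T q :=
    (hasFDerivAt_prodMk_right (s, t) q).hasFDerivWithinAt
  have h1 := pull_comp σ (Φ := sweep flow v) (S := Sq ×ˢ T) (θ := fun q : W => ((s, t), q))
    (((h.sweep_contMDiffOn hv) _ ⟨⟨hs, ht⟩, hq⟩).mdifferentiableWithinAt (by simp))
    hθ.differentiableWithinAt (fun q hq => ⟨⟨hs, ht⟩, hq⟩) (hT q hq) ξ η
  rw [hθ.fderivWithin (hT q hq)] at h1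
  simpa [sweep] using h1.symm

/-- By `fderivWithin_pull_space` the left side is constant in t, and at t = 0 the flow is the
identity. -/
theorem pull_sweep_space_eq (h : IsHamFamily σ ham flow) (hv : ContMDiffOn 𝓘(ℝ, W) I ∞ v T)
    (hT : UniqueDiffOn ℝ T) (hTI : T ⊆ closure (interior T)) {s t : ℝ} (hs : s ∈ J) (ht : t ∈ J)
    {q : W} (hq : q ∈ T) (ξ η : W) :
    pull σ (sweep flow v) (Sq ×ˢ T) ((s, t), q) (0, ξ) (0, η) = pull σ v T q ξ η := by
  have hder (t : ℝ) (ht : t ∈ J) : HasDerivWithinAt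
      (fun t => pull σ (sweep flow v) (Sq ×ˢ T) ((s, t), q) (0, ξ) (0, η)) 0 J t := by
    rw [← h.fderivWithin_pull_space hTI hv hT (p := ((s, t), q)) ⟨⟨hs, ht⟩, hq⟩ ξ η]
    exact hasDerivWithinAt_comp_fderivWithin (θ := fun t => ((s, t), q))
      (((pull_contDiffOn σ (h.sweep_contMDiffOn hv) (uniqueDiffOn_Sq_prod hT) _ _) _
        ⟨⟨hs, ht⟩, hq⟩).differentiableWithinAt (by simp))
      (((hasDerivWithinAt_const _ _ _).prodMk (hasDerivWithinAt_id _ _)).prodMk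
        (hasDerivWithinAt_const _ _ _)) fun t ht => ⟨⟨hs, ht⟩, hq⟩
  rw [eq_of_hasDerivWithinAt_zero hder ht, h.pull_sweep_space hv hT hs zero_mem_J hq]
  simp only [(h.generates s hs).zero]

theorem isSymplectic (h : IsHamFamily σ ham flow) {s t : ℝ} (hs : s ∈ J) (ht : t ∈ J) :
    IsSymplectic σ (flow s t) := by
  intro x u w
  obtain ⟨ξ, rfl⟩ := dWithin_chart_surjective (I := I) x u
  obtain ⟨η, rfl⟩ := dWithin_chart_surjective (I := I) x w
  have hv := contMDiffOn_extChartAt_symm (I := I) (n := ∞) x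
  have hT := uniqueDiffOn_extChartAt_target (I := I) x
  have hq := mem_extChartAt_target (I := I) x
  have h1 := (h.pull_sweep_space hv hT hs ht hq ξ η).symm.trans
    (h.pull_sweep_space_eq hv hT extChartAt_target_subset_closure_interior hs ht hq ξ η)
  have e : (extChartAt I x).symm (extChartAt I x x) = x := extChartAt_to_inv x
  rw [pull_apply, pull_apply, dWithin_dMap (Diffeomorph.mdifferentiableAt' _ _)
    ((hv.mdifferentiableOn (by simp)) _ hq) (hT _ hq)] at h1
  rw [e] at h1
  exact h1

end IsHamFamily

theorem Generates.isSymplectic {F : ℝ → M → ℝ} {f : ℝ → M ≃ₘ⟮I, I⟯ M} (h : Generates σ F f)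
    {t : ℝ} (ht : t ∈ J) : IsSymplectic σ (f t) :=
  h.isHamFamily.isSymplectic zero_mem_J ht

end Symplectic

/-! ### The closed 1-form along a curve -/

section Area

variable {n : ℕ} {H : Type*} [TopologicalSpace H] {I : ModelWithCorners ℝ (E n) H}
  {M : Type*} [TopologicalSpace M] [ChartedSpace H M] [IsManifold I ∞ M]
  {W : Type*} [NormedAddCommGroup W] [NormedSpace ℝ W] {σ : SymplecticForm I M}
  {ham : ℝ → ℝ → M → ℝ} {flow : ℝ → ℝ → M ≃ₘ⟮I, I⟯ M} {v : W → M} {T : Set W}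

namespace IsHamFamily

/-- If the time-`t` maps do not depend on `s`, then neither does `f^s_t (v q)`. -/
theorem pull_sweep_param_eq_zero (h : IsHamFamily σ ham flow) (hv : ContMDiffOn 𝓘(ℝ, W) I ∞ v T)
    {t : ℝ} (ht : t ∈ J) (hc : ∀ s ∈ J, ∀ x, flow s t x = flow 0 t x) {s : ℝ} (hs : s ∈ J)
    {q : W} (hq : q ∈ T) (X : (ℝ × ℝ) × W) :
    pull σ (sweep flow v) (Sq ×ˢ T) ((s, t), q) ((1, 0), 0) X = 0 := by
  have hθ : HasDerivWithinAt (fun s : ℝ => ((s, t), q)) ((1, 0), (0 : W)) J s :=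
    ((hasDerivWithinAt_id _ _).prodMk (hasDerivWithinAt_const _ _ _)).prodMk
      (hasDerivWithinAt_const _ _ _)
  have h1 := dWithin_comp (Φ := sweep flow v) (θ := fun s : ℝ => ((s, t), q))
    (((h.sweep_contMDiffOn hv) _ ⟨⟨hs, ht⟩, hq⟩).mdifferentiableWithinAt (by simp))
    hθ.differentiableWithinAt (fun s hs => ⟨⟨hs, ht⟩, hq⟩) (uniqueDiffOn_J _ hs)
  have h2 : dWithin I (fun s => sweep flow v ((s, t), q)) J s = 0 := by
    have h3 := mfderivWithin_congr (I := 𝓘(ℝ, ℝ)) (I' := I) (s := J) (x := s)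
      (f := fun _ => flow 0 t (v q)) (f₁ := fun s => sweep flow v ((s, t), q))
      (fun s hs => hc s hs _) (hc s hs _)
    exact h3.trans mfderivWithin_const
  rw [h2] at h1
  have h3 := congrArg (fun L : ℝ →L[ℝ] E n => L 1) h1
  simp only [ContinuousLinearMap.comp_apply, fderivWithin_one hθ (uniqueDiffOn_J _ hs)] at h3
  rw [pull_apply, ← h3]
  simp

theorem pull_sweep_param_zero (h : IsHamFamily σ ham flow) (hv : ContMDiffOn 𝓘(ℝ, W) I ∞ v T)
    {s : ℝ} (hs : s ∈ J) {q : W} (hq : q ∈ T) (X : (ℝ × ℝ) × W) :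
    pull σ (sweep flow v) (Sq ×ˢ T) ((s, 0), q) ((1, 0), 0) X = 0 :=
  h.pull_sweep_param_eq_zero hv zero_mem_J (fun s hs x => by
    rw [(h.generates s hs).zero, (h.generates 0 zero_mem_J).zero]) hs hq X

variable (h : IsHamFamily σ ham flow) (hone : ∀ s ∈ J, ∀ x, flow s 1 x = flow 0 1 x)
include h

/-- For a curve `u` in `M`, the pair of functions `∂_s F(s,t,f^s_t(u τ))` and
`ω(∂_s f^s_t(u τ), ∂_τ f^s_t(u τ))` of `(t,τ)` are the coefficients of a closed 1-form. -/
theorem curve_closed {u : ℝ → M} (hu : ContMDiffOn 𝓘(ℝ, ℝ) I ∞ u J) {s : ℝ} (hs : s ∈ J) :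
    ContDiffOn ℝ ∞ (fun p : ℝ × ℝ => hamDot ham s p.1 (flow s p.1 (u p.2))) Sq ∧
    ContDiffOn ℝ ∞ (fun p : ℝ × ℝ =>
      pull σ (sweep flow u) (Sq ×ˢ J) ((s, p.1), p.2) ((1, 0), 0) (0, 1)) Sq ∧
    ∀ p ∈ Sq, fderivWithin ℝ (fun p : ℝ × ℝ =>
      pull σ (sweep flow u) (Sq ×ˢ J) ((s, p.1), p.2) ((1, 0), 0) (0, 1)) Sq p (1, 0) =
      fderivWithin ℝ (fun p : ℝ × ℝ => hamDot ham s p.1 (flow s p.1 (u p.2))) Sq p (0, 1) := by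
  have ha := h.hamDot_contDiffOn hu uniqueDiffOn_J
  have hm := pull_contDiffOn σ (h.sweep_contMDiffOn hu) (uniqueDiffOn_Sq_prod uniqueDiffOn_J)
    ((1, 0), 0) (0, 1)
  have hθ : ContDiff ℝ ∞ (fun p : ℝ × ℝ => ((s, p.1), p.2)) := by fun_prop
  have hmaps : MapsTo (fun p : ℝ × ℝ => ((s, p.1), p.2)) Sq (Sq ×ˢ J) :=
    fun p hp => ⟨⟨hs, hp.1⟩, hp.2⟩
  refine ⟨ha.comp hθ.contDiffOn hmaps, hm.comp hθ.contDiffOn hmaps, fun p hp => ?_⟩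
  have hder : HasFDerivWithinAt (fun p : ℝ × ℝ => ((s, p.1), p.2))
      ((((0 : ℝ × ℝ →L[ℝ] ℝ).prod (ContinuousLinearMap.fst ℝ ℝ ℝ))).prod
        (ContinuousLinearMap.snd ℝ ℝ ℝ)) Sq p :=
    (((hasFDerivAt_const s p).prodMk hasFDerivAt_fst).prodMk hasFDerivAt_snd).hasFDerivWithinAt
  have e1 := ((((hm _ (hmaps hp)).differentiableWithinAt (by simp)).hasFDerivWithinAt).comp p hder
    hmaps).fderivWithin (uniqueDiffOn_Sq p hp)
  have e2 := ((((ha _ (hmaps hp)).differentiableWithinAt (by simp)).hasFDerivWithinAt).comp p hder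
    hmaps).fderivWithin (uniqueDiffOn_Sq p hp)
  have e3 := h.fderivWithin_pull_param J_subset_closure_interior hu uniqueDiffOn_J (hmaps hp) 1
  refine (congrArg (fun L : ℝ × ℝ →L[ℝ] ℝ => L (1, 0)) e1).trans
    (Eq.trans ?_ (congrArg (fun L : ℝ × ℝ →L[ℝ] ℝ => L (0, 1)) e2).symm)
  simp only [ContinuousLinearMap.comp_apply, ContinuousLinearMap.prod_apply, zero_apply,
    ContinuousLinearMap.coe_fst', ContinuousLinearMap.coe_snd']
  exact e3

include hone

/-- The maps at t = 0 and t = 1 do not vary with s, so ω(∂_sΦ, ∂_τΦ) vanishes on these two sides of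
the square. This is where the fixed end point of the homotopy is used to make the flux integral
independent of the starting point. -/
theorem integral_hamDot_path {u : ℝ → M} (hu : ContMDiffOn 𝓘(ℝ, ℝ) I ∞ u J) {s : ℝ} (hs : s ∈ J) :
    ∫ t in (0 : ℝ)..1, hamDot ham s t (flow s t (u 1)) =
      ∫ t in (0 : ℝ)..1, hamDot ham s t (flow s t (u 0)) := by
  obtain ⟨ha, hm, hc⟩ := h.curve_closed hu hs
  exact integral_top_eq_bottom ha hm hc
    (fun τ hτ => h.pull_sweep_param_zero hu hs hτ _)
    (fun τ hτ => h.pull_sweep_param_eq_zero hu one_mem_J hone hs hτ _)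

/-- The integrand on the left is exactly the combination that appears in the area of the moved disc,
where the flow time and the angle on the disc are the same variable t. -/
theorem integral_hamDot_diagonal {u : ℝ → M} (hu : ContMDiffOn 𝓘(ℝ, ℝ) I ∞ u J) {s : ℝ}
    (hs : s ∈ J) :
    ∫ t in (0 : ℝ)..1, (hamDot ham s t (flow s t (u t)) +
      pull σ (sweep flow u) (Sq ×ˢ J) ((s, t), t) ((1, 0), 0) (0, 1)) =
      ∫ t in (0 : ℝ)..1, hamDot ham s t (flow s t (u 0)) := by
  obtain ⟨ha, hm, hc⟩ := h.curve_closed hu hs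
  exact integral_diagonal_eq_bottom ha hm hc
    (fun τ hτ => h.pull_sweep_param_eq_zero hu one_mem_J hone hs hτ _)

end IsHamFamily

end Area

/-! ### Change of the symplectic area under a disc of diffeomorphisms -/

section AreaFormula

variable {n : ℕ} {H : Type*} [TopologicalSpace H] {I : ModelWithCorners ℝ (E n) H}
  {M : Type*} [TopologicalSpace M] [ChartedSpace H M] [IsManifold I ∞ M]
  {σ : SymplecticForm I M}
  {ham : ℝ → ℝ → M → ℝ} {flow : ℝ → ℝ → M ≃ₘ⟮I, I⟯ M} {v : ℝ × ℝ → M}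

namespace IsHamFamily

variable (h : IsHamFamily σ ham flow) (hv : ContMDiffOn 𝓘(ℝ, ℝ × ℝ) I ∞ v Sq)
include h hv

/-- The moved disc is the sweep restricted to the diagonal p ↦ (p,p), so each of its two tangent
vectors is a parameter part plus a space part. Expanding ω bilinearly gives four terms; the two
involving ∂_tΦ combine into an r-derivative of F∘Φ along the diagonal, up to sign, and a `hamDot`
term. -/
theorem pull_diagonal {p : ℝ × ℝ} (hp : p ∈ Sq) :
    pull σ (fun p => flow p.1 p.2 (v p)) Sq p (1, 0) (0, 1) =
      - fderivWithin ℝ (fun p : (ℝ × ℝ) × ℝ × ℝ => ham p.1.1 p.1.2 (sweep flow v p)) (Sq ×ˢ Sq)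
        (p, p) ((1, 0), (1, 0)) + hamDot ham p.1 p.2 (flow p.1 p.2 (v p)) +
      pull σ (sweep flow v) (Sq ×ˢ Sq) (p, p) ((1, 0), 0) (0, (0, 1)) +
      pull σ v Sq p (1, 0) (0, 1) := by
  have hP : (p, p) ∈ Sq ×ˢ Sq := ⟨hp, hp⟩
  have hθ : HasFDerivWithinAt (fun p : ℝ × ℝ => (p, p))
      ((ContinuousLinearMap.id ℝ (ℝ × ℝ)).prod (ContinuousLinearMap.id ℝ (ℝ × ℝ))) Sq p :=
    (hasFDerivWithinAt_id p Sq).prodMk (hasFDerivWithinAt_id p Sq)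
  have h1 := pull_comp σ (Φ := sweep flow v) (S := Sq ×ˢ Sq) (θ := fun p : ℝ × ℝ => (p, p))
    (((h.sweep_contMDiffOn hv) _ hP).mdifferentiableWithinAt (by simp))
    hθ.differentiableWithinAt (fun p hp => ⟨hp, hp⟩) (uniqueDiffOn_Sq p hp) (1, 0) (0, 1)
  rw [hθ.fderivWithin (uniqueDiffOn_Sq p hp)] at h1
  have e1 := h.bil_sweep_time_param hv uniqueDiffOn_Sq hP
  have e2 := h.bil_sweep_time_space hv uniqueDiffOn_Sq hP (1, 0)
  have e3 := h.pull_sweep_space_eq hv uniqueDiffOn_Sq Sq_subset_closure_interior hp.1 hp.2 hp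
    (1, 0) (0, 1)
  rw [pull_swap] at e1 e2
  have split (X : ℝ × ℝ) (Y : ℝ × ℝ) : ((X, Y) : (ℝ × ℝ) × ℝ × ℝ) = (X, 0) + (0, Y) := by simp
  refine h1.trans ?_
  simp only [ContinuousLinearMap.prod_apply, ContinuousLinearMap.id_apply]
  rw [split (1, 0) (1, 0), split (0, 1) (0, 1)]
  simp only [map_add, add_apply]
  have e4 : sweep flow v (p, p) = flow p.1 p.2 (v p) := rfl
  rw [e4] at e1
  linarith

/-- As in `pull_diagonal`, with s frozen at 0: the ∂_s terms disappear, and the area form of v is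
the same, so it cancels in the difference. -/
theorem pull_initial {p : ℝ × ℝ} (hp : p ∈ Sq) :
    pull σ (fun p => flow 0 p.2 (v p)) Sq p (1, 0) (0, 1) =
      - fderivWithin ℝ (fun p : (ℝ × ℝ) × ℝ × ℝ => ham p.1.1 p.1.2 (sweep flow v p)) (Sq ×ˢ Sq)
        ((0, p.2), p) (0, (1, 0)) + pull σ v Sq p (1, 0) (0, 1) := by
  have hP : ((0, p.2), p) ∈ Sq ×ˢ Sq := ⟨⟨zero_mem_J, hp.2⟩, hp⟩
  have hθ : HasFDerivWithinAt (fun p : ℝ × ℝ => (((0 : ℝ), p.2), p))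
      (((0 : ℝ × ℝ →L[ℝ] ℝ).prod (ContinuousLinearMap.snd ℝ ℝ ℝ)).prod
        (ContinuousLinearMap.id ℝ (ℝ × ℝ))) Sq p :=
    ((hasFDerivWithinAt_const 0 p Sq).prodMk hasFDerivWithinAt_snd).prodMk
      (hasFDerivWithinAt_id p Sq)
  have h1 := pull_comp σ (Φ := sweep flow v) (S := Sq ×ˢ Sq)
    (θ := fun p : ℝ × ℝ => (((0 : ℝ), p.2), p))
    (((h.sweep_contMDiffOn hv) _ hP).mdifferentiableWithinAt (by simp))
    hθ.differentiableWithinAt (fun p hp => ⟨⟨zero_mem_J, hp.2⟩, hp⟩) (uniqueDiffOn_Sq p hp)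
    (1, 0) (0, 1)
  rw [hθ.fderivWithin (uniqueDiffOn_Sq p hp)] at h1
  have e2 := h.bil_sweep_time_space hv uniqueDiffOn_Sq hP (1, 0)
  have e3 := h.pull_sweep_space_eq hv uniqueDiffOn_Sq Sq_subset_closure_interior zero_mem_J hp.2 hp
    (1, 0) (0, 1)
  rw [pull_swap] at e2
  have split (X : ℝ × ℝ) (Y : ℝ × ℝ) : ((X, Y) : (ℝ × ℝ) × ℝ × ℝ) = (X, 0) + (0, Y) := by simp
  refine h1.trans ?_
  simp only [ContinuousLinearMap.prod_apply, ContinuousLinearMap.id_apply, zero_apply,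
    ContinuousLinearMap.coe_snd']
  rw [split (0, 1) (0, 1), show ((0 : ℝ), (0 : ℝ)) = 0 from rfl]
  simp only [map_add]
  linarith

/-- Identifies the mixed term of `pull_diagonal` with the one for the single curve v(r, ·), which
the results on curves require. -/
theorem pull_slice {p : ℝ × ℝ} (hp : p ∈ Sq) :
    pull σ (sweep flow fun τ => v (p.1, τ)) (Sq ×ˢ J) (p, p.2) ((1, 0), 0) (0, 1) =
      pull σ (sweep flow v) (Sq ×ˢ Sq) (p, p) ((1, 0), 0) (0, (0, 1)) := by
  have hP : (p, p) ∈ Sq ×ˢ Sq := ⟨hp, hp⟩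
  have hu : UniqueDiffWithinAt ℝ (Sq ×ˢ J) (p, p.2) :=
    (uniqueDiffOn_Sq_prod uniqueDiffOn_J) _ ⟨hp, hp.2⟩
  have hθ : HasFDerivWithinAt (fun q : (ℝ × ℝ) × ℝ => (q.1, (p.1, q.2)))
      ((ContinuousLinearMap.fst ℝ (ℝ × ℝ) ℝ).prod
        ((0 : (ℝ × ℝ) × ℝ →L[ℝ] ℝ).prod (ContinuousLinearMap.snd ℝ (ℝ × ℝ) ℝ))) (Sq ×ˢ J)
        (p, p.2) :=
    hasFDerivWithinAt_fst.prodMk ((hasFDerivWithinAt_const _ _ _).prodMk hasFDerivWithinAt_snd)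
  have h1 := pull_comp σ (Φ := sweep flow v) (S := Sq ×ˢ Sq)
    (θ := fun q : (ℝ × ℝ) × ℝ => (q.1, (p.1, q.2)))
    (((h.sweep_contMDiffOn hv) _ hP).mdifferentiableWithinAt (by simp))
    hθ.differentiableWithinAt (fun q hq => ⟨hq.1, hp.1, hq.2⟩) hu
    ((1, 0), 0) (0, 1)
  rw [hθ.fderivWithin hu] at h1
  exact h1

variable (hone : ∀ s ∈ J, ∀ x, flow s 1 x = flow 0 1 x)
include hone

/-- In the difference of the two discs the area form of v cancels. For fixed r = s, the `hamDot` and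
mixed terms are integrated over t by `integral_hamDot_diagonal`, which pushes them to the starting
point v(s,0). The remaining terms are exact in r, hence the exchange of the order of integration. -/
theorem area_sub_area :
    (∫ r in (0 : ℝ)..1, ∫ t in (0 : ℝ)..1,
      pull σ (fun p => flow p.1 p.2 (v p)) Sq (r, t) (1, 0) (0, 1)) -
    (∫ r in (0 : ℝ)..1, ∫ t in (0 : ℝ)..1,
      pull σ (fun p => flow 0 p.2 (v p)) Sq (r, t) (1, 0) (0, 1)) =
    (∫ s in (0 : ℝ)..1, ∫ t in (0 : ℝ)..1, hamDot ham s t (flow s t (v (s, 0)))) -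
      ((∫ t in (0 : ℝ)..1, ham 1 t (flow 1 t (v (1, t)))) -
        ∫ t in (0 : ℝ)..1, ham 0 t (flow 0 t (v (1, t)))) := by
  have hS := uniqueDiffOn_Sq_prod uniqueDiffOn_Sq
  have hb := h.ham_sweep_contDiffOn hv
  set b : (ℝ × ℝ) × ℝ × ℝ → ℝ := fun p => ham p.1.1 p.1.2 (sweep flow v p) with hbdef
  have hd := h.hamDot_contDiffOn hv uniqueDiffOn_Sq
  have hθ₁ : MapsTo (fun p : ℝ × ℝ => (p, p)) Sq (Sq ×ˢ Sq) := fun p hp => ⟨hp, hp⟩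
  have hθ₀ : MapsTo (fun p : ℝ × ℝ => (((0 : ℝ), p.2), p)) Sq (Sq ×ˢ Sq) :=
    fun p hp => ⟨⟨zero_mem_J, hp.2⟩, hp⟩
  have hw₁ : ContMDiffOn 𝓘(ℝ, ℝ × ℝ) I ∞ (fun p => flow p.1 p.2 (v p)) Sq :=
    (h.sweep_contMDiffOn hv).comp (f := fun p : ℝ × ℝ => (p, p))
      (ContDiff.contMDiff (by fun_prop)).contMDiffOn hθ₁
  have hw₀ : ContMDiffOn 𝓘(ℝ, ℝ × ℝ) I ∞ (fun p => flow 0 p.2 (v p)) Sq :=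
    (h.sweep_contMDiffOn hv).comp (f := fun p : ℝ × ℝ => (((0 : ℝ), p.2), p))
      (ContDiff.contMDiff (by fun_prop)).contMDiffOn hθ₀
  have c1 : ContinuousOn (fun p : ℝ × ℝ => fderivWithin ℝ b (Sq ×ˢ Sq) (p, p) ((1, 0), (1, 0)))
      Sq :=
    (fderivWithin_apply_contDiffOn hb hS _).continuousOn.comp (by fun_prop) hθ₁
  have c0 : ContinuousOn (fun p : ℝ × ℝ => fderivWithin ℝ b (Sq ×ˢ Sq) ((0, p.2), p)
      (0, (1, 0))) Sq :=
    (fderivWithin_apply_contDiffOn hb hS _).continuousOn.comp (by fun_prop) hθ₀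
  have c2 : ContinuousOn (fun p : ℝ × ℝ => hamDot ham p.1 p.2 (flow p.1 p.2 (v p)) +
      pull σ (sweep flow v) (Sq ×ˢ Sq) (p, p) ((1, 0), 0) (0, (0, 1))) Sq :=
    (hd.continuousOn.comp (f := fun p : ℝ × ℝ => (p, p)) (by fun_prop) hθ₁).add
      ((pull_contDiffOn σ (h.sweep_contMDiffOn hv) hS _ _).continuousOn.comp (by fun_prop) hθ₁)
  have cb1 : ContinuousOn (fun p : ℝ × ℝ => b (p, p)) Sq :=
    hb.continuousOn.comp (by fun_prop) hθ₁
  have cb0 : ContinuousOn (fun p : ℝ × ℝ => b ((0, p.2), p)) Sq :=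
    hb.continuousOn.comp (by fun_prop) hθ₀
  rw [← integral_integral_sub_J
    (D := fun r t => pull σ (fun p => flow p.1 p.2 (v p)) Sq (r, t) (1, 0) (0, 1))
    (D' := fun r t => pull σ (fun p => flow 0 p.2 (v p)) Sq (r, t) (1, 0) (0, 1))
    (pull_contDiffOn σ hw₁ uniqueDiffOn_Sq _ _).continuousOn
    (pull_contDiffOn σ hw₀ uniqueDiffOn_Sq _ _).continuousOn]
  have e1 : ∫ r in (0 : ℝ)..1, ∫ t in (0 : ℝ)..1,
      (pull σ (fun p => flow p.1 p.2 (v p)) Sq (r, t) (1, 0) (0, 1) -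
        pull σ (fun p => flow 0 p.2 (v p)) Sq (r, t) (1, 0) (0, 1)) =
      ∫ r in (0 : ℝ)..1, ∫ t in (0 : ℝ)..1, ((hamDot ham r t (flow r t (v (r, t))) +
        pull σ (sweep flow v) (Sq ×ˢ Sq) ((r, t), (r, t)) ((1, 0), 0) (0, (0, 1))) -
        (fderivWithin ℝ b (Sq ×ˢ Sq) ((r, t), (r, t)) ((1, 0), (1, 0)) -
          fderivWithin ℝ b (Sq ×ˢ Sq) ((0, t), (r, t)) (0, (1, 0)))) := by
    refine integral_J_congr fun r hr => integral_J_congr fun t ht => ?_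
    rw [h.pull_diagonal hv (p := (r, t)) ⟨hr, ht⟩, h.pull_initial hv (p := (r, t)) ⟨hr, ht⟩]
    ring
  rw [e1, integral_integral_sub_J
    (D := fun r t => hamDot ham r t (flow r t (v (r, t))) +
        pull σ (sweep flow v) (Sq ×ˢ Sq) ((r, t), (r, t)) ((1, 0), 0) (0, (0, 1)))
    (D' := fun r t => fderivWithin ℝ b (Sq ×ˢ Sq) ((r, t), (r, t)) ((1, 0), (1, 0)) -
          fderivWithin ℝ b (Sq ×ˢ Sq) ((0, t), (r, t)) (0, (1, 0))) c2 (c1.sub c0),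
    integral_swap_J (D := fun r t => fderivWithin ℝ b (Sq ×ˢ Sq) ((r, t), (r, t)) ((1, 0), (1, 0)) -
          fderivWithin ℝ b (Sq ×ˢ Sq) ((0, t), (r, t)) (0, (1, 0))) (c1.sub c0)]
  congr 1
  · refine integral_J_congr fun s hs => ?_
    have hu : ContMDiffOn 𝓘(ℝ, ℝ) I ∞ (fun τ => v (s, τ)) J :=
      hv.comp (f := fun τ : ℝ => (s, τ)) (ContDiff.contMDiff (by fun_prop)).contMDiffOn
        fun τ hτ => ⟨hs, hτ⟩
    rw [← h.integral_hamDot_diagonal hone hu hs]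
    refine integral_J_congr fun t ht => ?_
    rw [← h.pull_slice hv (p := (s, t)) ⟨hs, ht⟩]
  · rw [← intervalIntegral.integral_sub]
    · refine integral_J_congr fun t ht => ?_
      -- At r = 0 the two values of `b` coincide; only the boundary circle r = 1 contributes the
      -- Hamiltonian terms.
      have d (r : ℝ) (hr : r ∈ J) : HasDerivWithinAt
          (fun r => b ((r, t), (r, t)) - b ((0, t), (r, t)))
          (fderivWithin ℝ b (Sq ×ˢ Sq) ((r, t), (r, t)) ((1, 0), (1, 0)) -
          fderivWithin ℝ b (Sq ×ˢ Sq) ((0, t), (r, t)) (0, (1, 0))) J r := by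
        have hr' : HasDerivWithinAt (fun r : ℝ => (r, t)) (1, 0) J r :=
          (hasDerivWithinAt_id _ _).prodMk (hasDerivWithinAt_const _ _ _)
        exact (hasDerivWithinAt_comp_fderivWithin (θ := fun r => ((r, t), (r, t)))
          ((hb _ (hθ₁ (x := (r, t)) ⟨hr, ht⟩)).differentiableWithinAt (by simp)) (hr'.prodMk hr')
            fun r hr => hθ₁ (x := (r, t)) ⟨hr, ht⟩).sub
          (hasDerivWithinAt_comp_fderivWithin (θ := fun r => ((0, t), (r, t)))
          ((hb _ (hθ₀ (x := (r, t)) ⟨hr, ht⟩)).differentiableWithinAt (by simp))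
            ((hasDerivWithinAt_const _ _ _).prodMk hr')
            fun r hr => hθ₀ (x := (r, t)) ⟨hr, ht⟩)
      rw [integral_deriv_J d (continuousOn_right (D := fun r t =>
        fderivWithin ℝ b (Sq ×ˢ Sq) ((r, t), (r, t)) ((1, 0), (1, 0)) -
          fderivWithin ℝ b (Sq ×ˢ Sq) ((0, t), (r, t)) (0, (1, 0))) (c1.sub c0) ht)]
      simp [hbdef, sweep]
    · exact intervalIntegrable_J (continuousOn_left (D := fun r t => b ((r, t), (r, t))) cb1
        one_mem_J)
    · exact intervalIntegrable_J (continuousOn_left (D := fun r t => b ((0, t), (r, t))) cb0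
        one_mem_J)

end IsHamFamily

end AreaFormula

/-! ### Constancy along smooth paths -/

section Connected

variable {n : ℕ} {H : Type*} [TopologicalSpace H] {I : ModelWithCorners ℝ (E n) H}
  {M : Type*} [TopologicalSpace M] [ChartedSpace H M] [IsManifold I ∞ M]

/-- A function on a connected manifold that takes the same value at the end points of each smooth
path is constant. -/
theorem eq_of_smooth_path [ConnectedSpace M] {Y : Type*} {g : M → Y}
    (hg : ∀ u : ℝ → M, ContMDiffOn 𝓘(ℝ, ℝ) I ∞ u J → g (u 1) = g (u 0)) (x y : M) : g x = g y := by
  refine IsLocallyConstant.apply_eq_of_preconnectedSpace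
    ((IsLocallyConstant.iff_eventually_eq g).2 fun x₀ => ?_) x y
  obtain ⟨ε, hε, hball⟩ := Metric.mem_nhdsWithin_iff.1
    (extChartAt_target_mem_nhdsWithin (I := I) x₀)
  have hcont : extChartAt I x₀ ⁻¹' Metric.ball (extChartAt I x₀ x₀) ε ∈ nhds x₀ :=
    (continuousAt_extChartAt x₀).preimage_mem_nhds (Metric.ball_mem_nhds _ hε)
  filter_upwards [hcont, extChartAt_source_mem_nhds (I := I) x₀] with y hy hys
  -- Near a boundary point the chart target need not contain a full ball. Convexity of `range I`
  -- keeps the segment in the part of the ball that lies in the target.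
  have hconv : Convex ℝ (Metric.ball (extChartAt I x₀ x₀) ε ∩ range I) :=
    (convex_ball _ _).inter I.convex_range
  set γ : ℝ → E n := fun ρ => extChartAt I x₀ x₀ + ρ • (extChartAt I x₀ y - extChartAt I x₀ x₀)
  have hγ : MapsTo γ J (extChartAt I x₀).target := fun ρ hρ =>
    hball (hconv.add_smul_sub_mem ⟨Metric.mem_ball_self hε, mem_range_self _⟩
      ⟨hy, mem_range_self _⟩ hρ)
  have h1 := hg (fun ρ => (extChartAt I x₀).symm (γ ρ))
    ((contMDiffOn_extChartAt_symm x₀).comp (ContDiff.contMDiff (by fun_prop)).contMDiffOn hγ)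
  have e0 : γ 0 = extChartAt I x₀ x₀ := by simp [γ]
  have e1 : γ 1 = extChartAt I x₀ y := by simp [γ]
  rwa [e0, e1, extChartAt_to_inv, (extChartAt I x₀).left_inv hys] at h1

end Connected

/-! ### Discs of symplectic diffeomorphisms acting on capped loops and frames -/

section DiskAction

variable {n : ℕ} {H : Type*} [TopologicalSpace H] {I : ModelWithCorners ℝ (E n) H}
  {M : Type*} [TopologicalSpace M] [ChartedSpace H M] [IsManifold I ∞ M]
  (σ : SymplecticForm I M)

/-- A disc of symplectic diffeomorphisms, in polar coordinates, that is the identity along the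
radius at angle zero. -/
structure IsSympDisk (Ψ : ℝ × ℝ → M ≃ₘ⟮I, I⟯ M) : Prop where
  smooth : ContMDiffOn (𝓘(ℝ, ℝ × ℝ).prod I) I ∞
    (fun q : (ℝ × ℝ) × M => Ψ q.1 q.2) (Sq ×ˢ univ)
  symplectic (p : ℝ × ℝ) (_ : p ∈ Sq) : IsSymplectic σ (Ψ p)
  center (t : ℝ) (_ : t ∈ J) (x : M) : Ψ (0, t) x = x
  start (r : ℝ) (_ : r ∈ J) (x : M) : Ψ (r, 0) x = x
  finish (r : ℝ) (_ : r ∈ J) (x : M) : Ψ (r, 1) x = x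

variable {σ} {Ψ : ℝ × ℝ → M ≃ₘ⟮I, I⟯ M}

/-- The action of a disc of diffeomorphisms on capped loops. -/
def IsSympDisk.act (h : IsSympDisk σ Ψ) (u : CappedLoop I M) : CappedLoop I M where
  disc p := Ψ p (u.disc p)
  smooth := h.smooth.comp (contMDiffOn_id.prodMk u.smooth) fun _ hp => ⟨hp, mem_univ _⟩
  center t ht := by rw [h.center t ht, h.center 0 zero_mem_J, u.center t ht]
  closed r hr := by rw [h.finish r hr, h.start r hr, u.closed r hr]

omit [IsManifold I ∞ M] in
theorem mfderivWithin_family_space {f : ℝ × ℝ → M → M}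
    (hf : ContMDiffOn (𝓘(ℝ, ℝ × ℝ).prod I) I ∞ (fun q : (ℝ × ℝ) × M => f q.1 q.2) (Sq ×ˢ univ))
    {p : ℝ × ℝ} (hp : p ∈ Sq) (x : M) (w : E n) :
    (mfderivWithin (𝓘(ℝ, ℝ × ℝ).prod I) I (fun q : (ℝ × ℝ) × M => f q.1 q.2) (Sq ×ˢ univ) (p, x) :
      (ℝ × ℝ) × E n →L[ℝ] E n) (0, w) = dMap I (f p) x w := by
  have hd : MDifferentiableWithinAt (𝓘(ℝ, ℝ × ℝ).prod I) I (fun q : (ℝ × ℝ) × M => f q.1 q.2)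
      (Sq ×ˢ univ) (p, x) := (hf _ ⟨hp, mem_univ _⟩).mdifferentiableWithinAt (by simp)
  have h3 := (hd.hasMFDerivWithinAt.comp (I := I) x (f := fun x => (p, x)) (s := univ)
    ((hasMFDerivWithinAt_const _ _ _).prodMk (hasMFDerivWithinAt_id _ _))
    (fun q hq => ⟨hp, mem_univ _⟩)).mfderivWithin (uniqueMDiffWithinAt_univ I)
  rw [mfderivWithin_univ] at h3
  exact (congrArg (fun L : E n →L[ℝ] E n => L w) h3).symm

/-- The pushed vectors are values of the tangent map of the total family (p,x) ↦ f_p(x) on vectors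
with zero parameter component, so joint continuity comes from joint smoothness. -/
theorem continuousOn_push {f : ℝ × ℝ → M → M}
    (hf : ContMDiffOn (𝓘(ℝ, ℝ × ℝ).prod I) I ∞ (fun q : (ℝ × ℝ) × M => f q.1 q.2) (Sq ×ˢ univ))
    {w : ℝ × ℝ → M} {e : ℝ × ℝ → E n}
    (he : ContinuousOn (fun p => (⟨w p, e p⟩ : TangentBundle I M)) Sq) :
    ContinuousOn (fun p => (⟨f p (w p), dMap I (f p) (w p) (e p)⟩ : TangentBundle I M)) Sq := by
  have hu : UniqueMDiffOn (𝓘(ℝ, ℝ × ℝ).prod I) (Sq ×ˢ (univ : Set M)) :=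
    (uniqueMDiffOn_iff_uniqueDiffOn.2 uniqueDiffOn_Sq).prod uniqueMDiffOn_univ
  have h1 := hf.continuousOn_tangentMapWithin (by simp) hu
  have h0 : Continuous (fun p : ℝ × ℝ => (⟨p, 0⟩ : TangentBundle 𝓘(ℝ, ℝ × ℝ) (ℝ × ℝ))) :=
    (Bundle.contMDiff_zeroSection (n := ∞) (IB := 𝓘(ℝ, ℝ × ℝ)) ℝ
      (TangentSpace 𝓘(ℝ, ℝ × ℝ) (M := ℝ × ℝ))).continuous
  have h2 : Continuous (equivTangentBundleProd 𝓘(ℝ, ℝ × ℝ) (ℝ × ℝ) I M).symm :=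
    (contMDiff_equivTangentBundleProd_symm (n := 0)).continuous
  have h3 := h2.comp_continuousOn (h0.continuousOn.prodMk he)
  have h4 := h1.comp h3 (fun p hp => ⟨hp, mem_univ _⟩)
  refine h4.congr fun p hp => ?_
  have h5 := mfderivWithin_family_space hf hp (w p) (e p)
  exact congrArg (fun z : E n => (⟨f p (w p), z⟩ : TangentBundle I M)) h5.symm

namespace IsSympDisk

omit [IsManifold I ∞ M] in
theorem dMap_eq_of_eq_id {f : M → M} (hf : ∀ x, f x = x) (x : M) (w : E n) : dMap I f x w = w := by
  rw [funext hf, dMap_id]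
  rfl

/-- The image of a symplectic frame along a disc. -/
def frame (h : IsSympDisk σ Ψ) {u : CappedLoop I M} (b : SympFrame σ u) :
    SympFrame σ (h.act u) where
  e p i := dMap I (Ψ p) (u.disc p) (b.e p i)
  f p i := dMap I (Ψ p) (u.disc p) (b.f p i)
  continuous_e i := continuousOn_push h.smooth (b.continuous_e i)
  continuous_f i := continuousOn_push h.smooth (b.continuous_f i)
  center_e t ht i := by
    rw [dMap_eq_of_eq_id (h.center t ht), dMap_eq_of_eq_id (h.center 0 zero_mem_J),
      b.center_e t ht]
  center_f t ht i := by
    rw [dMap_eq_of_eq_id (h.center t ht), dMap_eq_of_eq_id (h.center 0 zero_mem_J),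
      b.center_f t ht]
  closed_e r hr i := by
    rw [dMap_eq_of_eq_id (h.finish r hr), dMap_eq_of_eq_id (h.start r hr), b.closed_e r hr]
  closed_f r hr i := by
    rw [dMap_eq_of_eq_id (h.finish r hr), dMap_eq_of_eq_id (h.start r hr), b.closed_f r hr]
  form_ee p hp i j := (h.symplectic p hp _ _ _).trans (b.form_ee p hp i j)
  form_ff p hp i j := (h.symplectic p hp _ _ _).trans (b.form_ff p hp i j)
  form_ef p hp i j := (h.symplectic p hp _ _ _).trans (b.form_ef p hp i j)

/-- The entries of the transition matrix are values of ω, and over the boundary circle both frames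
are moved by the same symplectic map. Hence the winding number defining c₁ can be computed with the
same logarithm. -/
theorem transitionDet_frame (h : IsSympDisk σ Ψ) {u u' : CappedLoop I M} (b : SympFrame σ u)
    (b' : SympFrame σ u') {t : ℝ} (ht : t ∈ J) (hu : u.loop t = u'.loop t) :
    transitionDet σ (h.frame b) (h.frame b') t = transitionDet σ b b' t := by
  have hs (x y : E n) : σ.bil ((h.act u).loop t) (dMap I (Ψ (1, t)) (u.disc (1, t)) x)
      (dMap I (Ψ (1, t)) (u.disc (1, t)) y) = σ.bil (u.loop t) x y :=
    h.symplectic (1, t) ⟨one_mem_J, ht⟩ _ _ _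
  have hu' : u'.disc (1, t) = u.disc (1, t) := hu.symm
  simp only [transitionDet, frame, hu', hs]

theorem hasChernNumber (h : IsSympDisk σ Ψ) {u u' : CappedLoop I M} {k : ℤ}
    (hu : ∀ t ∈ J, u.loop t = u'.loop t) (hk : HasChernNumber σ u u' k) :
    HasChernNumber σ (h.act u) (h.act u') k := by
  obtain ⟨b, b', L, hL, he, hk⟩ := hk
  refine ⟨h.frame b, h.frame b', L, hL, fun t ht => ?_, hk⟩
  rw [he t ht, h.transitionDet_frame b b' ht (hu t ht)]

theorem act_loop_eq (h : IsSympDisk σ Ψ) {u u' : CappedLoop I M} {t : ℝ}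
    (hu : u.loop t = u'.loop t) : (h.act u).loop t = (h.act u').loop t :=
  congrArg (Ψ (1, t)) hu

end IsSympDisk

end DiskAction

/-! ### The canonical lifting on pairs and its effect on area -/

section Lift

variable {n : ℕ} {H : Type*} [TopologicalSpace H] {I : ModelWithCorners ℝ (E n) H}
  {M : Type*} [TopologicalSpace M] [ChartedSpace H M] [IsManifold I ∞ M]
  {σ : SymplecticForm I M} [MeasurableSpace M] {φ : M ≃ₘ⟮I, I⟯ M} {G F : ℝ → M → ℝ}

namespace HamHomotopy

variable (P : HamHomotopy σ φ G F)

/-- The disc of diffeomorphisms `f^r_t ∘ g_t⁻¹`. -/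
def disk (p : ℝ × ℝ) : M ≃ₘ⟮I, I⟯ M := (P.flow 0 p.2).symm.trans (P.flow p.1 p.2)

theorem flow_zero_symm {s : ℝ} (hs : s ∈ J) (x : M) : (P.flow s 0).symm x = x := by
  conv_lhs => rw [← (P.generates s hs).zero x]
  simp

theorem isSympDisk_disk : IsSympDisk σ P.disk where
  smooth := by
    have h1 : ContMDiffOn (𝓘(ℝ, ℝ × ℝ).prod I) I ∞
        (fun q : (ℝ × ℝ) × M => (P.flow 0 q.1.2).symm q.2) (Sq ×ˢ univ) :=
      P.smooth_flow_symm.comp (f := fun q : (ℝ × ℝ) × M => (((0 : ℝ), q.1.2), q.2))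
        (((ContDiff.contMDiff (by fun_prop : ContDiff ℝ ∞ fun p : ℝ × ℝ => ((0 : ℝ), p.2))).comp
          contMDiff_fst).prodMk contMDiff_snd).contMDiffOn
        fun q hq => ⟨⟨zero_mem_J, hq.1.2⟩, mem_univ _⟩
    exact P.smooth_flow.comp (contMDiff_fst.contMDiffOn.prodMk h1) fun q hq => ⟨hq.1, mem_univ _⟩
  symplectic p hp := (P.isHamFamily.isSymplectic zero_mem_J hp.2).symm.comp
    (P.isHamFamily.isSymplectic hp.1 hp.2)
  center t ht x := by simp [disk]
  start r hr x := by simp [disk, P.flow_zero_symm zero_mem_J, (P.generates r hr).zero]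
  finish r hr x := by simp [disk, P.flow_one r hr, P.flow_one 0 zero_mem_J]

theorem isSympDisk_disk_symm : IsSympDisk σ (fun p => (P.disk p).symm) where
  smooth := by
    have h1 : ContMDiffOn (𝓘(ℝ, ℝ × ℝ).prod I) (𝓘(ℝ, ℝ × ℝ).prod I) ∞
        (fun q : (ℝ × ℝ) × M => (((0 : ℝ), q.1.2), (P.flow q.1.1 q.1.2).symm q.2)) (Sq ×ˢ univ) :=
      (((ContDiff.contMDiff (by fun_prop : ContDiff ℝ ∞ fun p : ℝ × ℝ => ((0 : ℝ), p.2))).comp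
          contMDiff_fst).contMDiffOn).prodMk P.smooth_flow_symm
    exact P.smooth_flow.comp h1 fun q hq => ⟨⟨zero_mem_J, hq.1.2⟩, mem_univ _⟩
  symplectic p hp := (P.isSympDisk_disk.symplectic p hp).symm
  center t ht x := by
    conv_lhs => rw [← P.isSympDisk_disk.center t ht x]
    simp
  start r hr x := by
    conv_lhs => rw [← P.isSympDisk_disk.start r hr x]
    simp
  finish r hr x := by
    conv_lhs => rw [← P.isSympDisk_disk.finish r hr x]
    simp

/-- The inverse of the lifting on pairs. -/
def unliftPair (u : CappedLoop I M) : CappedLoop I M := P.isSympDisk_disk_symm.act u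

theorem liftPair_eq_act (u : CappedLoop I M) : P.liftPair u = P.isSympDisk_disk.act u := rfl

theorem liftPair_unliftPair (u : CappedLoop I M) : P.liftPair (P.unliftPair u) = u := by
  cases u
  simp [liftPair_eq_act, unliftPair, IsSympDisk.act]

theorem unliftPair_liftPair (u : CappedLoop I M) : P.unliftPair (P.liftPair u) = u := by
  cases u
  simp [liftPair_eq_act, unliftPair, IsSympDisk.act]

/-- `area_sub_area` with v = g_t⁻¹∘w: moving v by f^r_t gives the lifted disc, and moving it by
f^0_t = g_t gives back w. -/
theorem area_liftPair (u : CappedLoop I M) :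
    area σ (P.liftPair u) - area σ u =
    (∫ s in (0 : ℝ)..1, ∫ t in (0 : ℝ)..1,
      hamDot P.ham s t (P.flow s t ((P.flow 0 0).symm (u.disc (s, 0))))) -
    ((∫ t in (0 : ℝ)..1, F t ((P.liftPair u).loop t)) - ∫ t in (0 : ℝ)..1, G t (u.loop t)) := by
  have hv : ContMDiffOn 𝓘(ℝ, ℝ × ℝ) I ∞ (fun p => (P.flow 0 p.2).symm (u.disc p)) Sq :=
    P.smooth_flow_symm.comp (f := fun p : ℝ × ℝ => (((0 : ℝ), p.2), u.disc p))
      ((ContDiff.contMDiff (by fun_prop)).contMDiffOn.prodMk u.smooth)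
      fun p hp => ⟨⟨zero_mem_J, hp.2⟩, mem_univ _⟩
  have key := P.isHamFamily.area_sub_area hv
    (fun s hs x => by rw [P.flow_one s hs, P.flow_one 0 zero_mem_J])
  have e1 : ∫ t in (0 : ℝ)..1, P.ham 1 t (P.flow 1 t ((P.flow 0 t).symm (u.disc (1, t)))) =
      ∫ t in (0 : ℝ)..1, F t ((P.liftPair u).loop t) :=
    integral_J_congr fun t ht => by rw [P.ham_one t ht]; rfl
  have e0 : ∫ t in (0 : ℝ)..1, P.ham 0 t (P.flow 0 t ((P.flow 0 t).symm (u.disc (1, t)))) =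
      ∫ t in (0 : ℝ)..1, G t (u.loop t) :=
    integral_J_congr fun t ht => by rw [P.ham_zero t ht, Diffeomorph.apply_symm_apply]; rfl
  simp only [e1, e0] at key
  simp only [Diffeomorph.apply_symm_apply] at key
  exact key

end HamHomotopy

end Lift

/-! ### Orbits and generators of composed isotopies -/

section Orbits

variable {n : ℕ} {H : Type*} [TopologicalSpace H] {I : ModelWithCorners ℝ (E n) H}
  {M : Type*} [TopologicalSpace M] [ChartedSpace H M] [IsManifold I ∞ M]
  {σ : SymplecticForm I M} {F G : ℝ → M → ℝ} {f g : ℝ → M ≃ₘ⟮I, I⟯ M} {z : ℝ → M}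

omit [IsManifold I ∞ M] in
theorem SmoothHam.contMDiff (h : SmoothHam I F) {t : ℝ} (ht : t ∈ J) :
    ContMDiff I 𝓘(ℝ, ℝ) ∞ (F t) := by
  rw [← contMDiffOn_univ]
  exact h.comp (f := fun x => (t, x)) (contMDiff_const.prodMk contMDiff_id).contMDiffOn
    fun x _ => ⟨ht, mem_univ _⟩

omit [IsManifold I ∞ M] in
theorem SmoothHam.mdifferentiableAt (h : SmoothHam I F) {t : ℝ} (ht : t ∈ J) (x : M) :
    MDifferentiableAt I 𝓘(ℝ, ℝ) (F t) x :=
  (h.contMDiff ht).mdifferentiableAt (by simp)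

namespace Generates

theorem congr (h : Generates σ F f) (e : ∀ t ∈ J, F t = G t) : Generates σ G f where
  smooth_ham := ContMDiffOn.congr h.smooth_ham fun q hq => (congrFun (e q.1 hq.1) q.2).symm
  smooth := h.smooth
  smooth_symm := h.smooth_symm
  zero := h.zero
  orbit x := ⟨(h.orbit x).1, fun t ht v => by rw [← e t ht]; exact (h.orbit x).2 t ht v⟩

theorem contMDiffOn_curve (h : Generates σ F f) (hz : ContMDiffOn 𝓘(ℝ, ℝ) I ∞ z J) :
    ContMDiffOn 𝓘(ℝ, ℝ) I ∞ (fun t => f t (z t)) J :=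
  h.smooth.comp (contMDiffOn_id.prodMk hz) fun _ ht => ⟨ht, mem_univ _⟩

theorem contMDiffOn_curve_symm (h : Generates σ F f) (hz : ContMDiffOn 𝓘(ℝ, ℝ) I ∞ z J) :
    ContMDiffOn 𝓘(ℝ, ℝ) I ∞ (fun t => (f t).symm (z t)) J :=
  h.smooth_symm.comp (contMDiffOn_id.prodMk hz) fun _ ht => ⟨ht, mem_univ _⟩

theorem bil_velocity (h : Generates σ F f) (hz : ContMDiffOn 𝓘(ℝ, ℝ) I ∞ z J) {t : ℝ} (ht : t ∈ J)
    (w : E n) :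
    σ.bil (f t (z t)) (velocity I (fun t => f t (z t)) t) w = differential I (F t) (f t (z t)) w +
      σ.bil (f t (z t)) (dMap I (f t) (z t) (velocity I z t)) w := by
  have h1 := mfderivWithin_family (f := fun t : ℝ => f t) uniqueDiffOn_J h.smooth
    uniqueDiffOn_J (τ := fun t : ℝ => t) differentiableOn_id (fun t ht => ht)
    (hz.mdifferentiableOn (by simp)) ht 1
  have h0 : fderivWithin ℝ (fun t : ℝ => t) J t 1 = 1 :=
    fderivWithin_one (hasDerivWithinAt_id t J) (uniqueDiffOn_J t ht)
  rw [h0] at h1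
  have h2 := (h.orbit (z t)).2 t ht w
  rw [← h2, ← add_apply, ← map_add]
  exact congrArg (fun y => σ.bil (f t (z t)) y w) h1

/-- If `z` is an orbit of `G`, then `g_t⁻¹ z(t)` is at rest, and `f_t g_t⁻¹ z(t)` is an orbit
of `F`. -/
theorem isHamOrbit_transfer (hF : Generates σ F f) (hG : Generates σ G g) (hz : IsHamOrbit σ G z) :
    IsHamOrbit σ F (fun t => f t ((g t).symm (z t))) := by
  have hy := hG.contMDiffOn_curve_symm hz.1
  refine ⟨hF.contMDiffOn_curve hy, fun t ht w => ?_⟩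
  have hvel : velocity I (fun t => (g t).symm (z t)) t = 0 := by
    have h1 (w : E n) := hG.bil_velocity hy ht w
    simp only [Diffeomorph.apply_symm_apply] at h1
    have h2 : dMap I (g t) ((g t).symm (z t)) (velocity I (fun t => (g t).symm (z t)) t) = 0 :=
      bil_eq_zero σ (x := z t) fun w => by
        have := h1 w
        rw [hz.2 t ht w] at this
        linarith
    rw [← dMap_symm_dMap (g t) ((g t).symm (z t)) (velocity I (fun t => (g t).symm (z t)) t), h2,
      map_zero]
  rw [hF.bil_velocity hy ht w, hvel]
  simp

/-- The isotopy `f_t ∘ g_t⁻¹` is generated by `F_t - G_t ∘ g_t ∘ f_t⁻¹`. -/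
theorem comp_symm (hF : Generates σ F f) (hG : Generates σ G g) :
    Generates σ (fun t x => F t x - G t (((g t).symm.trans (f t)).symm x))
      (fun t => (g t).symm.trans (f t)) where
  smooth_ham := by
    have h1 : ContMDiffOn (𝓘(ℝ, ℝ).prod I) I ∞ (fun q : ℝ × M => g q.1 ((f q.1).symm q.2))
        (J ×ˢ univ) :=
      hG.smooth.comp (contMDiff_fst.contMDiffOn.prodMk hF.smooth_symm)
        fun q hq => ⟨hq.1, mem_univ _⟩
    have h2 : ContMDiffOn (𝓘(ℝ, ℝ).prod I) 𝓘(ℝ, ℝ) ∞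
        (fun q : ℝ × M => G q.1 (g q.1 ((f q.1).symm q.2))) (J ×ˢ univ) :=
      hG.smooth_ham.comp (contMDiff_fst.contMDiffOn.prodMk h1) fun q hq => ⟨hq.1, mem_univ _⟩
    exact hF.smooth_ham.sub h2
  smooth := hF.smooth.comp (contMDiff_fst.contMDiffOn.prodMk hG.smooth_symm)
    fun q hq => ⟨hq.1, mem_univ _⟩
  smooth_symm := hG.smooth.comp (contMDiff_fst.contMDiffOn.prodMk hF.smooth_symm)
    fun q hq => ⟨hq.1, mem_univ _⟩
  zero x := by
    have : (g 0).symm x = x := by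
      conv_lhs => rw [← hG.zero x]
      simp
    simp [this, hF.zero]
  orbit x := by
    have hx : ContMDiffOn 𝓘(ℝ, ℝ) I ∞ (fun _ : ℝ => x) J := contMDiffOn_const
    have hy := hG.contMDiffOn_curve_symm hx
    refine ⟨hF.contMDiffOn_curve hy, fun t ht w => ?_⟩
    set y : M := (g t).symm x with hydef
    set y' : E n := velocity I (fun t => (g t).symm x) t with hy'
    have hgy : g t y = x := (g t).apply_symm_apply x
    -- The constant curve x equals g_t(y(t)) with y(t) = g_t⁻¹(x). Its velocity is zero, so the
    -- velocity of y, pushed by g_t, is dual to -dG_t.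
    have h1 (w : E n) : 0 = differential I (G t) x w + σ.bil x (dMap I (g t) y y') w := by
      have := hG.bil_velocity hy ht w
      simp only [Diffeomorph.apply_symm_apply] at this
      rw [← this]
      have hv : velocity I (fun _ : ℝ => x) t = 0 := by
        have : mfderivWithin 𝓘(ℝ, ℝ) I (fun _ : ℝ => x) J t = 0 := mfderivWithin_const
        exact congrArg (fun L : ℝ →L[ℝ] E n => L 1) this
      rw [hv]
      simp
    have h2 := hF.bil_velocity hy ht w
    refine h2.trans ?_
    set w' : E n := dMap I (f t).symm (f t y) w with hw'
    have hw : dMap I (f t) y w' = w := by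
      have := dMap_dMap_symm (f t) (f t y) w
      rwa [Diffeomorph.symm_apply_apply] at this
    -- The identity `h1` lives at x = g_t(y), while the velocity sought is at f_t(y). Symplecticity
    -- of f_t and g_t carries the pairing from one point to the other through y.
    have h3 : σ.bil (f t y) (dMap I (f t) y y') w =
        σ.bil x (dMap I (g t) y y') (dMap I (g t) y w') := by
      rw [← hgy, hG.isSymplectic ht, ← hF.isSymplectic ht y y' w', hw]
    have h4 : differential I (fun x => F t x - G t (((g t).symm.trans (f t)).symm x)) (f t y) w =
        differential I (F t) (f t y) w - differential I (G t) x (dMap I (g t) y w') := by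
      have e1 := dMap_comp (Diffeomorph.mdifferentiableAt' (g t) ((f t).symm (f t y)))
        (Diffeomorph.mdifferentiableAt' (f t).symm (f t y))
      have e2 := differential_comp (h := G t) (f := fun x => g t ((f t).symm x)) (x := f t y)
        (hG.smooth_ham.mdifferentiableAt ht _)
        (Diffeomorph.mdifferentiableAt' ((f t).symm.trans (g t)) (f t y))
      rw [e1] at e2
      simp only [Diffeomorph.symm_apply_apply, hgy] at e2
      have e3 := mfderiv_sub (hF.smooth_ham.mdifferentiableAt ht (f t y))
        (((hG.smooth_ham.contMDiff ht).comp ((f t).symm.trans (g t)).contMDiff).mdifferentiableAt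
          (x := f t y) (by simp))
      have e4 := congrArg (fun L : E n →L[ℝ] ℝ => L w) e2
      have e5 := congrArg (fun L : E n →L[ℝ] ℝ => L w) e3
      refine e5.trans ?_
      exact congrArg (fun c => differential I (F t) (f t y) w - c) e4
    refine Eq.trans ?_ h4.symm
    rw [h3]
    linarith [h1 (dMap I (g t) y w')]

/-- Two Hamiltonians generating the same isotopy differ by a function of time. -/
theorem sub_eq_sub [ConnectedSpace M] (hF : Generates σ F f) (hG : Generates σ G f) {t : ℝ}
    (ht : t ∈ J) (x y : M) : F t x - G t x = F t y - G t y := by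
  have hd (x : M) : differential I (F t) x = differential I (G t) x := by
    ext w
    have h1 := (hF.orbit ((f t).symm x)).2 t ht w
    have h2 := (hG.orbit ((f t).symm x)).2 t ht w
    rw [h2] at h1
    simpa using h1.symm
  refine eq_of_smooth_path (I := I) (g := fun x => F t x - G t x) (fun u hu => ?_) x y
  have hc {K : ℝ → M → ℝ} (hK : Generates σ K f) : DifferentiableOn ℝ (fun ρ => K t (u ρ)) J :=
    ((hK.smooth_ham.contMDiff ht).comp_contMDiffOn hu).contDiffOn.differentiableOn (by simp)
  refine eq_of_hasDerivWithinAt_zero (g := fun ρ => F t (u ρ) - G t (u ρ)) (fun ρ hρ => ?_)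
    one_mem_J
  have e1 := (hc hF ρ hρ).hasFDerivWithinAt
  have e2 := (hc hG ρ hρ).hasFDerivWithinAt
  have hu' := hu.mdifferentiableOn (by simp) ρ hρ
  rw [fderivWithin_differential (hF.smooth_ham.mdifferentiableAt ht _) hu' (uniqueDiffOn_J ρ hρ)]
    at e1
  rw [fderivWithin_differential (hG.smooth_ham.mdifferentiableAt ht _) hu' (uniqueDiffOn_J ρ hρ),
    ← hd] at e2
  have e3 := (e1.sub e2).hasDerivWithinAt
  rw [sub_self, zero_apply] at e3
  exact e3

end Generates

end Orbits

/-! ### Determinant of the matrix of an alternating form -/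

section Gram

variable {n : ℕ}

/-- The matrix of a bilinear form on the model space. -/
def gram (B : E n →L[ℝ] E n →L[ℝ] ℝ) : Matrix (Fin (2 * n)) (Fin (2 * n)) ℝ :=
  Matrix.of fun i j => B (EuclideanSpace.single i 1) (EuclideanSpace.single j 1)

theorem gram_mulVec (B : E n →L[ℝ] E n →L[ℝ] ℝ) (v : Fin (2 * n) → ℝ) (i : Fin (2 * n)) :
    (gram B).mulVec v i = B (EuclideanSpace.single i 1) (WithLp.toLp 2 v) := by
  have hv : WithLp.toLp 2 v = ∑ j, v j • (EuclideanSpace.single j (1 : ℝ) : E n) := by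
    have := (EuclideanSpace.basisFun (Fin (2 * n)) ℝ).sum_repr (WithLp.toLp 2 v)
    simpa using this.symm
  rw [hv, map_sum]
  simp [gram, Matrix.mulVec, dotProduct, mul_comm]

theorem det_gram_bilinearComp (B : E n →L[ℝ] E n →L[ℝ] ℝ) (L : E n →L[ℝ] E n) :
    (gram (B.bilinearComp L L)).det = L.det ^ 2 * (gram B).det := by
  set b := (EuclideanSpace.basisFun (Fin (2 * n)) ℝ).toBasis
  have hb (i : Fin (2 * n)) : b i = EuclideanSpace.single i 1 := by simp [b]
  let T := LinearMap.toMatrix b b (L : E n →ₗ[ℝ] E n)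
  have hT : T.det = L.det := LinearMap.det_toMatrix b _
  have hL (j : Fin (2 * n)) : L (EuclideanSpace.single j 1) = WithLp.toLp 2 (fun k => T k j) := by
    ext k
    simp [T, LinearMap.toMatrix_apply, b]
  have key : gram (B.bilinearComp L L) = T.transpose * gram B * T := by
    ext i j
    have h1 : gram (B.bilinearComp L L) i j =
        B (L (EuclideanSpace.single i 1)) (L (EuclideanSpace.single j 1)) := rfl
    have hi : L (EuclideanSpace.single i 1) =
        ∑ k, T k i • (EuclideanSpace.single k (1 : ℝ) : E n) := by
      rw [hL]
      have := (EuclideanSpace.basisFun (Fin (2 * n)) ℝ).sum_repr (WithLp.toLp 2 (fun k => T k i))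
      simpa using this.symm
    rw [h1, hi, map_sum, Matrix.mul_assoc, Matrix.mul_apply]
    simp only [map_smul, sum_apply, smul_apply, Matrix.transpose_apply, smul_eq_mul]
    refine Finset.sum_congr rfl fun k _ => ?_
    rw [hL, ← gram_mulVec]
    rfl
  rw [key, Matrix.det_mul, Matrix.det_mul, Matrix.det_transpose, hT]
  ring

/-- Join the identity to the Gram matrix by a segment. For s < 1 a kernel vector v of (1-s)·1 + s·B
would satisfy (1-s)|v|² = 0, because B(v,v) = 0. So the determinant cannot change sign along the
segment, and it is nonzero at the end by nondegeneracy. -/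
theorem det_gram_pos {B : E n →L[ℝ] E n →L[ℝ] ℝ} (halt : ∀ v, B v v = 0)
    (hnd : ∀ v, (∀ w, B w v = 0) → v = 0) : 0 < (gram B).det := by
  have hne : (gram B).det ≠ 0 := by
    intro h0
    obtain ⟨v, hv, h⟩ := Matrix.exists_mulVec_eq_zero_iff.2 h0
    refine hv (?_ : v = 0)
    have : (WithLp.toLp 2 v : E n) = 0 := hnd _ fun w => by
      have hw : w = ∑ j, w j • (EuclideanSpace.single j (1 : ℝ) : E n) := by
        have := (EuclideanSpace.basisFun (Fin (2 * n)) ℝ).sum_repr w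
        simpa using this.symm
      rw [hw, map_sum, sum_apply]
      refine Finset.sum_eq_zero fun j _ => ?_
      rw [map_smul, smul_apply, ← gram_mulVec, h]
      simp
    simpa using this
  by_contra hpos
  have hneg : (gram B).det < 0 := lt_of_le_of_ne (not_lt.1 hpos) hne
  let g : ℝ → ℝ := fun s => ((1 - s) • (1 : Matrix (Fin (2 * n)) (Fin (2 * n)) ℝ) + s • gram B).det
  have hg : ContinuousOn g (Icc 0 1) := by
    refine Continuous.continuousOn ?_
    exact Continuous.matrix_det (by fun_prop)
  have hg0 : g 0 = 1 := by simp [g]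
  have hg1 : g 1 = (gram B).det := by simp [g]
  obtain ⟨s, hs, hs0⟩ := intermediate_value_Icc' zero_le_one hg
    (show (0 : ℝ) ∈ Icc (g 1) (g 0) by rw [hg0, hg1]; exact ⟨hneg.le, zero_le_one⟩)
  have hs1 : s < 1 := lt_of_le_of_ne hs.2 fun h => by
    rw [h, hg1] at hs0
    exact hne hs0
  obtain ⟨v, hv, h⟩ := Matrix.exists_mulVec_eq_zero_iff.2 hs0
  have hq : v ⬝ᵥ (gram B).mulVec v = 0 := by
    have h1 : v ⬝ᵥ (gram B).mulVec v = B (WithLp.toLp 2 v) (WithLp.toLp 2 v) := by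
      have hv : (WithLp.toLp 2 v : E n) = ∑ j, v j • (EuclideanSpace.single j (1 : ℝ) : E n) := by
        have := (EuclideanSpace.basisFun (Fin (2 * n)) ℝ).sum_repr (WithLp.toLp 2 v)
        simpa using this.symm
      have hB (w : E n) : B (WithLp.toLp 2 v) w = ∑ j, v j * B (EuclideanSpace.single j 1) w := by
        rw [hv, map_sum, sum_apply]
        simp
      rw [hB]
      refine Finset.sum_congr rfl fun j _ => ?_
      rw [gram_mulVec]
    rw [h1, halt]
  have h2 := congrArg (fun w => v ⬝ᵥ w) h
  simp only [Matrix.add_mulVec, Matrix.smul_mulVec, Matrix.one_mulVec, dotProduct_add,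
    dotProduct_smul, hq, smul_eq_mul, mul_zero, add_zero, dotProduct_zero, mul_eq_zero] at h2
  rcases h2 with h2 | h2
  · linarith
  · exact hv (dotProduct_self_eq_zero.1 h2)

end Gram

/-! ### The Liouville density in a chart -/

section Density

variable {n : ℕ} {H : Type*} [TopologicalSpace H] {I : ModelWithCorners ℝ (E n) H}
  {M : Type*} [TopologicalSpace M] [ChartedSpace H M] [IsManifold I ∞ M] (σ : SymplecticForm I M)

/-- The density of the Liouville measure in the chart at `x₀`. -/
def density (x₀ : M) (y : E n) : ℝ := Real.sqrt (gram (localForm I σ.form x₀ y)).det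

theorem continuousOn_density (x₀ : M) : ContinuousOn (density σ x₀) (extChartAt I x₀).target := by
  refine Real.continuous_sqrt.comp_continuousOn ?_
  have hB := (σ.smooth x₀).continuousOn
  have : ContinuousOn (fun y => gram (localForm I σ.form x₀ y)) (extChartAt I x₀).target := by
    refine continuousOn_pi.2 fun i => continuousOn_pi.2 fun j => ?_
    exact (hB.clm_apply continuousOn_const).clm_apply continuousOn_const
  exact (Continuous.matrix_det continuous_id).comp_continuousOn this

theorem density_pos {x₀ : M} {y : E n} (hy : y ∈ (extChartAt I x₀).target) :
    0 < density σ x₀ y := by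
  refine Real.sqrt_pos.2 (det_gram_pos (fun v => ?_) fun v hv => ?_)
  · rw [localForm_apply, bil_self]
  · have : IsManifold I 1 M := IsManifold.of_le (n := ∞) (by norm_cast)
    obtain ⟨e, he⟩ := isInvertible_mfderivWithin_extChartAt_symm (I := I) hy
    have he' (w : E n) : dChartSymm I x₀ y w = e w :=
      congrArg (fun L : E n →L[ℝ] E n => L w) he.symm
    have h0 : dChartSymm I x₀ y v = 0 := bil_eq_zero σ (x := (extChartAt I x₀).symm y) fun w => by
      obtain ⟨w', rfl⟩ : ∃ w' : E n, dChartSymm I x₀ y w' = w := by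
        obtain ⟨w', hw'⟩ := e.surjective w
        exact ⟨w', (he' w').trans hw'⟩
      have h1 := hv w'
      rwa [localForm_apply, bil_swap, neg_eq_zero] at h1
    exact e.map_eq_zero_iff.1 ((he' v).symm.trans h0)

end Density

/-! ### The Liouville measure and its invariance under symplectic diffeomorphisms -/

section Liouville

variable {n : ℕ} {H : Type*} [TopologicalSpace H] {I : ModelWithCorners ℝ (E n) H}
  {M : Type*} [TopologicalSpace M] [ChartedSpace H M] [IsManifold I ∞ M] (σ : SymplecticForm I M)
  [MeasurableSpace M] [BorelSpace M]

omit [IsManifold I ∞ M] [MeasurableSpace M] [BorelSpace M] in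
theorem measurableSet_target (x₀ : M) : MeasurableSet (extChartAt I x₀).target := by
  rw [extChartAt_target]
  exact ((chartAt H x₀).open_target.preimage I.continuous_symm).measurableSet.inter
    I.isClosed_range.measurableSet

omit [IsManifold I ∞ M] in
theorem measurableSet_target_inter (x₀ : M) {A : Set M} (hA : MeasurableSet A) :
    MeasurableSet ((extChartAt I x₀).target ∩ (extChartAt I x₀).symm ⁻¹' A) := by
  have h := (continuousOn_iff_continuous_domRestrict.1
    (continuousOn_extChartAt_symm (I := I) x₀)).measurable hA
  have h2 := (measurableSet_target (I := I) x₀).subtype_image h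
  rwa [domRestrict_eq, preimage_comp, Subtype.image_preimage_coe] at h2

theorem chartMeasure_apply (x₀ : M) {A : Set M} (hA : MeasurableSet A) :
    chartMeasure σ x₀ A =
      ∫⁻ y in (extChartAt I x₀).target ∩ (extChartAt I x₀).symm ⁻¹' A,
        ENNReal.ofReal (density σ x₀ y) := by
  have ht := measurableSet_target (I := I) x₀
  have hm : AEMeasurable (extChartAt I x₀).symm
      ((volume.restrict (extChartAt I x₀).target).withDensity fun y =>
        ENNReal.ofReal (density σ x₀ y)) :=
    ((continuousOn_extChartAt_symm (I := I) x₀).aemeasurable ht).mono_ac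
      (withDensity_absolutelyContinuous _ _)
  have h1 : chartMeasure σ x₀ = Measure.map (extChartAt I x₀).symm
    ((volume.restrict (extChartAt I x₀).target).withDensity fun y =>
        ENNReal.ofReal (density σ x₀ y)) := rfl
  rw [h1, Measure.map_apply_of_aemeasurable hm hA, withDensity_apply',
    Measure.restrict_restrict' ht, inter_comm]

theorem chartMeasure_inter_source (x₀ : M) {A : Set M} (hA : MeasurableSet A) :
    chartMeasure σ x₀ A = chartMeasure σ x₀ (A ∩ (extChartAt I x₀).source) := by
  rw [chartMeasure_apply σ x₀ hA, chartMeasure_apply σ x₀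
    (hA.inter (isOpen_extChartAt_source x₀).measurableSet)]
  congr 2
  ext y
  exact ⟨fun h => ⟨h.1, h.2, (extChartAt I x₀).map_target h.1⟩, fun h => ⟨h.1, h.2.1⟩⟩

variable {σ}

/-- The change of variables formula for a symplectic diffeomorphism between two charts. -/
theorem chartMeasure_image {f : M ≃ₘ⟮I, I⟯ M} (hf : IsSymplectic σ f) {x₀ x₁ : M} {A : Set M}
    (hA : MeasurableSet A) (h0 : A ⊆ (extChartAt I x₀).source)
    (h1 : A ⊆ f ⁻¹' (extChartAt I x₁).source) :
    chartMeasure σ x₁ (f '' A) = chartMeasure σ x₀ A := by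
  have hfA : MeasurableSet (f '' A) :=
    f.toHomeomorph.toMeasurableEquiv.measurableEmbedding.measurableSet_image.2 hA
  rw [chartMeasure_apply σ x₁ hfA, chartMeasure_apply σ x₀ hA]
  set T := (extChartAt I x₀).target
  set S := T ∩ (extChartAt I x₀).symm ⁻¹' A with hS
  set Φ : E n → M := fun y => f ((extChartAt I x₀).symm y) with hΦdef
  set θ : E n → E n := fun y => extChartAt I x₁ (Φ y) with hθdef
  have hsymm := contMDiffOn_extChartAt_symm (I := I) (n := ∞) x₀
  have hΦ : ContMDiffOn 𝓘(ℝ, E n) I ∞ Φ T := f.contMDiff.comp_contMDiffOn hsymm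
  have hT : UniqueDiffOn ℝ T := uniqueDiffOn_extChartAt_target x₀
  have himg : (extChartAt I x₁).target ∩ (extChartAt I x₁).symm ⁻¹' (f '' A) = θ '' S := by
    ext y
    constructor
    · rintro ⟨hy, a, ha, hay⟩
      refine ⟨extChartAt I x₀ a, ⟨(extChartAt I x₀).map_source (h0 ha), ?_⟩, ?_⟩
      · rwa [mem_preimage, (extChartAt I x₀).left_inv (h0 ha)]
      · simp only [hθdef, hΦdef]
        rw [(extChartAt I x₀).left_inv (h0 ha), hay, (extChartAt I x₁).right_inv hy]
    · rintro ⟨y', ⟨hy', hA'⟩, rfl⟩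
      refine ⟨(extChartAt I x₁).map_source (h1 hA'), (extChartAt I x₀).symm y', hA', ?_⟩
      simp only [hθdef, hΦdef]
      rw [(extChartAt I x₁).left_inv (h1 hA')]
  have hinj : InjOn θ S := by
    intro y hy z hz hyz
    have e1 := (extChartAt I x₁).injOn (h1 hy.2) (h1 hz.2) hyz
    exact (extChartAt I x₀).symm.injOn hy.1 hz.1 (f.injective e1)
  have hder : ∀ y ∈ S, HasFDerivWithinAt θ (fderivWithin ℝ θ T y) S y := fun y hy =>
    (((contDiffWithinAt_extChartAt hΦ hy.1 (h1 hy.2)).differentiableWithinAt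
      (by simp)).hasFDerivWithinAt).mono inter_subset_left
  rw [himg, lintegral_image_eq_lintegral_abs_det_fderiv_mul volume
    (measurableSet_target_inter x₀ hA) hder hinj]
  refine setLIntegral_congr_fun (measurableSet_target_inter x₀ hA) fun y hy => ?_
  -- As f is symplectic, pulling ω back by f after the inverse chart at x₀ is the local form at x₀;
  -- computed in the chart at x₁ it is the local form there, pulled back by θ. The square root of
  -- det² is then exactly the Jacobian factor.
  have hloc : localForm I σ.form x₀ y = (localForm I σ.form x₁ (θ y)).bilinearComp
      (fderivWithin ℝ θ T y) (fderivWithin ℝ θ T y) := by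
    rw [← pull_eq_localForm σ hy.1 (hΦ.mdifferentiableOn (by simp)) hT (h1 hy.2)]
    have hmd := (hsymm.mdifferentiableOn (by simp)) y hy.1
    have hD : dWithin I (extChartAt I x₀).symm T y = dChartSymm I x₀ y :=
      mfderivWithin_subset (extChartAt_target_subset_range x₀)
        (uniqueMDiffWithinAt_iff_uniqueDiffWithinAt.2 (hT y hy.1))
        (mdifferentiableWithinAt_extChartAt_symm hy.1)
    ext u w
    rw [pull_apply, dWithin_dMap (Diffeomorph.mdifferentiableAt' _ _) hmd (hT y hy.1), hD,
      localForm_apply]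
    exact (hf _ _ _).symm
  have hdens : density σ x₀ y = |(fderivWithin ℝ θ T y).det| * density σ x₁ (θ y) := by
    rw [density, hloc, det_gram_bilinearComp, Real.sqrt_mul (sq_nonneg _), Real.sqrt_sq_eq_abs]
    rfl
  simp only [hdens]
  rw [ENNReal.ofReal_mul (abs_nonneg _)]

omit [MeasurableSpace M] [BorelSpace M] in
theorem isSymplectic_refl : IsSymplectic σ (Diffeomorph.refl I M ∞) := by
  intro x u w
  have h : dMap I (Diffeomorph.refl I M ∞) x = ContinuousLinearMap.id ℝ (E n) := dMap_id x
  rw [h]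
  rfl

omit [BorelSpace M] in
theorem chartMeasure_le_liouville (x₀ : M) : chartMeasure σ x₀ ≤ liouville σ :=
  le_iSup (chartMeasure σ) x₀

theorem liouville_eq_chartMeasure {x₀ : M} {A : Set M} (hA : MeasurableSet A)
    (h0 : A ⊆ (extChartAt I x₀).source) : liouville σ A = chartMeasure σ x₀ A := by
  refine le_antisymm ?_ (chartMeasure_le_liouville x₀ A)
  have hs : MeasurableSet (extChartAt I x₀).source := (isOpen_extChartAt_source x₀).measurableSet
  -- A supremum of measures is not a supremum set by set. An upper bound is obtained from a measure
  -- that dominates every chart measure: inside the chart domain by agreement on overlaps, outside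
  -- it by the Liouville measure itself.
  have hle : liouville σ ≤
      chartMeasure σ x₀ + (liouville σ).restrict (extChartAt I x₀).sourceᶜ := by
    refine iSup_le fun y => Measure.le_iff.2 fun B hB => ?_
    rw [← measure_inter_add_sdiff B hs, Measure.add_apply, Measure.restrict_apply hB]
    refine add_le_add ?_ (chartMeasure_le_liouville y _)
    rw [chartMeasure_inter_source σ y (hB.inter hs)]
    have := chartMeasure_image (σ := σ) isSymplectic_refl (x₀ := x₀) (x₁ := y)
      (A := B ∩ (extChartAt I x₀).source ∩ (extChartAt I y).source)
      ((hB.inter hs).inter (isOpen_extChartAt_source y).measurableSet)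
      (fun z hz => hz.1.2) (fun z hz => hz.2)
    simp only [Diffeomorph.coe_refl, image_id] at this
    rw [this]
    exact measure_mono fun z hz => hz.1.1
  have h1 := hle A
  rw [Measure.add_apply, Measure.restrict_apply hA,
    (disjoint_compl_right_iff_subset.2 h0).inter_eq, measure_empty, add_zero] at h1
  exact h1

/-- Equality of measures is local on a countable open cover, which second countability provides. The
sets `U x` are small enough for one chart around x and one around f⁻¹(x) to suffice. -/
theorem liouville_image [SecondCountableTopology M] {f : M ≃ₘ⟮I, I⟯ M} (hf : IsSymplectic σ f) :
    Measure.map f (liouville σ) = liouville σ := by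
  have hcont : Continuous f := f.continuous
  let U : M → Set M := fun y => f '' ((extChartAt I (f.symm y)).source ∩
    f ⁻¹' (extChartAt I y).source)
  have hUo (x : M) : IsOpen ((extChartAt I (f.symm x)).source ∩ f ⁻¹' (extChartAt I x).source) :=
    (isOpen_extChartAt_source _).inter ((isOpen_extChartAt_source _).preimage hcont)
  have hU (x : M) : U x ∈ nhds x := by
    refine (f.toHomeomorph.isOpenMap _ (hUo x)).mem_nhds
      ⟨f.symm x, ⟨mem_extChartAt_source _, ?_⟩, f.apply_symm_apply x⟩
    rw [mem_preimage, f.apply_symm_apply]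
    exact mem_extChartAt_source x
  obtain ⟨s, hs, hcover⟩ := TopologicalSpace.countable_cover_nhds hU
  refine (Measure.ext_iff_of_biUnion_eq_univ hs hcover).2 fun x _ => Measure.ext fun B hB => ?_
  have hUm : MeasurableSet (U x) := (f.toHomeomorph.isOpenMap _ (hUo x)).measurableSet
  rw [Measure.restrict_apply hB, Measure.restrict_apply hB,
    Measure.map_apply hcont.measurable (hB.inter hUm)]
  have hsub : B ∩ U x ⊆ (extChartAt I x).source := by
    rintro _ ⟨-, y, hy, rfl⟩
    exact hy.2
  have hpre : f ⁻¹' (B ∩ U x) ⊆ (extChartAt I (f.symm x)).source := by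
    rintro y ⟨-, z, hz, hzy⟩
    rw [← f.injective hzy]
    exact hz.1
  have hm : MeasurableSet (f ⁻¹' (B ∩ U x)) := hcont.measurable (hB.inter hUm)
  rw [liouville_eq_chartMeasure (hB.inter hUm) hsub, liouville_eq_chartMeasure hm hpre,
    ← chartMeasure_image hf hm hpre (x₁ := x) (fun y hy => hsub hy),
    show f '' (f ⁻¹' (B ∩ U x)) = B ∩ U x from f.toHomeomorph.image_preimage _]

theorem integral_comp_isSymplectic [SecondCountableTopology M] {f : M ≃ₘ⟮I, I⟯ M}
    (hf : IsSymplectic σ f) (g : M → ℝ) :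
    ∫ x, g (f x) ∂(liouville σ) = ∫ x, g x ∂(liouville σ) := by
  conv_rhs => rw [← liouville_image hf]
  exact (integral_map_equiv f.toHomeomorph.toMeasurableEquiv g).symm

/-- The density is positive, so a zero measure would make a chart target null and its interior
empty. But the target is nonempty and lies in the closure of its interior. -/
theorem liouville_ne_zero [Nonempty M] : liouville σ univ ≠ 0 := by
  obtain ⟨x⟩ := ‹Nonempty M›
  intro h0
  have h1 : chartMeasure σ x univ = 0 := le_antisymm (h0 ▸ chartMeasure_le_liouville x univ) bot_le
  rw [chartMeasure_apply σ x MeasurableSet.univ, preimage_univ, inter_univ,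
    lintegral_eq_zero_iff' ((continuousOn_density σ x).aemeasurable
      (measurableSet_target x)).ennreal_ofReal] at h1
  have h2 : ∀ᵐ y ∂(volume.restrict (extChartAt I x).target), y ∉ (extChartAt I x).target :=
    h1.mono fun y hy hy' => by
      have := density_pos σ hy'
      simp only [Pi.zero_apply, ENNReal.ofReal_eq_zero] at hy
      linarith
  have h3 : volume (extChartAt I x).target = 0 := by
    rw [ae_restrict_iff' (measurableSet_target x), ae_iff] at h2
    exact measure_mono_null (fun y hy => fun h => h hy hy) h2
  have h4 : volume (interior (extChartAt I x).target) = 0 :=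
    measure_mono_null interior_subset h3
  have h5 := (isOpen_interior.measure_eq_zero_iff volume).1 h4
  have h6 := extChartAt_target_subset_closure_interior (I := I) (mem_extChartAt_target (I := I) x)
  rw [h5, closure_empty] at h6
  exact h6

theorem isLocallyFiniteMeasure_liouville : IsLocallyFiniteMeasure (liouville σ) := by
  refine ⟨fun x => ?_⟩
  have hy := mem_extChartAt_target (I := I) x
  set y₀ := extChartAt I x x
  have hc : ∀ᶠ y in nhdsWithin y₀ (extChartAt I x).target, density σ x y < density σ x y₀ + 1 :=
    (continuousOn_density σ x y₀ hy).eventually_lt_const (by linarith)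
  rw [eventually_nhdsWithin_iff] at hc
  obtain ⟨ε, hε, hball⟩ := Metric.eventually_nhds_iff_ball.1 hc
  have hopen : IsOpen ((extChartAt I x).source ∩ extChartAt I x ⁻¹' Metric.ball y₀ ε) :=
    (continuousOn_extChartAt x).isOpen_inter_preimage (isOpen_extChartAt_source x)
      Metric.isOpen_ball
  refine ⟨_, hopen.mem_nhds ⟨mem_extChartAt_source x, Metric.mem_ball_self hε⟩, ?_⟩
  rw [liouville_eq_chartMeasure hopen.measurableSet inter_subset_left,
    chartMeasure_apply σ x hopen.measurableSet]
  have hsub : (extChartAt I x).target ∩ (extChartAt I x).symm ⁻¹'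
      ((extChartAt I x).source ∩ extChartAt I x ⁻¹' Metric.ball y₀ ε) ⊆ Metric.ball y₀ ε := by
    rintro y ⟨hyt, -, hyb⟩
    rwa [mem_preimage, (extChartAt I x).right_inv hyt] at hyb
  calc _ ≤ ∫⁻ _ in (extChartAt I x).target ∩ (extChartAt I x).symm ⁻¹'
      ((extChartAt I x).source ∩ extChartAt I x ⁻¹' Metric.ball y₀ ε),
        ENNReal.ofReal (density σ x y₀ + 1) :=
        setLIntegral_mono' (measurableSet_target_inter x hopen.measurableSet) fun y hy =>
          ENNReal.ofReal_le_ofReal (hball y (hsub hy) hy.1).le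
    _ ≤ ENNReal.ofReal (density σ x y₀ + 1) * volume (Metric.ball y₀ ε) := by
        rw [setLIntegral_const]
        gcongr
    _ < ⊤ := ENNReal.mul_lt_top ENNReal.ofReal_lt_top measure_ball_lt_top

end Liouville

/-! ### Normalized Hamiltonians: uniqueness and stability -/

section Normalization

variable {n : ℕ} {H : Type*} [TopologicalSpace H] {I : ModelWithCorners ℝ (E n) H}
  {M : Type*} [TopologicalSpace M] [ChartedSpace H M]

theorem exists_notMem_of_not_isClosedMfd (hM : ¬ IsClosedMfd I M) {K : Set M} (hK : IsCompact K)
    (hKi : K ⊆ I.interior M) : ∃ x, x ∉ K := by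
  by_contra! h
  have hu : K = univ := eq_univ_of_forall h
  refine hM ⟨⟨hu ▸ hK⟩, ?_⟩
  rw [← I.compl_interior, compl_empty_iff]
  exact eq_univ_of_univ_subset (hu ▸ hKi)

variable [IsManifold I ∞ M] {σ : SymplecticForm I M} [MeasurableSpace M] [BorelSpace M]

theorem isFiniteMeasure_liouville [CompactSpace M] : IsFiniteMeasure (liouville σ) := by
  have := isLocallyFiniteMeasure_liouville (σ := σ)
  exact CompactSpace.isFiniteMeasure

theorem liouville_real_pos [CompactSpace M] [Nonempty M] : (liouville σ).real univ ≠ 0 := by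
  have := isFiniteMeasure_liouville (σ := σ)
  rw [Measure.real, ENNReal.toReal_ne_zero]
  exact ⟨liouville_ne_zero, measure_ne_top _ _⟩

variable [T2Space M] [SecondCountableTopology M]

theorem integrable_liouville [CompactSpace M] {g : M → ℝ} (hg : Continuous g) :
    Integrable g (liouville σ) := by
  have := isLocallyFiniteMeasure_liouville (σ := σ)
  rw [← integrableOn_univ]
  exact hg.continuousOn.integrableOn_compact isCompact_univ

theorem integral_swap_liouville [CompactSpace M] {g : ℝ → M → ℝ}
    (hg : ContinuousOn (fun q : ℝ × M => g q.1 q.2) (J ×ˢ univ)) :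
    ∫ s in (0 : ℝ)..1, ∫ x, g s x ∂(liouville σ) =
      ∫ x, (∫ s in (0 : ℝ)..1, g s x) ∂(liouville σ) := by
  have := isLocallyFiniteMeasure_liouville (σ := σ)
  have := isFiniteMeasure_liouville (σ := σ)
  refine intervalIntegral_integral_swap ?_
  rw [uIoc_of_le zero_le_one]
  have h1 : IntegrableOn (fun q : ℝ × M => g q.1 q.2) (J ×ˢ univ)
      ((volume : Measure ℝ).prod (liouville σ)) :=
    hg.integrableOn_compact (isCompact_Icc.prod isCompact_univ)
  have h2 := h1.mono_set (prod_mono (Ioc_subset_Icc_self (a := (0 : ℝ)) (b := 1)) subset_rfl)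
  rwa [IntegrableOn, ← Measure.prod_restrict, Measure.restrict_univ] at h2

theorem integral_integral_swap_liouville [CompactSpace M] {g : ℝ → ℝ → M → ℝ}
    (hg : ContinuousOn (fun q : (ℝ × ℝ) × M => g q.1.1 q.1.2 q.2) (Sq ×ˢ univ)) :
    ∫ s in (0 : ℝ)..1, ∫ t in (0 : ℝ)..1, ∫ x, g s t x ∂(liouville σ) =
      ∫ x, (∫ s in (0 : ℝ)..1, ∫ t in (0 : ℝ)..1, g s t x) ∂(liouville σ) := by
  rw [← integral_swap_liouville (g := fun s x => ∫ t in (0 : ℝ)..1, g s t x)]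
  · refine integral_J_congr fun s hs => integral_swap_liouville (g := g s) ?_
    exact hg.comp (f := fun q : ℝ × M => ((s, q.1), q.2)) (by fun_prop)
      fun q hq => ⟨⟨hs, hq.1⟩, mem_univ _⟩
  · refine continuousOn_integral_J (D := fun (q : ℝ × M) t => g q.1 t q.2) ?_
    exact hg.comp (f := fun p : (ℝ × M) × ℝ => ((p.1.1, p.2), p.1.2)) (by fun_prop)
      fun p hp => ⟨⟨hp.1.1, hp.2⟩, mem_univ _⟩

variable {F G : ℝ → M → ℝ} {f g : ℝ → M ≃ₘ⟮I, I⟯ M}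

/-- A normalized Hamiltonian is determined by the isotopy that it generates. -/
theorem IsNormalized.eq_of_generates [ConnectedSpace M] (hF : IsNormalized σ F)
    (hG : IsNormalized σ G) (hFf : Generates σ F f) (hGf : Generates σ G f) {t : ℝ} (ht : t ∈ J) :
    F t = G t := by
  have hsub := hFf.sub_eq_sub hGf ht
  obtain ⟨x₀⟩ := ‹ConnectedSpace M›.toNonempty
  suffices h0 : F t x₀ - G t x₀ = 0 by
    funext x
    linarith [hsub x x₀]
  rcases hF with ⟨hc, hF⟩ | ⟨hc, K, hK, hKi, hF⟩
  · rcases hG with ⟨-, hG⟩ | ⟨hc', -⟩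
    · have := hc.1
      have h1 := integral_sub
        (integrable_liouville (σ := σ) (hFf.smooth_ham.contMDiff ht).continuous)
        (integrable_liouville (σ := σ) (hGf.smooth_ham.contMDiff ht).continuous)
      rw [hF t ht, hG t ht, integral_congr_ae (.of_forall fun x => hsub x x₀), integral_const,
        smul_eq_mul, sub_zero] at h1
      -- The constant difference times the total volume is a difference of vanishing means.
      exact (mul_eq_zero.1 h1).resolve_left liouville_real_pos
    · exact absurd hc hc'
  · rcases hG with ⟨hc', -⟩ | ⟨-, K', hK', hKi', hG⟩
    · exact absurd hc' hc
    · obtain ⟨x, hx⟩ := exists_notMem_of_not_isClosedMfd hc (hK.union hK') (union_subset hKi hKi')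
      rw [mem_union, not_or] at hx
      rw [hsub x₀ x, hF t ht x hx.1, hG t ht x hx.2, sub_zero]

/-- On a closed manifold the mean of the second term is unchanged, as the loop consists of
symplectic maps. On an open one its support is swept by the loop over a compact set, which stays in
the interior because diffeomorphisms preserve the interior. -/
theorem IsNormalized.comp_symm (hF : IsNormalized σ F) (hG : IsNormalized σ G)
    (hFf : Generates σ F f) (hGg : Generates σ G g) :
    IsNormalized σ (fun t x => F t x - G t (((g t).symm.trans (f t)).symm x)) := by
  have hgen := hFf.comp_symm hGg
  rcases hF with ⟨hc, hF⟩ | ⟨hc, K, hK, hKi, hF⟩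
  · rcases hG with ⟨-, hG⟩ | ⟨hc', -⟩
    · refine .inl ⟨hc, fun t ht => ?_⟩
      have := hc.1
      have h1 : Integrable (fun x => G t (((g t).symm.trans (f t)).symm x)) (liouville σ) :=
        integrable_liouville ((hGg.smooth_ham.contMDiff ht).continuous.comp
          ((g t).symm.trans (f t)).symm.continuous)
      change ∫ x, (F t x - G t (((g t).symm.trans (f t)).symm x)) ∂(liouville σ) = 0
      rw [integral_sub (integrable_liouville (hFf.smooth_ham.contMDiff ht).continuous) h1, hF t ht,
        integral_comp_isSymplectic (hgen.isSymplectic ht).symm, hG t ht, sub_zero]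
    · exact absurd hc hc'
  · rcases hG with ⟨hc', -⟩ | ⟨-, K', hK', hKi', hG⟩
    · exact absurd hc' hc
    · refine .inr ⟨hc, K ∪ (fun q : ℝ × M => ((g q.1).symm.trans (f q.1)) q.2) '' (J ×ˢ K'),
        hK.union ((isCompact_Icc.prod hK').image_of_continuousOn
          (hgen.smooth.continuousOn.mono (prod_mono subset_rfl (subset_univ _)))),
        union_subset hKi ?_, fun t ht x hx => ?_⟩
      · rintro _ ⟨⟨t, x⟩, hx, rfl⟩
        have h1 := ((g t).symm.trans (f t)).image_interior (by simp)
        rw [← h1]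
        exact mem_image_of_mem _ (hKi' hx.2)
      · rw [mem_union, not_or] at hx
        have h2 : ((g t).symm.trans (f t)).symm x ∉ K' := fun h =>
          hx.2 ⟨(t, _), ⟨ht, h⟩, Diffeomorph.apply_symm_apply _ _⟩
        simp only [hF t ht x hx.1, hG t ht _ h2, sub_zero]

end Normalization

/-! ### Vanishing of the constant of integration -/

section Flux

variable {n : ℕ} {H : Type*} [TopologicalSpace H] {I : ModelWithCorners ℝ (E n) H}
  {M : Type*} [TopologicalSpace M] [ChartedSpace H M] [IsManifold I ∞ M]
  {σ : SymplecticForm I M}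
  {ham : ℝ → ℝ → M → ℝ} {flow : ℝ → ℝ → M ≃ₘ⟮I, I⟯ M}

namespace IsHamFamily

/-- Continuity is local in x: sweeping the inverse chart at x reduces it to `hamDot_contDiffOn`. -/
theorem continuousOn_hamDot_flow (h : IsHamFamily σ ham flow) :
    ContinuousOn (fun q : (ℝ × ℝ) × M => hamDot ham q.1.1 q.1.2 (flow q.1.1 q.1.2 q.2))
      (Sq ×ˢ univ) := by
  rintro ⟨a, x⟩ hq
  have h1 := (h.hamDot_contDiffOn (contMDiffOn_extChartAt_symm (I := I) (n := ∞) x)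
    (uniqueDiffOn_extChartAt_target x)).continuousOn
  have h2 : ContinuousOn (fun q : (ℝ × ℝ) × M => (q.1, extChartAt I x q.2))
      (Sq ×ˢ (extChartAt I x).source) :=
    continuousOn_fst.prodMk ((continuousOn_extChartAt x).comp continuousOn_snd fun q hq => hq.2)
  have h3 := h1.comp h2 fun q hq => ⟨hq.1, (extChartAt I x).map_source hq.2⟩
  have h4 : ContinuousOn (fun q : (ℝ × ℝ) × M => hamDot ham q.1.1 q.1.2 (flow q.1.1 q.1.2 q.2))
      (Sq ×ˢ (extChartAt I x).source) := h3.congr fun q hq => by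
    simp only [Function.comp, sweep, (extChartAt I x).left_inv hq.2]
  refine (h4 (a, x) ⟨hq.1, mem_extChartAt_source x⟩).mono_of_mem_nhdsWithin ?_
  have h5 : (univ : Set (ℝ × ℝ)) ×ˢ (extChartAt I x).source ∈ nhds (a, x) :=
    prod_mem_nhds Filter.univ_mem (extChartAt_source_mem_nhds x)
  filter_upwards [self_mem_nhdsWithin, mem_nhdsWithin_of_mem_nhds h5] with q hq hq'
  exact ⟨hq.1, hq'.2⟩

theorem contDiffOn_ham (h : IsHamFamily σ ham flow) (x : M) :
    ContDiffOn ℝ ∞ (fun a : ℝ × ℝ => ham a.1 a.2 x) Sq :=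
  (h.smooth_ham.comp (f := fun a : ℝ × ℝ => (a, x))
    (contMDiff_id.prodMk contMDiff_const).contMDiffOn fun _ ha => ⟨ha, mem_univ _⟩).contDiffOn

theorem hasDerivWithinAt_ham (h : IsHamFamily σ ham flow) {s t : ℝ} (hs : s ∈ J) (ht : t ∈ J)
    (x : M) : HasDerivWithinAt (fun s => ham s t x) (hamDot ham s t x) J s :=
  hasDerivWithinAt_fst (p := (s, t)) (h.contDiffOn_ham x) ⟨hs, ht⟩

theorem hamDot_eq_zero (h : IsHamFamily σ ham flow) {s t : ℝ} (hs : s ∈ J) (ht : t ∈ J) {x : M}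
    (hx : ∀ᶠ s' in nhdsWithin s J, ham s' t x = 0) : hamDot ham s t x = 0 := by
  have h1 : HasDerivWithinAt (fun s => ham s t x) 0 J s :=
    (hasDerivWithinAt_const s J (0 : ℝ)).congr_of_eventuallyEq hx (hx.self_of_nhdsWithin hs)
  exact (uniqueDiffOn_J s hs).eq_deriv _ (h.hasDerivWithinAt_ham hs ht x) h1

theorem integral_hamDot (h : IsHamFamily σ ham flow) {t : ℝ} (ht : t ∈ J) (x : M) :
    ∫ s in (0 : ℝ)..1, hamDot ham s t x = ham 1 t x - ham 0 t x :=
  integral_deriv_J (fun _ hs => h.hasDerivWithinAt_ham hs ht x)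
    (continuousOn_right (D := fun s t => hamDot ham s t x)
      (continuousOn_fderivWithin_Sq (h.contDiffOn_ham x) (1, 0)) ht)

end IsHamFamily

namespace HamHomotopy

variable [MeasurableSpace M] {φ : M ≃ₘ⟮I, I⟯ M} {G F : ℝ → M → ℝ} (P : HamHomotopy σ φ G F)

theorem integral_hamDot_const [ConnectedSpace M] {s : ℝ} (hs : s ∈ J) (x y : M) :
    ∫ t in (0 : ℝ)..1, hamDot P.ham s t (P.flow s t x) =
      ∫ t in (0 : ℝ)..1, hamDot P.ham s t (P.flow s t y) :=
  eq_of_smooth_path (I := I) (g := fun x => ∫ t in (0 : ℝ)..1, hamDot P.ham s t (P.flow s t x))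
    (fun _ hu => P.isHamFamily.integral_hamDot_path
      (fun s hs x => by rw [P.flow_one s hs, P.flow_one 0 zero_mem_J]) hu hs) x y

theorem continuousOn_hamDot : ContinuousOn (fun q : (ℝ × ℝ) × M => hamDot P.ham q.1.1 q.1.2 q.2)
    (Sq ×ˢ univ) := by
  have h1 := P.isHamFamily.continuousOn_hamDot_flow.comp
    (f := fun q : (ℝ × ℝ) × M => (q.1, (P.flow q.1.1 q.1.2).symm q.2))
    (continuousOn_fst.prodMk P.smooth_flow_symm.continuousOn) fun q hq => ⟨hq.1, mem_univ _⟩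
  exact h1.congr fun q hq => by simp [Function.comp]

/-- The flux does not depend on the starting point, so it equals its average over M. By invariance
of the measure the flow can be dropped from this average, and integrating `hamDot` in s leaves the
means of F^1 and F^0, which vanish. The total volume is finite and nonzero. -/
theorem flux_eq_zero_of_isClosedMfd [BorelSpace M] [T2Space M] [SecondCountableTopology M]
    [ConnectedSpace M] (hc : IsClosedMfd I M) (x₀ : M) :
    ∫ s in (0 : ℝ)..1, ∫ t in (0 : ℝ)..1, hamDot P.ham s t (P.flow s t x₀) = 0 := by
  have := hc.1
  have hnorm (s : ℝ) (hs : s ∈ J) (t : ℝ) (ht : t ∈ J) :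
      ∫ x, P.ham s t x ∂(liouville σ) = 0 := by
    rcases P.normalized s hs with ⟨-, h⟩ | ⟨h, -⟩
    · exact h t ht
    · exact absurd hc h
  have hint (s : ℝ) (hs : s ∈ J) (t : ℝ) (ht : t ∈ J) : Integrable (P.ham s t) (liouville σ) :=
    integrable_liouville ((P.generates s hs).smooth_ham.contMDiff ht).continuous
  have hcont := P.continuousOn_hamDot
  have e1 : ∫ x, (∫ s in (0 : ℝ)..1, ∫ t in (0 : ℝ)..1, hamDot P.ham s t x) ∂(liouville σ) = 0 := by
    have e2 (x : M) : ∫ s in (0 : ℝ)..1, ∫ t in (0 : ℝ)..1, hamDot P.ham s t x =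
        ∫ t in (0 : ℝ)..1, (P.ham 1 t x - P.ham 0 t x) := by
      rw [integral_swap_J (D := fun s t => hamDot P.ham s t x)
        (continuousOn_fderivWithin_Sq (P.isHamFamily.contDiffOn_ham x) (1, 0))]
      exact integral_J_congr fun t ht => P.isHamFamily.integral_hamDot ht x
    simp only [e2]
    rw [← integral_swap_liouville (g := fun t x => P.ham 1 t x - P.ham 0 t x)]
    · rw [integral_J_congr (g := fun _ => 0) fun t ht => by
        rw [integral_sub (hint 1 one_mem_J t ht) (hint 0 zero_mem_J t ht), hnorm 1 one_mem_J t ht,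
          hnorm 0 zero_mem_J t ht, sub_zero]]
      simp
    · exact (P.generates 1 one_mem_J).smooth_ham.continuousOn.sub
        (P.generates 0 zero_mem_J).smooth_ham.continuousOn
  rw [← integral_integral_swap_liouville hcont] at e1
  have e3 : ∫ s in (0 : ℝ)..1, ∫ t in (0 : ℝ)..1, ∫ x, hamDot P.ham s t x ∂(liouville σ) =
      ∫ s in (0 : ℝ)..1, ∫ t in (0 : ℝ)..1,
        ∫ x, hamDot P.ham s t (P.flow s t x) ∂(liouville σ) :=
    integral_J_congr fun s hs => integral_J_congr fun t ht =>
      (integral_comp_isSymplectic (P.isHamFamily.isSymplectic hs ht) (hamDot P.ham s t)).symm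
  rw [e3, integral_integral_swap_liouville (g := fun s t x => hamDot P.ham s t (P.flow s t x))
    P.isHamFamily.continuousOn_hamDot_flow] at e1
  have e4 (x : M) : ∫ s in (0 : ℝ)..1, ∫ t in (0 : ℝ)..1, hamDot P.ham s t (P.flow s t x) =
      ∫ s in (0 : ℝ)..1, ∫ t in (0 : ℝ)..1, hamDot P.ham s t (P.flow s t x₀) :=
    integral_J_congr fun s hs => P.integral_hamDot_const hs x x₀
  simp only [e4] at e1
  rw [integral_const, smul_eq_mul] at e1
  have : Nonempty M := ⟨x₀⟩
  exact (mul_eq_zero.1 e1).resolve_left liouville_real_pos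

theorem support_of_not_isClosedMfd (hc : ¬ IsClosedMfd I M) {s : ℝ} (hs : s ∈ J) :
    ∃ K : Set M, IsCompact K ∧ K ⊆ I.interior M ∧ ∀ t ∈ J, ∀ x, x ∉ K → P.ham s t x = 0 := by
  rcases P.normalized s hs with ⟨h, -⟩ | ⟨-, h⟩
  · exact absurd h hc
  · exact h

/-- Boundary points stay on the boundary under the flow, and every support lies in the interior,
whatever the value of s. So no uniformity of the supports in s is needed. -/
theorem flux_eq_zero_of_boundary {x : M} (hx : x ∈ I.boundary M) {s : ℝ} (hs : s ∈ J) :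
    ∫ t in (0 : ℝ)..1, hamDot P.ham s t (P.flow s t x) = 0 := by
  have hc : ¬ IsClosedMfd I M := fun h => by simp [h.2] at hx
  rw [integral_J_congr (g := fun _ => 0) fun t ht => ?_]
  · simp
  · have h1 : P.flow s t x ∈ I.boundary M := by
      rw [← (P.flow s t).preimage_boundary (by simp)] at hx
      exact hx
    refine P.isHamFamily.hamDot_eq_zero hs ht ?_
    filter_upwards [self_mem_nhdsWithin] with s' hs'
    obtain ⟨K, -, hK, h0⟩ := P.support_of_not_isClosedMfd hc hs'
    refine h0 t ht _ fun h => ?_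
    rw [← I.compl_interior] at h1
    exact h1 (hK h)

/-- If `M` is not compact, the supports of the Hamiltonians stay in a fixed compact set for `s` in
an open dense set of parameters. -/
theorem flux_eq_zero_of_noncompact [SecondCountableTopology M] [ConnectedSpace M]
    (hM : ¬ CompactSpace M) {s : ℝ} (hs : s ∈ J) (x₀ : M) :
    ∫ t in (0 : ℝ)..1, hamDot P.ham s t (P.flow s t x₀) = 0 := by
  have hc : ¬ IsClosedMfd I M := fun h => hM h.1
  have := Manifold.locallyCompact_of_finiteDimensional (M := M) I
  let C := CompactExhaustion.choice M
  let R : ℕ → Set J := fun k => {s | ∀ t ∈ J, ∀ x, x ∉ C k → P.ham s t x = 0}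
  have hR (k : ℕ) : IsClosed (R k) := by
    -- The condition for s to lie in `R k` is an intersection of zero sets of functions continuous
    -- in s, hence closed. The sets cover [0,1] since each single support is compact, so Baire's
    -- theorem makes the union of their interiors dense.
    have : R k = ⋂ t ∈ J, ⋂ x ∈ (C k)ᶜ, {s : J | P.ham s t x = 0} := by
      ext s
      simp only [R, mem_iInter, mem_ofPred_eq, mem_compl_iff]
    rw [this]
    refine isClosed_biInter fun t ht => isClosed_biInter fun x _ => ?_
    have hcont : Continuous fun s : J => P.ham s t x :=
      (continuousOn_right (D := fun s t => P.ham s t x)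
        (P.isHamFamily.contDiffOn_ham x).continuousOn ht).domRestrict
    exact isClosed_eq hcont continuous_const
  have hcov : ⋃ k, R k = univ := eq_univ_of_forall fun s => by
    obtain ⟨K, hK, -, h0⟩ := P.support_of_not_isClosedMfd hc s.2
    obtain ⟨k, hk⟩ := C.exists_superset_of_isCompact hK
    exact mem_iUnion.2 ⟨k, fun t ht x hx => h0 t ht x fun h => hx (hk h)⟩
  have hdense := dense_iUnion_interior_of_closed hR hcov
  have hzero : EqOn (fun s : J => ∫ t in (0 : ℝ)..1, hamDot P.ham s t (P.flow s t x₀))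
      (fun _ => 0) (⋃ k, interior (R k)) := by
    intro s hs
    obtain ⟨k, hk⟩ := mem_iUnion.1 hs
    have hL : IsCompact ((fun q : ℝ × M => (P.flow s q.1).symm q.2) '' (J ×ˢ C k)) :=
      (isCompact_Icc.prod (C.isCompact k)).image_of_continuousOn
        ((P.generates s s.2).smooth_symm.continuousOn.mono (prod_mono subset_rfl (subset_univ _)))
    -- A starting point whose whole trajectory avoids `C k`: the points whose trajectory meets it
    -- form a compact set, which cannot be all of M.
    obtain ⟨x, hx⟩ : ∃ x, x ∉ (fun q : ℝ × M => (P.flow s q.1).symm q.2) '' (J ×ˢ C k) := by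
      by_contra! h
      exact hM ⟨eq_univ_of_forall h ▸ hL⟩
    refine (P.integral_hamDot_const s.2 x₀ x).trans ?_
    rw [integral_J_congr (g := fun _ => 0) fun t ht => ?_]
    · simp
    · have hx' : P.flow s t x ∉ C k := fun h =>
        hx ⟨(t, P.flow s t x), ⟨ht, h⟩, (P.flow s t).symm_apply_apply x⟩
      refine P.isHamFamily.hamDot_eq_zero s.2 ht ?_
      rw [← map_nhds_subtype_val s, Filter.eventually_map]
      filter_upwards [isOpen_interior.mem_nhds hk] with s' hs'
      exact interior_subset hs' t ht _ hx'
  have hcont : Continuous fun s : J => ∫ t in (0 : ℝ)..1, hamDot P.ham s t (P.flow s t x₀) :=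
    (continuousOn_integral_J (D := fun s t => hamDot P.ham s t (P.flow s t x₀))
      (P.isHamFamily.continuousOn_hamDot_flow.comp (f := fun p : ℝ × ℝ => (p, x₀))
        (by fun_prop) fun p hp => ⟨hp, mem_univ _⟩)).domRestrict
  exact congrFun (Continuous.ext_on hdense hcont continuous_const hzero) ⟨s, hs⟩

/-- The normalization of the Hamiltonians leaves no constant of integration. -/
theorem flux_eq_zero [BorelSpace M] [T2Space M] [SecondCountableTopology M]
    [ConnectedSpace M] (x : ℝ → M) :
    ∫ s in (0 : ℝ)..1, ∫ t in (0 : ℝ)..1, hamDot P.ham s t (P.flow s t (x s)) = 0 := by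
  obtain ⟨x₀⟩ := ‹ConnectedSpace M›.toNonempty
  rw [integral_J_congr fun s hs => P.integral_hamDot_const hs (x s) x₀]
  by_cases hc : IsClosedMfd I M
  · exact P.flux_eq_zero_of_isClosedMfd hc x₀
  · rw [integral_J_congr (g := fun _ => 0) fun s hs => ?_]
    · simp
    · by_cases hM : CompactSpace M
      · obtain ⟨x, hx⟩ : (I.boundary M).Nonempty := by
          by_contra h
          exact hc ⟨hM, not_nonempty_iff_eq_empty.1 h⟩
        rw [P.integral_hamDot_const hs x₀ x, P.flux_eq_zero_of_boundary hx hs]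
      · exact P.flux_eq_zero_of_noncompact hM hs x₀

end HamHomotopy

end Flux

/-! ### Action, critical points and spectrum under the lifting -/

section Spectrum

variable {n : ℕ} {H : Type*} [TopologicalSpace H] {I : ModelWithCorners ℝ (E n) H}
  {M : Type*} [TopologicalSpace M] [ChartedSpace H M] [IsManifold I ∞ M]
  {σ : SymplecticForm I M} {F G : ℝ → M → ℝ}

theorem IsHamOrbit.congr {z : ℝ → M} (hz : IsHamOrbit σ F z) (e : ∀ t ∈ J, F t = G t) :
    IsHamOrbit σ G z :=
  ⟨hz.1, fun t ht v => by rw [← e t ht]; exact hz.2 t ht v⟩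

theorem crit_congr (e : ∀ t ∈ J, F t = G t) : crit σ F = crit σ G := by
  ext x
  exact ⟨fun ⟨u, hu, h⟩ => ⟨u, hu, h.congr e⟩,
    fun ⟨u, hu, h⟩ => ⟨u, hu, h.congr fun t ht => (e t ht).symm⟩⟩

theorem action_congr (e : ∀ t ∈ J, F t = G t) : action σ F = action σ G := by
  funext x
  induction x using Quot.ind with
  | mk u => exact congrArg (- area σ u - ·) (integral_J_congr fun t ht => by rw [e t ht])

namespace HamHomotopy

variable [MeasurableSpace M] {φ : M ≃ₘ⟮I, I⟯ M} (P : HamHomotopy σ φ G F)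

theorem generates_flow_one : Generates σ F (P.flow 1) :=
  (P.generates 1 one_mem_J).congr P.ham_one

theorem generates_flow_zero : Generates σ G (P.flow 0) :=
  (P.generates 0 zero_mem_J).congr P.ham_zero

theorem isHamOrbit_liftPair {u : CappedLoop I M} (hu : IsHamOrbit σ G u.loop) :
    IsHamOrbit σ F (P.liftPair u).loop :=
  P.generates_flow_one.isHamOrbit_transfer P.generates_flow_zero hu

theorem isHamOrbit_unliftPair {u : CappedLoop I M} (hu : IsHamOrbit σ F u.loop) :
    IsHamOrbit σ G (P.unliftPair u).loop :=
  P.generates_flow_zero.isHamOrbit_transfer P.generates_flow_one hu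

theorem generates_loop :
    Generates σ (fun t x => F t x - G t ((P.loop t).symm x)) P.loop :=
  P.generates_flow_one.comp_symm P.generates_flow_zero

variable [BorelSpace M] [T2Space M] [SecondCountableTopology M] [ConnectedSpace M]

theorem area_liftPair_eq (u : CappedLoop I M) :
    area σ (P.liftPair u) = area σ u -
      ((∫ t in (0 : ℝ)..1, F t ((P.liftPair u).loop t)) - ∫ t in (0 : ℝ)..1, G t (u.loop t)) := by
  have h := P.area_liftPair u
  rw [P.flux_eq_zero fun s => (P.flow 0 0).symm (u.disc (s, 0))] at h
  linarith

/-- The correction in the area formula depends only on the boundary loops, so two discs on the same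
loop change their areas by the same amount. -/
theorem gammaEquiv_liftPair {u u' : CappedLoop I M} (h : GammaEquiv σ u u') :
    GammaEquiv σ (P.liftPair u) (P.liftPair u') := by
  obtain ⟨h, ha, hc⟩ := h
  have hl : ∀ t ∈ J, (P.liftPair u).loop t = (P.liftPair u').loop t := fun t ht =>
    P.isSympDisk_disk.act_loop_eq (h t ht)
  refine ⟨hl, ?_, P.isSympDisk_disk.hasChernNumber h hc⟩
  rw [P.area_liftPair_eq, P.area_liftPair_eq,
    integral_J_congr (f := fun t => G t (u.loop t)) fun t ht => by rw [h t ht],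
    integral_J_congr (f := fun t => F t ((P.liftPair u).loop t)) fun t ht => by rw [hl t ht]]
  linarith

theorem gammaEquiv_unliftPair {u u' : CappedLoop I M} (h : GammaEquiv σ u u') :
    GammaEquiv σ (P.unliftPair u) (P.unliftPair u') := by
  obtain ⟨h, ha, hc⟩ := h
  have hl : ∀ t ∈ J, (P.unliftPair u).loop t = (P.unliftPair u').loop t := fun t ht =>
    P.isSympDisk_disk_symm.act_loop_eq (h t ht)
  refine ⟨hl, ?_, P.isSympDisk_disk_symm.hasChernNumber h hc⟩
  have e := P.area_liftPair_eq (P.unliftPair u)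
  have e' := P.area_liftPair_eq (P.unliftPair u')
  rw [P.liftPair_unliftPair] at e e'
  rw [integral_J_congr (f := fun t => G t ((P.unliftPair u).loop t)) fun t ht => by rw [hl t ht],
    integral_J_congr (f := fun t => F t (u.loop t)) fun t ht => by rw [h t ht]] at e
  linarith

/-- The canonical lifting of the loop `h`. -/
def lift : GammaCover σ → GammaCover σ :=
  Quot.map P.liftPair fun _ _ => P.gammaEquiv_liftPair

/-- The inverse of the canonical lifting. -/
def unlift : GammaCover σ → GammaCover σ :=
  Quot.map P.unliftPair fun _ _ => P.gammaEquiv_unliftPair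

theorem unlift_lift (x : GammaCover σ) : P.unlift (P.lift x) = x := by
  induction x using Quot.ind with
  | mk u => exact congrArg (GammaCover.mk σ) (P.unliftPair_liftPair u)

theorem action_lift (x : GammaCover σ) : action σ F (P.lift x) = action σ G x := by
  induction x using Quot.ind with
  | mk u =>
    change - area σ (P.liftPair u) - (∫ t in (0 : ℝ)..1, F t ((P.liftPair u).loop t)) =
      - area σ u - ∫ t in (0 : ℝ)..1, G t (u.loop t)
    rw [P.area_liftPair_eq]
    ring

theorem bijOn_lift : BijOn P.lift (crit σ G) (crit σ F) := by
  refine ⟨?_, fun x _ y _ h => ?_, ?_⟩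
  · rintro _ ⟨u, rfl, hu⟩
    exact ⟨P.liftPair u, rfl, P.isHamOrbit_liftPair hu⟩
  · rw [← P.unlift_lift x, h, P.unlift_lift]
  · rintro _ ⟨u, rfl, hu⟩
    exact ⟨GammaCover.mk σ (P.unliftPair u), ⟨_, rfl, P.isHamOrbit_unliftPair hu⟩,
      congrArg (GammaCover.mk σ) (P.liftPair_unliftPair u)⟩

theorem spec_eq (P : HamHomotopy σ φ G F) : spec σ F = spec σ G := by
  rw [spec, ← P.bijOn_lift.image_eq, image_image]
  exact image_congr fun x _ => P.action_lift x

variable {P} in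
-- F_t - G_t∘h_t⁻¹ is normalized and generates h, so by uniqueness it agrees with every other
-- normalized generator of h at times in [0,1].
theorem hash_eq (hF : IsNormalized σ F) (hG : IsNormalized σ G) {K : ℝ → M → ℝ}
    (hK : IsNormalized σ K) (hgen : Generates σ K P.loop) {t : ℝ} (ht : t ∈ J) :
    F t = hash K P.loop G t := by
  funext x
  have h := congrFun (hK.eq_of_generates
    (hF.comp_symm hG P.generates_flow_one P.generates_flow_zero) hgen P.generates_loop ht) x
  rw [hash, h]
  exact (sub_add_cancel _ _).symm

end HamHomotopy

end Spectrum

end HamSpec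

end

theorem theoremI {n : ℕ} {H : Type*} [TopologicalSpace H]
    (I : ModelWithCorners ℝ (HamSpec.E n) H)
    {M : Type*} [TopologicalSpace M] [T2Space M] [SecondCountableTopology M] [ConnectedSpace M]
    [ChartedSpace H M] [IsManifold I ∞ M] [MeasurableSpace M] [BorelSpace M]
    (σ : HamSpec.SymplecticForm I M) (φ : M ≃ₘ⟮I, I⟯ M)
    (F G : ℝ → M → ℝ)
    (hF : F ∈ HamSpec.normalizedHam σ φ) (hG : G ∈ HamSpec.normalizedHam σ φ)
    (P : HamSpec.HamHomotopy σ φ G F) :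
    (∃ lift : HamSpec.GammaCover σ → HamSpec.GammaCover σ,
      (∀ u : HamSpec.CappedLoop I M,
        lift (HamSpec.GammaCover.mk σ u) = HamSpec.GammaCover.mk σ (P.liftPair u)) ∧
      (∃ K : ℝ → M → ℝ, HamSpec.IsNormalized σ K ∧ HamSpec.Generates σ K P.loop) ∧
      (∀ K : ℝ → M → ℝ, HamSpec.IsNormalized σ K → HamSpec.Generates σ K P.loop →
        (∀ x : HamSpec.GammaCover σ,
          HamSpec.action σ (HamSpec.hash K P.loop G) (lift x) = HamSpec.action σ G x) ∧
        Set.BijOn lift (HamSpec.crit σ G) (HamSpec.crit σ (HamSpec.hash K P.loop G)))) ∧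
    HamSpec.spec σ F = HamSpec.spec σ G := by
  refine ⟨⟨P.lift, fun u => rfl, ⟨_, hF.1.comp_symm hG.1 P.generates_flow_one
    P.generates_flow_zero, P.generates_loop⟩, fun K hK hgen => ?_⟩, P.spec_eq⟩
  -- Action and critical points see the Hamiltonian only at times in [0,1], where K # G is F.
  have e : ∀ t ∈ HamSpec.J, F t = HamSpec.hash K P.loop G t := fun t ht =>
    HamSpec.HamHomotopy.hash_eq hF.1 hG.1 hK hgen ht
  rw [← HamSpec.action_congr e, ← HamSpec.crit_congr e]
  exact ⟨P.action_lift, P.bijOn_lift⟩
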